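/- Let $m\ge 1$, $T>0$, $R>0$, $\alpha>0$, and let $B_R\subset\mathbb R^m$ be the closed Euclidean ball of centre $0$ and radius $R$. *Exponents.* Let $b,\sigma\in\mathbb R$ and let $\nu$ be a Lévy measure on $\mathbb R\setminus\{0\}$ ($\int\min(1,x^2)\,\nu(dx)<\infty$). Put $\varphi(q)=ibq-\tfrac12\sigma^2q^2+\int(e^{iqx}-1-iq\sin x)\,\nu(dx)$ and $\psi(q)=\varphi(-iq)$ whenever this makes sense. Assume $\psi(1)=0$, $\psi(2)<\infty$ and $\int_{[-1,1]}|x|\,\nu(dx)<\infty$. *The process.* Let $G=\{M\in M_m(\mathbb R): MM^t=I\}$ with its right-invariant Haar probability measure $H$, let $S=\{(t,y):t\in\mathbb R,\ y>0\}$ with $\theta(dt,dy)=y^{-2}\,dt\,dy$, and let $\mu$ be an independently scattered infinitely divisible random measure on $G\times S$ associated to $(\varphi,H\otimes\theta)$, on a probability space $(\Omega,\mathbb P)$: for Borel sets $A$ of finite measure $\mathbb E[e^{iq\mu(A)}]=e^{\varphi(q)\,H\otimes\theta(A)}$ for real $q$, the values on disjoint sets are independent, and $\mu$ is almost surely countably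 additive along each sequence of disjoint sets whose union has finite measure. For $0<l<T$ and $x\in\mathbb R^m$ let $C_l(x)$ be the set of all $(g,s,y)\in G\times S$ with $y\ge l$ and $|s-(gx)_1|\le\tfrac12\min(y,T)$, where $(gx)_1$ is the first coordinate of $gx$, and let $\omega_l(x)=\mu(C_l(x))$, where we take a version that is measurable in $(x,\text{chance})$ for each $l$ and such that almost surely $l\mapsto\omega_l(x)$ is left-continuous on $(0,T)$ for every $x$ (that is, right-continuous as $l$ decreases). *The class $R^e_\alpha$.* Let $B\subset B_R$ be a Borel set and let $\kappa$ be a probability measure on $B_R$ with $\kappa(B)=1$. Let $C$ be the completion of $B$ for the Euclidean distance, that is, its closure. Then $\kappa\in R^e_\alpha$ means: for every $\varepsilon>0$ there are $\delta>0$, $D>0$ and a compact set $K\subset C$ such that $\kappa(C\setminus K)<\varepsilon$ and $\kappa(K\cap U)\le D\,\mathrm{Diam}(U)^{\alpha+\delta}$ for every open ball $U$ of $C$. **Proposition.** Let $N_l(dx)=e^{\omega_l(x)}\,\kappa(dx)$ for $0<l<T$, and assume $\kappa\in R^e_\alpha$ and $\psi(2)<\alpha$. Then $(N_l(B))_{0<l<T}$,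 indexed by decreasing $l$, is a martingale and is uniformly integrable. Almost surely $N_l$ converges weakly as $l\to0^+$ to a finite measure $N$, which may be chosen as a random measure. The limit $N$ is non-trivial, i.e. $\mathbb P(N\neq0)>0$, and indeed $\mathbb E[N(B)]=1$; and $N$ is almost surely supported by $B$, i.e. $N(\mathbb R^m\setminus B)=0$ almost surely. -/

import Mathlib

open MeasureTheory ProbabilityTheory Filter Topology Set
open scoped ENNReal NNReal BoundedContinuousFunction

noncomputable section

namespace MRM

/-! ### Characteristic and Laplace exponents -/

/-- The data `(b, σ, ν)` of the Lévy-Khintchine formula; `ν` is a Lévy measure on `ℝ \ {0}`. -/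
structure LevyTriplet where
  b : ℝ
  σ : ℝ
  ν : Measure ℝ
  ν_zero : ν {0} = 0
  ν_lintegral : ∫⁻ x, ENNReal.ofReal (min 1 (x ^ 2)) ∂ν < ∞

/-- The Lévy-Khintchine exponent
`φ(q) = i b q - σ² q² / 2 + ∫ (exp(i q x) - 1 - i q sin x) ν(dx)`. -/
def LevyTriplet.φ (L : LevyTriplet) (q : ℂ) : ℂ :=
  Complex.I * L.b * q - (L.σ : ℂ) ^ 2 * q ^ 2 / 2
    + ∫ x : ℝ, (Complex.exp (Complex.I * q * x) - 1 - Complex.I * q * (Real.sin x : ℂ)) ∂L.ν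

/-- The Laplace exponent `ψ(q) = φ(-iq)`, for real `q`. Its value is real; it is meaningful when
`L.PsiFinite q` holds. -/
def LevyTriplet.ψ (L : LevyTriplet) (q : ℝ) : ℝ := (L.φ (-(Complex.I * q))).re

/-- `ψ(q) < +∞`: the integral in the definition of `ψ(q)` converges absolutely. -/
def LevyTriplet.PsiFinite (L : LevyTriplet) (q : ℝ) : Prop :=
  Integrable (fun x : ℝ => Real.exp (q * x) - 1 - q * Real.sin x) L.ν

/-! ### Independently scattered infinitely divisible random measures -/

/-- `μ` is an independently scattered infinitely divisible random measure associated to `(φ, Λ)`,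
defined on the measurable sets of finite `Λ`-measure: `μ A` is a random variable with
`E[exp(i q μ(A))] = exp(φ(q) Λ(A))`, the values on pairwise disjoint sets are independent,
and `μ` is almost surely countably additive along each given sequence of disjoint sets
(convergence is that of the partial sums, as it need not be absolute). -/
structure IsIndepScattered {Ω E : Type*} [MeasurableSpace Ω] [MeasurableSpace E]
    (P : Measure Ω) (φ : ℂ → ℂ) (Λ : Measure E) (μ : Set E → Ω → ℝ) : Prop where
  measurable : ∀ A, MeasurableSet A → Λ A < ∞ → Measurable (μ A)
  law : ∀ A, MeasurableSet A → Λ A < ∞ → ∀ q : ℝ,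
    ∫ w, Complex.exp (Complex.I * q * μ A w) ∂P = Complex.exp (φ q * (Λ A).toReal)
  indep : ∀ A : ℕ → Set E, (∀ n, MeasurableSet (A n)) → (∀ n, Λ (A n) < ∞) →
    Pairwise (fun i j => Disjoint (A i) (A j)) → iIndepFun (fun n => μ (A n)) P
  additive : ∀ A : ℕ → Set E, (∀ n, MeasurableSet (A n)) → Λ (⋃ n, A n) < ∞ →
    Pairwise (fun i j => Disjoint (A i) (A j)) →
    ∀ᵐ w ∂P, Tendsto (fun n => ∑ i ∈ Finset.range n, μ (A i) w) atTop (𝓝 (μ (⋃ n, A n) w))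

/-! ### The cone construction -/

/-- The group `G` of real matrices `M` with `M Mᵗ = I`. -/
abbrev G (m : ℕ) := Matrix.orthogonalGroup (Fin m) ℝ

instance (m : ℕ) : MeasurableSpace (G m) := borel (G m)

instance (m : ℕ) : BorelSpace (G m) := ⟨rfl⟩

/-- The half-space `S = {(t, y) : t ∈ ℝ, y > 0}`. -/
abbrev S := {p : ℝ × ℝ // 0 < p.2}

/-- The measure `θ(dt, dy) = y⁻² dt dy` on `S`. -/
def θ : Measure S :=
  ((volume : Measure (ℝ × ℝ)).withDensity
    (fun p => ENNReal.ofReal ((p.2 ^ 2)⁻¹))).comap Subtype.val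

/-- `A_l(t) = {(s, y) ∈ S : y ≥ l, -f(y)/2 ≤ s - t ≤ f(y)/2}` with `f(y) = min(y, T)`. -/
def coneA (T l t : ℝ) : Set S :=
  {p | l ≤ p.1.2 ∧ -(min p.1.2 T) / 2 ≤ p.1.1 - t ∧ p.1.1 - t ≤ min p.1.2 T / 2}

/-- `x₁ᵍ`, the first coordinate of the vector `g x`. -/
def firstCoord {m : ℕ} [NeZero m] (g : G m) (x : EuclideanSpace ℝ (Fin m)) : ℝ :=
  Matrix.mulVec g.1 x.ofLp 0

/-- The cone product `C_l(x) = {(g, t, y) : (t, y) ∈ A_l(x₁ᵍ)}`. -/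
def cone {m : ℕ} [NeZero m] (T l : ℝ) (x : EuclideanSpace ℝ (Fin m)) : Set (G m × S) :=
  {p | p.2 ∈ coneA T l (firstCoord p.1 x)}

/-- `om` is a version of the process `ω_l(x) = μ(C_l(x))`, `0 < l < T`, `x ∈ ℝᵐ`: for given `l` and
`x` the equality holds almost surely, the version is measurable in `(x, w)` for each `l`, and it is
regular in the scale parameter (`l` runs from `T` down to `0` and `l ↦ A_l(t)` is continuous from
the left, so that right-continuity along the direction of time is left-continuity in `l`). -/
structure IsOmega {Ω : Type*} [MeasurableSpace Ω] {m : ℕ} [NeZero m] (P : Measure Ω) (T : ℝ)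
    (μ : Set (G m × S) → Ω → ℝ) (om : ℝ → EuclideanSpace ℝ (Fin m) → Ω → ℝ) : Prop where
  ae_eq : ∀ l ∈ Ioo 0 T, ∀ x, om l x =ᵐ[P] μ (cone T l x)
  measurable : ∀ l ∈ Ioo 0 T,
    Measurable (fun p : EuclideanSpace ℝ (Fin m) × Ω => om l p.1 p.2)
  regular : ∀ᵐ w ∂P, ∀ x, ∀ l ∈ Ioo 0 T, ContinuousWithinAt (fun r => om r x w) (Iic l) l

/-! ### The chaos -/

/-- `N_l(dx) = exp(ω_l(x)) κ(dx)`. -/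
def chaos {Ω E : Type*} [MeasurableSpace E] (κ : Measure E) (om : ℝ → E → Ω → ℝ)
    (l : ℝ) (w : Ω) : Measure E :=
  κ.withDensity (fun x => ENNReal.ofReal (Real.exp (om l x w)))

/-- `N` is, almost surely, a finite measure and the weak limit of `N_l` as `l → 0+`. -/
structure IsChaosLimit {Ω E : Type*} [MeasurableSpace Ω] [TopologicalSpace E] [MeasurableSpace E]
    (P : Measure Ω) (κ : Measure E) (om : ℝ → E → Ω → ℝ) (N : Ω → Measure E) : Prop where
  finite : ∀ᵐ w ∂P, IsFiniteMeasure (N w)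
  tendsto : ∀ᵐ w ∂P, ∀ f : E →ᵇ ℝ≥0,
    Tendsto (fun l => ∫⁻ x, f x ∂(chaos κ om l w)) (𝓝[>] 0) (𝓝 (∫⁻ x, f x ∂(N w)))

/-! ### The regularity classes -/

/-- The class `R_α` of measures `ν` on a metric space `C`: for any `ε > 0` there are `δ, D > 0` and
a compact set `K` with `ν(C \ K) < ε` and `ν(K ∩ U) ≤ D Diam(U)^(α+δ)` for all open balls `U`. -/
def ClassR {C : Type*} [MetricSpace C] [MeasurableSpace C] (α : ℝ) (ν : Measure C) : Prop :=
  ∀ ε : ℝ, 0 < ε → ∃ δ : ℝ, 0 < δ ∧ ∃ D : ℝ, 0 < D ∧ ∃ K : Set C, IsCompact K ∧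
    ν Kᶜ < ENNReal.ofReal ε ∧
    ∀ (x : C) (r : ℝ), 0 < r →
      (ν.restrict K) (Metric.ball x r) ≤
        ENNReal.ofReal D * Metric.ediam (Metric.ball x r) ^ (α + δ)

/-- The class `R_α^e` of measures `κ` carried by a bounded Borel set `B ⊆ ℝᵐ`: the completion of `B`
for the Euclidean distance is its closure, and `κ` is viewed as a measure on this closure. -/
def ClassRe {m : ℕ} (α : ℝ) (B : Set (EuclideanSpace ℝ (Fin m)))
    (κ : Measure (EuclideanSpace ℝ (Fin m))) : Prop :=
  ClassR α (κ.comap (Subtype.val : closure B → EuclideanSpace ℝ (Fin m)))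

end MRM

end

open MeasureTheory ProbabilityTheory Filter Topology Set
open scoped ENNReal NNReal BoundedContinuousFunction

noncomputable section

namespace MRM

/-! ### Exponential moments from an analytic continuation of the characteristic function -/

section Strip

/-! Write `Λ` for `H ⊗ θ`. The proof rests on the moments `E[exp(μ A)] = 1` and `E[exp(2 μ A)] =
exp(ψ(2) Λ(A))`. Since only the characteristic function of `μ A` is given, it is continued to the
strip `0 ≤ re z ≤ 2`, where the exponent makes sense because `ψ(2)` is finite and `|x|` is
`ν`-integrable near `0`. A Gaussian regularization and a contour shift then yield the moments
(`lintegral_exp_eq_of_strip`, `LevyTriplet.lintegral_exp_eq`).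

For fixed `x`, lowering the scale multiplies `exp(ω_l(x))` by an independent factor of mean one,
hence a martingale; Fubini carries this over to integrals against `κ`. The two-point function is
`exp(ψ(2) Λ(C_l(x) ∩ C_l(y)))`. Two cones over the points `s` and `t` of the line meet only above
height `|s - t|`, so the mass of their intersection is at most `1 + log(T / |s - t|)`. Averaged over
the rotations this becomes `log⁺(T / ‖x - y‖)` up to a constant, because the logarithm of the first
coordinate of a random unit vector is integrable (`exists_lintegral_invSqrt_le`). The two-point
function is therefore at most `C (1 + ‖x - y‖^(-ψ(2)⁺))` uniformly in `l`. As `ψ(2) < α`, the class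
`R_α^e` provides compact sets `K` of nearly full measure on which this kernel has bounded potential,
so the mass of `K` is bounded in `L²`. The rest of `κ` has small expected mass at every scale. The
martingales are thus Cauchy in `L¹`, hence uniformly integrable
(`exists_integral_abs_chaosInt_sub_le`).

These facts are collected in `IsMartingaleField`, and what follows uses nothing else about cones.
Doob's inequalities on countable dense sets of scales, together with left-continuity in `l`, give
almost sure convergence along all scales for each bounded test function. Since `κ` lives on a
compact ball, the test functions `cos ⟨x, t⟩` and `sin ⟨x, t⟩` with `t` in a countable dense set are
enough for weak convergence (`exists_weak_limit`).

No mass is lost: `E[N(ℝᵐ)] = 1` by `L¹` convergence, while `E[N(K)] ≥ κ(K)` for compact `K ⊆ B`,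
since weak limits do not lose mass on closed sets. Inner regularity gives `E[N(B)] = 1`, and nothing
remains for the complement of `B`. -/

/-- The real part of `(z - c)²` is `(re z - c)² - (im z)²`: the factor decays like a Gaussian along
vertical lines and grows by a bounded amount across the strip. -/
lemma norm_mul_gaussian_le {W : ℂ → ℂ} {c s M : ℝ} (hc : 0 < c)
    (hWb : ∀ z : ℂ, z.re ∈ Icc 0 c → ‖W z‖ ≤ M) {z : ℂ} (hz : z.re ∈ Icc 0 c) :
    ‖W z * Complex.exp ((z - c) ^ 2 / (2 * s ^ 2))‖
      ≤ M * Real.exp (c ^ 2 / (2 * s ^ 2)) * Real.exp (-(2 * s ^ 2)⁻¹ * z.im ^ 2) := by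
  have hM : 0 ≤ M := (norm_nonneg _).trans (hWb z hz)
  have hre : ((z - c) ^ 2 / (2 * (s : ℂ) ^ 2)).re = ((z.re - c) ^ 2 - z.im ^ 2) / (2 * s ^ 2) := by
    have h1 : (2 * (s : ℂ) ^ 2) = ((2 * s ^ 2 : ℝ) : ℂ) := by push_cast; ring
    rw [h1, Complex.div_ofReal_re]
    congr 1
    simp [pow_two]
  rw [norm_mul, Complex.norm_exp, hre, mul_assoc, ← Real.exp_add]
  gcongr
  · exact hWb z hz
  · have : (z.re - c) ^ 2 ≤ c ^ 2 := by nlinarith [hz.1, hz.2]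
    calc ((z.re - c) ^ 2 - z.im ^ 2) / (2 * s ^ 2) ≤ (c ^ 2 - z.im ^ 2) / (2 * s ^ 2) := by gcongr
      _ = _ := by ring

lemma continuousOn_strip_mul_gaussian {W : ℂ → ℂ} {c s : ℝ}
    (hWc : ContinuousOn W {z | z.re ∈ Icc 0 c}) :
    ContinuousOn (fun z => W z * Complex.exp ((z - c) ^ 2 / (2 * s ^ 2))) {z | z.re ∈ Icc 0 c} :=
  hWc.mul (by fun_prop)

lemma integrable_vertical {W : ℂ → ℂ} {c s M : ℝ} (hc : 0 < c) (hs : 0 < s)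
    (hWc : ContinuousOn W {z | z.re ∈ Icc 0 c})
    (hWb : ∀ z : ℂ, z.re ∈ Icc 0 c → ‖W z‖ ≤ M) {a : ℝ} (ha : a ∈ Icc 0 c) :
    Integrable (fun y : ℝ => W (a + y * Complex.I) *
      Complex.exp (((a + y * Complex.I) - c) ^ 2 / (2 * s ^ 2))) := by
  have hmem : ∀ y : ℝ, ((a : ℂ) + y * Complex.I).re ∈ Icc 0 c := by intro y; simpa using ha
  have hcont : Continuous (fun y : ℝ => W (a + y * Complex.I) *
      Complex.exp (((a + y * Complex.I) - c) ^ 2 / (2 * s ^ 2))) :=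
    (continuousOn_strip_mul_gaussian (s := s) hWc).comp_continuous
      (f := fun y : ℝ => (a : ℂ) + y * Complex.I) (by fun_prop) hmem
  refine Integrable.mono' (g := fun y => M * Real.exp (c ^ 2 / (2 * s ^ 2)) *
    Real.exp (-(2 * s ^ 2)⁻¹ * y ^ 2)) ?_ hcont.aestronglyMeasurable ?_
  · exact (integrable_exp_neg_mul_sq (by positivity)).const_mul _
  · refine ae_of_all _ fun y => ?_
    simpa using norm_mul_gaussian_le (s := s) hc hWb (hmem y)

lemma tendsto_horizontal {W : ℂ → ℂ} {c s M : ℝ} (hc : 0 < c) (hs : 0 < s)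
    (hWb : ∀ z : ℂ, z.re ∈ Icc 0 c → ‖W z‖ ≤ M) (e : ℝ) (he : e ^ 2 = 1) :
    Tendsto (fun A : ℝ => ∫ x in (0 : ℝ)..c, W (x + (e * A : ℝ) * Complex.I) *
      Complex.exp (((x + (e * A : ℝ) * Complex.I) - c) ^ 2 / (2 * s ^ 2))) atTop (𝓝 0) := by
  have hb : Tendsto (fun A : ℝ => (M * Real.exp (c ^ 2 / (2 * s ^ 2)) *
      Real.exp (-(2 * s ^ 2)⁻¹ * A ^ 2)) * |c - 0|) atTop (𝓝 0) := by
    have h1 : Tendsto (fun A : ℝ => -(2 * s ^ 2)⁻¹ * A ^ 2) atTop atBot :=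
      (tendsto_pow_atTop two_ne_zero).const_mul_atTop_of_neg (by
        have : 0 < (2 * s ^ 2)⁻¹ := by positivity
        linarith)
    have h2 := Real.tendsto_exp_atBot.comp h1
    have h3 := (h2.const_mul (M * Real.exp (c ^ 2 / (2 * s ^ 2)))).mul_const |c - 0|
    simpa using h3
  refine squeeze_zero_norm (fun A => ?_) hb
  refine intervalIntegral.norm_integral_le_of_norm_le_const fun x hx => ?_
  rw [uIoc_of_le hc.le] at hx
  have := norm_mul_gaussian_le (s := s) hc hWb (z := x + (e * A : ℝ) * Complex.I)
    (by simpa using ⟨hx.1.le, hx.2⟩)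
  refine this.trans (le_of_eq ?_)
  have h4 : ((x : ℂ) + (e * A : ℝ) * Complex.I).im ^ 2 = A ^ 2 := by
    simp [mul_pow, he]
  rw [h4]

/-- Cauchy's theorem on the rectangles `[0, c] × [-A, A]`; the Gaussian factor kills the horizontal
sides as `A → ∞`. -/
lemma integral_vertical_shift {W : ℂ → ℂ} {c s M : ℝ} (hc : 0 < c) (hs : 0 < s)
    (hWc : ContinuousOn W {z | z.re ∈ Icc 0 c})
    (hWd : DifferentiableOn ℂ W {z | z.re ∈ Ioo 0 c})
    (hWb : ∀ z : ℂ, z.re ∈ Icc 0 c → ‖W z‖ ≤ M) :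
    ∫ y : ℝ, W (c + y * Complex.I) * Complex.exp (((c + y * Complex.I) - c) ^ 2 / (2 * s ^ 2))
      = ∫ y : ℝ, W (y * Complex.I) * Complex.exp (((y * Complex.I) - c) ^ 2 / (2 * s ^ 2)) := by
  set F : ℂ → ℂ := fun z => W z * Complex.exp ((z - c) ^ 2 / (2 * s ^ 2)) with hF
  have hi1 := integrable_vertical hc hs hWc hWb (a := c) ⟨hc.le, le_rfl⟩
  have hi0 := integrable_vertical hc hs hWc hWb (a := 0) ⟨le_rfl, hc.le⟩
  have hl1 := intervalIntegral_tendsto_integral hi1 tendsto_neg_atTop_atBot tendsto_id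
  have hl0 := intervalIntegral_tendsto_integral hi0 tendsto_neg_atTop_atBot tendsto_id
  have hh1 := tendsto_horizontal hc hs hWb 1 (by norm_num)
  have hh0 := tendsto_horizontal hc hs hWb (-1) (by norm_num)
  have hrect : ∀ A : ℝ, 0 < A →
      (∫ x in (0 : ℝ)..c, F (x + ((-1) * A : ℝ) * Complex.I))
        - (∫ x in (0 : ℝ)..c, F (x + (1 * A : ℝ) * Complex.I))
        + Complex.I • (∫ y in (-A)..A, F (c + y * Complex.I))
        - Complex.I • (∫ y in (-A)..A, F ((0 : ℝ) + y * Complex.I)) = 0 := by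
    intro A hA
    have := Complex.integral_boundary_rect_eq_zero_of_continuousOn_of_differentiableOn F
      (⟨0, -A⟩ : ℂ) (⟨c, A⟩ : ℂ) ?_ ?_
    · simpa using this
    · refine (continuousOn_strip_mul_gaussian hWc).mono fun z hz => ?_
      have := hz.1
      simpa [uIcc_of_le hc.le] using this
    · refine (hWd.mul (by fun_prop)).mono fun z hz => ?_
      have := hz.1
      simpa [hc.le] using this
  have hlim := ((hh0.sub hh1).add (hl1.const_smul Complex.I)).sub (hl0.const_smul Complex.I)
  have hzero : Tendsto (fun _ : ℝ => (0 : ℂ)) atTop (𝓝 0) := tendsto_const_nhds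
  have hlim' := hlim.congr' (f₂ := fun _ => (0 : ℂ)) (by
    filter_upwards [eventually_gt_atTop 0] with A hA
    exact hrect A hA)
  have := tendsto_nhds_unique hlim' hzero
  simp only [sub_self, zero_add, smul_eq_mul] at this
  have h2 := mul_left_cancel₀ Complex.I_ne_zero (sub_eq_zero.1 this)
  simpa using h2

/-- The Fourier representation of a shifted Gaussian. -/
lemma integral_exp_mul_gaussian {c s : ℝ} (hs : 0 < s) (x : ℝ) :
    ∫ y : ℝ, Complex.exp (Complex.I * y * x) *
        Complex.exp (((y * Complex.I) - c) ^ 2 / (2 * s ^ 2))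
      = (Real.sqrt (2 * Real.pi * s ^ 2) : ℂ) * Real.exp (c * x - s ^ 2 * x ^ 2 / 2) := by
  have hs' : (s : ℂ) ≠ 0 := by exact_mod_cast hs.ne'
  have h := integral_cexp_quadratic (b := ((-(2 * s ^ 2)⁻¹ : ℝ) : ℂ)) (by
    rw [Complex.ofReal_re]
    have : 0 < (2 * s ^ 2)⁻¹ := by positivity
    linarith) (Complex.I * x - Complex.I * c / s ^ 2) (c ^ 2 / (2 * s ^ 2))
  have e1 : ∀ y : ℝ, Complex.exp (Complex.I * y * x) *
        Complex.exp (((y * Complex.I) - c) ^ 2 / (2 * s ^ 2)) =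
      Complex.exp (((-(2 * s ^ 2)⁻¹ : ℝ) : ℂ) * y ^ 2 + (Complex.I * x - Complex.I * c / s ^ 2) * y
        + c ^ 2 / (2 * s ^ 2)) := by
    intro y
    rw [← Complex.exp_add]
    congr 1
    push_cast
    field_simp
    ring_nf
    simp only [Complex.I_sq]
    ring
  simp_rw [e1]
  rw [h]
  congr 1
  · have : (Real.pi / -((-(2 * s ^ 2)⁻¹ : ℝ) : ℂ)) = ((2 * Real.pi * s ^ 2 : ℝ) : ℂ) := by
      push_cast
      field_simp
    rw [this, Real.sqrt_eq_rpow, Complex.ofReal_cpow (by positivity)]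
    norm_num
  · rw [Complex.ofReal_exp]
    congr 1
    push_cast
    field_simp
    ring_nf
    simp only [Complex.I_sq]
    ring

end Strip

/-! ### Gaussian-regularized exponential moments, and removal of the regularization. -/

section Strip

variable {Ω : Type*} [MeasurableSpace Ω] {P : Measure Ω} [IsProbabilityMeasure P] {X : Ω → ℝ}
  {W : ℂ → ℂ} {c s M : ℝ}

/-- The factor `exp(-s² X² / 2)` makes the moment finite without any prior knowledge of `X`. Its
Fourier representation turns the expectation into an integral of `W` over the imaginary axis, which
is then moved to `re z = c`. -/
lemma integral_exp_mul_sub_sq (hX : Measurable X) (hc : 0 < c) (hs : 0 < s)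
    (hWc : ContinuousOn W {z | z.re ∈ Icc 0 c})
    (hWd : DifferentiableOn ℂ W {z | z.re ∈ Ioo 0 c})
    (hWb : ∀ z : ℂ, z.re ∈ Icc 0 c → ‖W z‖ ≤ M)
    (hXW : ∀ q : ℝ, ∫ w, Complex.exp (Complex.I * q * X w) ∂P = W (q * Complex.I)) :
    ((Real.sqrt (2 * Real.pi * s ^ 2) : ℂ) *
      ∫ w, ((Real.exp (c * X w - s ^ 2 * X w ^ 2 / 2) : ℝ) : ℂ) ∂P)
      = ∫ y : ℝ, W (c + y * Complex.I) *
          Complex.exp (((c + y * Complex.I) - c) ^ 2 / (2 * s ^ 2)) := by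
  rw [integral_vertical_shift hc hs hWc hWd hWb, ← integral_const_mul]
  simp_rw [← integral_exp_mul_gaussian hs]
  rw [integral_integral_swap]
  · refine integral_congr_ae (ae_of_all _ fun y => ?_)
    simp only
    rw [integral_mul_const, hXW]
  · have hg := integrable_vertical (W := fun _ => 1) (M := 1) (c := c) hc hs continuousOn_const
      (by simp) (a := 0) ⟨le_rfl, hc.le⟩
    have hg2 := hg.comp_snd P
    refine hg2.mono ?_ (ae_of_all _ fun p => ?_)
    · refine Measurable.aestronglyMeasurable ?_
      simp only [Function.uncurry_def]
      fun_prop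
    · simp only [Function.uncurry_def, norm_mul, Complex.ofReal_zero, zero_add, one_mul]
      rw [show Complex.I * (p.2 : ℂ) * (X p.1 : ℂ) = ((p.2 * X p.1 : ℝ) : ℂ) * Complex.I by
        push_cast; ring, Complex.norm_exp_ofReal_mul_I, one_mul]

/-- On the line `re z = c` the weight is the centered Gaussian `exp(-y² / (2 s²))`, an approximate
identity. The substitution `y = s u` moves `s` into the argument of `W`, and dominated convergence
applies. -/
lemma tendsto_integral_gaussian_vertical (hc : 0 < c)
    (hWc : ContinuousOn W {z | z.re ∈ Icc 0 c})
    (hWb : ∀ z : ℂ, z.re ∈ Icc 0 c → ‖W z‖ ≤ M) {s : ℕ → ℝ} (hs : ∀ n, 0 < s n)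
    (hs0 : Tendsto s atTop (𝓝 0)) :
    Tendsto (fun n => (Real.sqrt (2 * Real.pi * s n ^ 2) : ℂ)⁻¹ *
      ∫ y : ℝ, W (c + y * Complex.I) *
          Complex.exp (((c + y * Complex.I) - c) ^ 2 / (2 * s n ^ 2))) atTop (𝓝 (W c)) := by
  have hmem : ∀ y : ℝ, ((c : ℂ) + y * Complex.I).re ∈ Icc 0 c := by intro y; simp [hc.le]
  have hcont : Continuous (fun y : ℝ => W (c + y * Complex.I)) :=
    hWc.comp_continuous (f := fun y : ℝ => (c : ℂ) + y * Complex.I) (by fun_prop) hmem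
  have hgi : Integrable (fun u : ℝ => Real.exp (-(1 / 2) * u ^ 2)) :=
    integrable_exp_neg_mul_sq (by norm_num)
  have key : ∀ n, (Real.sqrt (2 * Real.pi * s n ^ 2) : ℂ)⁻¹ *
      (∫ y : ℝ, W (c + y * Complex.I) *
          Complex.exp (((c + y * Complex.I) - c) ^ 2 / (2 * s n ^ 2))) =
      (Real.sqrt (2 * Real.pi) : ℂ)⁻¹ *
      ∫ u : ℝ, W (c + (s n * u : ℝ) * Complex.I) * (Real.exp (-(1 / 2) * u ^ 2) : ℝ) := by
    intro n
    have h1 := Measure.integral_comp_mul_left (fun y : ℝ => W (c + y * Complex.I) *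
          Complex.exp (((c + y * Complex.I) - c) ^ 2 / (2 * s n ^ 2))) (s n)
    have hsn : (s n : ℂ) ≠ 0 := by exact_mod_cast (hs n).ne'
    have h2 : ∀ u : ℝ, W (c + (s n * u : ℝ) * Complex.I) *
          Complex.exp (((c + (s n * u : ℝ) * Complex.I) - c) ^ 2 / (2 * s n ^ 2)) =
        W (c + (s n * u : ℝ) * Complex.I) * (Real.exp (-(1 / 2) * u ^ 2) : ℝ) := by
      intro u
      congr 1
      rw [Complex.ofReal_exp]
      congr 1
      push_cast
      field_simp
      ring_nf
      simp
    simp_rw [h2] at h1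
    rw [h1, abs_of_pos (by have := hs n; positivity), Real.sqrt_mul (by positivity),
      Real.sqrt_sq (hs n).le]
    simp only [Complex.real_smul]
    generalize (∫ y : ℝ, W (c + y * Complex.I) *
          Complex.exp (((c + y * Complex.I) - c) ^ 2 / (2 * s n ^ 2))) = J
    push_cast
    field_simp
  simp_rw [key]
  have hlim : Tendsto (fun n => ∫ u : ℝ, W (c + (s n * u : ℝ) * Complex.I) *
      (Real.exp (-(1 / 2) * u ^ 2) : ℝ)) atTop
      (𝓝 (∫ u : ℝ, W c * (Real.exp (-(1 / 2) * u ^ 2) : ℝ))) := by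
    refine tendsto_integral_of_dominated_convergence
      (fun u => M * Real.exp (-(1 / 2) * u ^ 2)) (fun n => ?_) (hgi.const_mul M) (fun n => ?_) ?_
    · refine Continuous.aestronglyMeasurable ?_
      have : Continuous fun u : ℝ => W (c + (s n * u : ℝ) * Complex.I) :=
        hcont.comp (continuous_const.mul continuous_id)
      exact this.mul (by fun_prop)
    · refine ae_of_all _ fun u => ?_
      rw [norm_mul, Complex.norm_real, Real.norm_of_nonneg (Real.exp_pos _).le]
      gcongr
      exact hWb _ (hmem _)
    · refine ae_of_all _ fun u => ?_
      refine Tendsto.mul_const _ ?_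
      have h3 : Tendsto (fun n => s n * u) atTop (𝓝 0) := by simpa using hs0.mul_const u
      have h4 := (hcont.tendsto 0).comp h3
      simpa [Function.comp_def] using h4
  have hg : ∫ u : ℝ, W c * (Real.exp (-(1 / 2) * u ^ 2) : ℝ) =
      W c * (Real.sqrt (2 * Real.pi) : ℂ) := by
    rw [integral_const_mul, integral_complex_ofReal, integral_gaussian]
    congr 3
    ring
  rw [hg] at hlim
  have h5 := hlim.const_mul ((Real.sqrt (2 * Real.pi) : ℂ)⁻¹)
  have hne : (Real.sqrt (2 * Real.pi) : ℂ) ≠ 0 := by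
    have : 0 < Real.sqrt (2 * Real.pi) := by positivity
    exact_mod_cast this.ne'
  convert h5 using 2
  field_simp

/-- If the characteristic function of `X` extends to a bounded continuous function on the strip
`0 ≤ re z ≤ c` that is holomorphic inside, then `E[exp(c X)]` is finite and given by it. -/
theorem lintegral_exp_eq_of_strip (hX : Measurable X) (hc : 0 < c)
    (hWc : ContinuousOn W {z | z.re ∈ Icc 0 c})
    (hWd : DifferentiableOn ℂ W {z | z.re ∈ Ioo 0 c})
    (hWb : ∀ z : ℂ, z.re ∈ Icc 0 c → ‖W z‖ ≤ M)
    (hXW : ∀ q : ℝ, ∫ w, Complex.exp (Complex.I * q * X w) ∂P = W (q * Complex.I)) :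
    ∫⁻ w, ENNReal.ofReal (Real.exp (c * X w)) ∂P = ENNReal.ofReal (W c).re := by
  set s : ℕ → ℝ := fun n => 1 / ((n : ℝ) + 1) with hsdef
  have hs : ∀ n, 0 < s n := fun n => by simp only [hsdef]; positivity
  have hs0 : Tendsto s atTop (𝓝 0) := tendsto_one_div_add_atTop_nhds_zero_nat
  have hanti : Antitone s := fun a b hab => by
    simp only [hsdef]
    gcongr
  have hlim := tendsto_integral_gaussian_vertical hc hWc hWb hs hs0
  have hint : ∀ n, Integrable (fun w => Real.exp (c * X w - s n ^ 2 * X w ^ 2 / 2)) P := by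
    intro n
    refine Integrable.of_bound (by fun_prop) (Real.exp (c ^ 2 / (2 * s n ^ 2))) ?_
    refine ae_of_all _ fun w => ?_
    rw [Real.norm_of_nonneg (Real.exp_pos _).le]
    gcongr
    have := hs n
    rw [le_div_iff₀ (by positivity)]
    nlinarith [sq_nonneg (c - s n ^ 2 * X w)]
  have hre : Tendsto (fun n => ∫ w, Real.exp (c * X w - s n ^ 2 * X w ^ 2 / 2) ∂P) atTop
      (𝓝 (W c).re) := by
    have h1 := (Complex.continuous_re.tendsto (W c)).comp hlim
    refine h1.congr fun n => ?_
    simp only [Function.comp_apply]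
    rw [← integral_exp_mul_sub_sq hX hc (hs n) hWc hWd hWb hXW, ← mul_assoc, inv_mul_cancel₀,
      one_mul, integral_complex_ofReal, Complex.ofReal_re]
    have : 0 < Real.sqrt (2 * Real.pi * s n ^ 2) := by have := hs n; positivity
    exact_mod_cast this.ne'
  -- The regularized exponentials increase as `s n` decreases, so monotone convergence identifies
  -- the limit before `exp(c X)` is known to be integrable.
  have h2 : Tendsto (fun n => ∫⁻ w, ENNReal.ofReal (Real.exp (c * X w - s n ^ 2 * X w ^ 2 / 2)) ∂P)
      atTop (𝓝 (∫⁻ w, ENNReal.ofReal (Real.exp (c * X w)) ∂P)) := by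
    refine lintegral_tendsto_of_tendsto_of_monotone (fun n => by fun_prop) ?_ ?_
    · refine ae_of_all _ fun w a b hab => ?_
      refine ENNReal.ofReal_le_ofReal (Real.exp_le_exp.2 ?_)
      have h3 : s b ^ 2 ≤ s a ^ 2 := pow_le_pow_left₀ (hs b).le (hanti hab) 2
      nlinarith [sq_nonneg (X w)]
    · refine ae_of_all _ fun w => ?_
      refine (ENNReal.continuous_ofReal.tendsto _).comp ((Real.continuous_exp.tendsto _).comp ?_)
      have := ((hs0.pow 2).mul_const (X w ^ 2 / 2)).const_sub (c * X w)
      simpa [mul_div_assoc] using this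
  refine tendsto_nhds_unique h2 ?_
  refine ((ENNReal.continuous_ofReal.tendsto _).comp hre).congr fun n => ?_
  simp only [Function.comp_apply]
  rw [ofReal_integral_eq_lintegral_ofReal (hint n) (ae_of_all _ fun w => (Real.exp_pos _).le)]

end Strip

/-! ### The exponent on the strip `0 ≤ re z ≤ 2` -/

namespace LevyTriplet

variable (L : LevyTriplet)

lemma integrable_min_one_abs (hν : ∫⁻ x in Icc (-1) 1, ENNReal.ofReal |x| ∂L.ν < ∞) :
    Integrable (fun x : ℝ => min 1 |x|) L.ν := by
  refine ⟨by fun_prop, ?_⟩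
  rw [hasFiniteIntegral_iff_ofReal (ae_of_all _ fun x => le_min zero_le_one (abs_nonneg x)),
    ← lintegral_add_compl _ (measurableSet_Icc (a := (-1 : ℝ)) (b := 1))]
  refine ENNReal.add_lt_top.2 ⟨lt_of_le_of_lt ?_ hν, lt_of_le_of_lt ?_ L.ν_lintegral⟩
  · exact lintegral_mono fun x => ENNReal.ofReal_le_ofReal (min_le_right _ _)
  · refine le_trans ?_ (setLIntegral_le_lintegral (Icc (-1 : ℝ) 1)ᶜ _)
    refine setLIntegral_mono' measurableSet_Icc.compl fun x hx => ENNReal.ofReal_le_ofReal ?_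
    have h1 : 1 < |x| := by
      by_contra h
      exact hx (abs_le.1 (not_lt.1 h))
    have h2 : 1 ≤ x ^ 2 := by rw [← sq_abs]; nlinarith
    rw [min_eq_left h2]
    exact min_le_left _ _

lemma abs_sin_le_min (x : ℝ) : |Real.sin x| ≤ min 1 |x| :=
  le_min (Real.abs_sin_le_one x) Real.abs_sin_le_abs

lemma integrable_sin (hν : ∫⁻ x in Icc (-1) 1, ENNReal.ofReal |x| ∂L.ν < ∞) :
    Integrable Real.sin L.ν :=
  (L.integrable_min_one_abs hν).mono' (by fun_prop) (ae_of_all _ fun x => abs_sin_le_min x)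

/-- A function dominating `exp(zx) - 1` for `0 ≤ re z ≤ 2`. -/
def dom (x : ℝ) : ℝ := min 1 |x| + |Real.exp (2 * x) - 1|

lemma dom_nonneg (x : ℝ) : 0 ≤ dom x :=
  add_nonneg (le_min zero_le_one (abs_nonneg x)) (abs_nonneg _)

lemma integrable_dom (hν : ∫⁻ x in Icc (-1) 1, ENNReal.ofReal |x| ∂L.ν < ∞)
    (hψ2 : L.PsiFinite 2) : Integrable dom L.ν := by
  refine (L.integrable_min_one_abs hν).add (Integrable.abs ?_)
  have := (show Integrable _ L.ν from hψ2).add ((L.integrable_sin hν).const_mul 2)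
  refine this.congr (ae_of_all _ fun x => ?_)
  simp

/-- For `|x| ≤ 1` the difference is of order `|x|`; for `|x| ≥ 1` it is at most `2 + exp(2x)`,
because `0 ≤ re z ≤ 2`. The constant is locally bounded in `z`, as dominated convergence requires.
-/
lemma norm_exp_sub_one_le_dom {z : ℂ} (hz : z.re ∈ Icc (0 : ℝ) 2) (x : ℝ) :
    ‖Complex.exp (z * x) - 1‖ ≤ (‖z‖ * Real.exp ‖z‖ + 3) * dom x := by
  rcases le_total |x| 1 with hx | hx
  · have h1 : ‖Complex.exp (z * x) - 1‖ ≤ ‖z * x‖ * Real.exp ‖z * x‖ := by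
      simpa using Complex.norm_exp_sub_sum_le_norm_mul_exp (z * x) 1
    have h2 : ‖z * x‖ = ‖z‖ * |x| := by simp
    have h3 : |x| ≤ dom x := by
      simp only [dom, min_eq_right hx]
      linarith [abs_nonneg (Real.exp (2 * x) - 1)]
    have hd := dom_nonneg x
    calc _ ≤ (‖z‖ * |x|) * Real.exp (‖z‖ * |x|) := by rw [← h2]; exact h1
      _ ≤ (‖z‖ * dom x) * Real.exp (‖z‖ * 1) := by
        have : 0 ≤ ‖z‖ * dom x := by positivity
        gcongr
      _ ≤ _ := by
        rw [mul_one]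
        nlinarith [dom_nonneg x]
  · have h1 : ‖Complex.exp (z * x) - 1‖ ≤ Real.exp (z.re * x) + 1 := by
      refine (norm_sub_le _ _).trans ?_
      rw [Complex.norm_exp]
      simp
    have h2 : Real.exp (z.re * x) ≤ 1 + Real.exp (2 * x) := by
      rcases le_total x 0 with h | h
      · have : Real.exp (z.re * x) ≤ 1 := Real.exp_le_one_iff.2 (by nlinarith [hz.1])
        linarith [Real.exp_pos (2 * x)]
      · have : Real.exp (z.re * x) ≤ Real.exp (2 * x) := by
          gcongr
          exact hz.2
        linarith
    have h3 : 1 + |Real.exp (2 * x) - 1| = dom x := by simp [dom, min_eq_left hx]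
    have h4 := le_abs_self (Real.exp (2 * x) - 1)
    have h5 : 0 ≤ ‖z‖ * Real.exp ‖z‖ := by positivity
    nlinarith [dom_nonneg x, abs_nonneg (Real.exp (2 * x) - 1)]

/-- Bounds the `z`-derivative of `exp(zx) - 1`. The distance `δ` to the edges of the strip pays for
the factor `x`, through `|x| ≤ exp(δ|x|) / δ`. -/
lemma norm_mul_exp_le_dom {δ : ℝ} (hδ : 0 < δ) {z : ℂ} (hz : z.re ∈ Icc δ (2 - δ)) (x : ℝ) :
    ‖(x : ℂ) * Complex.exp (z * x)‖ ≤ (Real.exp 2 + 1 / δ) * dom x := by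
  have h0 : ‖(x : ℂ) * Complex.exp (z * x)‖ = |x| * Real.exp (z.re * x) := by
    rw [norm_mul, Complex.norm_exp]
    simp
  have hδ' : 0 < 1 / δ := by positivity
  have hd := dom_nonneg x
  have he := Real.exp_pos 2
  rw [h0]
  rcases le_total |x| 1 with hx | hx
  · have h3 : |x| ≤ dom x := by
      simp only [dom, min_eq_right hx]
      linarith [abs_nonneg (Real.exp (2 * x) - 1)]
    have h4 : Real.exp (z.re * x) ≤ Real.exp 2 := by
      gcongr
      nlinarith [le_abs_self x, hz.1, hz.2, abs_nonneg x]
    calc |x| * Real.exp (z.re * x) ≤ dom x * Real.exp 2 := by gcongr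
      _ ≤ _ := by nlinarith
  · have h3 : 1 + |Real.exp (2 * x) - 1| = dom x := by simp [dom, min_eq_left hx]
    have h4 : |x| ≤ 1 / δ * Real.exp (δ * |x|) := by
      rw [one_div, inv_mul_eq_div, le_div_iff₀ hδ]
      linarith [Real.add_one_le_exp (δ * |x|)]
    have h5 : Real.exp (δ * |x|) * Real.exp (z.re * x) ≤ 1 + |Real.exp (2 * x) - 1| := by
      rw [← Real.exp_add]
      rcases le_total x 0 with h | h
      · have : Real.exp (δ * |x| + z.re * x) ≤ 1 := Real.exp_le_one_iff.2 (by
          rw [abs_of_nonpos h]; nlinarith [hz.1])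
        linarith [abs_nonneg (Real.exp (2 * x) - 1)]
      · have : Real.exp (δ * |x| + z.re * x) ≤ Real.exp (2 * x) := by
          gcongr
          rw [abs_of_nonneg h]; nlinarith [hz.2]
        linarith [le_abs_self (Real.exp (2 * x) - 1)]
    calc |x| * Real.exp (z.re * x) ≤ 1 / δ * Real.exp (δ * |x|) * Real.exp (z.re * x) := by gcongr
      _ = 1 / δ * (Real.exp (δ * |x|) * Real.exp (z.re * x)) := by ring
      _ ≤ 1 / δ * dom x := by rw [← h3]; gcongr
      _ ≤ _ := by nlinarith

/-- The exponent in the variable `z = iq`, without centering. -/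
def expo (z : ℂ) : ℂ :=
  ((L.b - ∫ x, Real.sin x ∂L.ν : ℝ) : ℂ) * z + (L.σ : ℂ) ^ 2 * z ^ 2 / 2
    + ∫ x : ℝ, (Complex.exp (z * x) - 1) ∂L.ν

variable {L}

lemma integrable_exp_sub_one (hν : ∫⁻ x in Icc (-1) 1, ENNReal.ofReal |x| ∂L.ν < ∞)
    (hψ2 : L.PsiFinite 2) {z : ℂ} (hz : z.re ∈ Icc (0 : ℝ) 2) :
    Integrable (fun x : ℝ => Complex.exp (z * x) - 1) L.ν :=
  ((L.integrable_dom hν hψ2).const_mul _).mono' (by fun_prop)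
    (ae_of_all _ fun x => norm_exp_sub_one_le_dom hz x)

/-- Finite variation of the small jumps makes `sin` integrable for `ν`, so the compensator can be
separated and absorbed in the drift. -/
lemma phi_eq_expo (hν : ∫⁻ x in Icc (-1) 1, ENNReal.ofReal |x| ∂L.ν < ∞)
    (hψ2 : L.PsiFinite 2) {q : ℂ} (hz : (Complex.I * q).re ∈ Icc (0 : ℝ) 2) :
    L.φ q = L.expo (Complex.I * q) := by
  have h1 := integrable_exp_sub_one hν hψ2 hz
  have h2 : Integrable (fun x : ℝ => Complex.I * q * (Real.sin x : ℂ)) L.ν :=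
    (L.integrable_sin hν).ofReal.const_mul _
  unfold φ expo
  rw [integral_sub h1 h2, integral_const_mul, integral_complex_ofReal]
  push_cast
  rw [mul_pow, Complex.I_sq]
  ring

lemma continuousOn_expo (hν : ∫⁻ x in Icc (-1) 1, ENNReal.ofReal |x| ∂L.ν < ∞)
    (hψ2 : L.PsiFinite 2) : ContinuousOn L.expo {z | z.re ∈ Icc (0 : ℝ) 2} := by
  unfold expo
  refine ContinuousOn.add (by fun_prop) fun z hz => ?_
  refine continuousWithinAt_of_dominated
    (bound := fun x => ((‖z‖ + 1) * Real.exp (‖z‖ + 1) + 3) * dom x) ?_ ?_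
    ((L.integrable_dom hν hψ2).const_mul _) ?_
  · exact Eventually.of_forall fun z => by fun_prop
  · have h1 : ∀ᶠ u in 𝓝[{z | z.re ∈ Icc (0 : ℝ) 2}] z, ‖u‖ < ‖z‖ + 1 :=
      nhdsWithin_le_nhds ((continuous_norm.tendsto z).eventually (gt_mem_nhds (by linarith)))
    filter_upwards [h1, self_mem_nhdsWithin] with u hu hu2
    refine ae_of_all _ fun x => (norm_exp_sub_one_le_dom hu2 x).trans ?_
    have := dom_nonneg x
    gcongr
  · exact ae_of_all _ fun x => by fun_prop

lemma differentiableOn_expo (hν : ∫⁻ x in Icc (-1) 1, ENNReal.ofReal |x| ∂L.ν < ∞)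
    (hψ2 : L.PsiFinite 2) : DifferentiableOn ℂ L.expo {z | z.re ∈ Ioo (0 : ℝ) 2} := by
  unfold expo
  refine DifferentiableOn.add (by fun_prop) fun z hz => ?_
  obtain ⟨δ, hδ, hδ1, hδ2⟩ : ∃ δ : ℝ, 0 < δ ∧ 2 * δ < z.re ∧ z.re < 2 - 2 * δ := by
    refine ⟨min z.re (2 - z.re) / 4, ?_, ?_, ?_⟩
    · have := lt_min hz.1 (sub_pos.2 hz.2); positivity
    · have := min_le_left z.re (2 - z.re); linarith [hz.1]
    · have := min_le_right z.re (2 - z.re); linarith [hz.2]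
  have hs : {u : ℂ | u.re ∈ Ioo δ (2 - δ)} ∈ 𝓝 z := by
    refine (isOpen_Ioo.preimage Complex.continuous_re).mem_nhds ?_
    exact ⟨by linarith, by linarith⟩
  have := hasDerivAt_integral_of_dominated_loc_of_deriv_le (μ := L.ν)
    (F := fun (z : ℂ) (x : ℝ) => Complex.exp (z * x) - 1)
    (F' := fun (z : ℂ) (x : ℝ) => (x : ℂ) * Complex.exp (z * x))
    (bound := fun x => (Real.exp 2 + 1 / δ) * dom x) (x₀ := z) hs
    (Eventually.of_forall fun z => by fun_prop)
    (integrable_exp_sub_one hν hψ2 ⟨hz.1.le, hz.2.le⟩) (by fun_prop)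
    (ae_of_all _ fun x u hu => norm_mul_exp_le_dom hδ ⟨hu.1.le, hu.2.le⟩ x)
    ((L.integrable_dom hν hψ2).const_mul _)
    (ae_of_all _ fun x u hu => by
      have h1 : HasDerivAt (fun z : ℂ => z * (x : ℂ)) (x : ℂ) u := by
        simpa using (hasDerivAt_id u).mul_const (x : ℂ)
      have h2 := h1.cexp.sub_const 1
      rwa [mul_comm] at h2)
  exact this.2.differentiableAt.differentiableWithinAt

/-- Going to the real axis only increases the real part: `re (exp(zx)) ≤ exp(x re z)`, and `re z² ≤
(re z)²`. So the bound involves only `re z ≤ 2`. It makes `exp(λ expo z)` bounded on the strip for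
`λ ≥ 0`. -/
lemma exists_re_expo_le (hν : ∫⁻ x in Icc (-1) 1, ENNReal.ofReal |x| ∂L.ν < ∞)
    (hψ2 : L.PsiFinite 2) : ∃ M : ℝ, ∀ z : ℂ, z.re ∈ Icc (0 : ℝ) 2 → (L.expo z).re ≤ M := by
  set β := L.b - ∫ x, Real.sin x ∂L.ν with hβ
  refine ⟨|β| * 2 + L.σ ^ 2 * 2 + (2 * Real.exp 2 + 3) * ∫ x, dom x ∂L.ν, fun z hz => ?_⟩
  have h1 : (((β : ℝ) : ℂ) * z).re ≤ |β| * 2 := by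
    rw [Complex.re_ofReal_mul]
    calc β * z.re ≤ |β| * z.re := by gcongr; exacts [hz.1, le_abs_self β]
      _ ≤ |β| * 2 := by gcongr; exact hz.2
  have h2 : ((L.σ : ℂ) ^ 2 * z ^ 2 / 2).re ≤ L.σ ^ 2 * 2 := by
    have : ((L.σ : ℂ) ^ 2 * z ^ 2 / 2) = ((L.σ ^ 2 / 2 : ℝ) : ℂ) * z ^ 2 := by push_cast; ring
    rw [this, Complex.re_ofReal_mul]
    have h3 : (z ^ 2).re ≤ 4 := by
      have : (z ^ 2).re = z.re ^ 2 - z.im ^ 2 := by simp [pow_two]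
      rw [this]
      nlinarith [hz.1, hz.2, sq_nonneg z.im]
    nlinarith [sq_nonneg L.σ]
  have h3 : (∫ x : ℝ, (Complex.exp (z * x) - 1) ∂L.ν).re ≤
      (2 * Real.exp 2 + 3) * ∫ x, dom x ∂L.ν := by
    have hint := integrable_exp_sub_one hν hψ2 hz
    have : (∫ x : ℝ, (Complex.exp (z * x) - 1) ∂L.ν).re =
        ∫ x : ℝ, (Complex.exp (z * x) - 1).re ∂L.ν := (integral_re hint).symm
    rw [this, ← integral_const_mul]
    refine integral_mono hint.re ((L.integrable_dom hν hψ2).const_mul _) fun x => ?_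
    have hz' : ((z.re : ℂ)).re ∈ Icc (0 : ℝ) 2 := by simpa using hz
    have h4 := norm_exp_sub_one_le_dom hz' x
    have h5 : ‖Complex.exp ((z.re : ℂ) * x) - 1‖ = |Real.exp (z.re * x) - 1| := by
      rw [← Complex.ofReal_mul, ← Complex.ofReal_exp, ← Complex.ofReal_one, ← Complex.ofReal_sub,
        Complex.norm_real, Real.norm_eq_abs]
    have h6 : (Complex.exp (z * x) - 1).re ≤ Real.exp (z.re * x) - 1 := by
      rw [Complex.sub_re, Complex.one_re]
      have := (Complex.re_le_norm (Complex.exp (z * x)))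
      rw [Complex.norm_exp] at this
      simpa using this
    have h7 : ‖(z.re : ℂ)‖ ≤ 2 := by
      rw [Complex.norm_real, Real.norm_of_nonneg hz.1]
      exact hz.2
    have hd := dom_nonneg x
    calc (Complex.exp (z * x) - 1).re ≤ |Real.exp (z.re * x) - 1| := h6.trans (le_abs_self _)
      _ ≤ (‖(z.re : ℂ)‖ * Real.exp ‖(z.re : ℂ)‖ + 3) * dom x := by rw [← h5]; exact h4
      _ ≤ (2 * Real.exp 2 + 3) * dom x := by gcongr
  unfold expo
  rw [Complex.add_re, Complex.add_re]
  linarith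

lemma expo_ofReal_im (c : ℝ) : (L.expo c).im = 0 := by
  have : L.expo c = (((L.b - ∫ x, Real.sin x ∂L.ν) * c + L.σ ^ 2 * c ^ 2 / 2
      + ∫ x : ℝ, (Real.exp (c * x) - 1) ∂L.ν : ℝ) : ℂ) := by
    unfold expo
    push_cast
    congr 1
    rw [← integral_complex_ofReal]
    push_cast
    rfl
  rw [this, Complex.ofReal_im]

/-- The exponential moments `E[exp(c X)] = exp(λ ψ(c))` for `0 < c ≤ 2`. -/
theorem lintegral_exp_eq (hν : ∫⁻ x in Icc (-1) 1, ENNReal.ofReal |x| ∂L.ν < ∞)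
    (hψ2 : L.PsiFinite 2) {Ω : Type*} [MeasurableSpace Ω] {P : Measure Ω} [IsProbabilityMeasure P]
    {X : Ω → ℝ} (hX : Measurable X) {lam : ℝ} (hlam : 0 ≤ lam)
    (hlaw : ∀ q : ℝ, ∫ w, Complex.exp (Complex.I * q * X w) ∂P = Complex.exp (L.φ q * lam))
    {c : ℝ} (hc : 0 < c) (hc2 : c ≤ 2) :
    ∫⁻ w, ENNReal.ofReal (Real.exp (c * X w)) ∂P = ENNReal.ofReal (Real.exp (lam * L.ψ c)) := by
  obtain ⟨M, hM⟩ := exists_re_expo_le hν hψ2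
  have hsub : ∀ z : ℂ, z.re ∈ Icc 0 c → z.re ∈ Icc (0 : ℝ) 2 := fun z hz =>
    ⟨hz.1, hz.2.trans hc2⟩
  have h := lintegral_exp_eq_of_strip (P := P) (W := fun z => Complex.exp (L.expo z * lam))
    (M := Real.exp (M * lam)) hX hc
    (((continuousOn_expo hν hψ2).mono hsub).mul continuousOn_const).cexp
    (((differentiableOn_expo hν hψ2).mono fun z hz => ⟨hz.1, hz.2.trans_le hc2⟩).mul_const _).cexp
    (fun z hz => by
      rw [Complex.norm_exp, Complex.re_mul_ofReal]
      gcongr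
      exact hM z (hsub z hz))
    (fun q => by
      rw [hlaw, phi_eq_expo hν hψ2 (by simp)]
      rw [mul_comm Complex.I])
  rw [h]
  have hψ : L.ψ c = (L.expo c).re := by
    have h1 : Complex.I * -(Complex.I * (c : ℂ)) = c := by
      rw [mul_neg, ← mul_assoc, Complex.I_mul_I]
      ring
    unfold ψ
    rw [phi_eq_expo hν hψ2 (by rw [h1]; exact ⟨hc.le, hc2⟩), h1]
  congr 1
  rw [Complex.exp_re, Complex.im_mul_ofReal, expo_ofReal_im, Complex.re_mul_ofReal, hψ]
  simp [mul_comm]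

end LevyTriplet

/-! ### Additivity and independence of a scattered random measure -/

namespace IsIndepScattered

variable {E : Type*}

/-- A finite family of sets as a sequence, completed by the empty set. -/
def toSeq {ι : Type*} [Fintype ι] (A : ι → Set E) : ℕ → Set E :=
  Function.extend (fun i => (Fintype.equivFin ι i : ℕ)) A fun _ => ∅

lemma equivFin_val_injective (ι : Type*) [Fintype ι] :
    Function.Injective (fun i => (Fintype.equivFin ι i : ℕ)) :=
  Fin.val_injective.comp (Fintype.equivFin ι).injective

lemma toSeq_val {ι : Type*} [Fintype ι] (A : ι → Set E) (i : ι) :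
    toSeq A (Fintype.equivFin ι i : ℕ) = A i :=
  (equivFin_val_injective ι).extend_apply A _ i

lemma toSeq_eq_empty {ι : Type*} [Fintype ι] (A : ι → Set E) {k : ℕ} (hk : Fintype.card ι ≤ k) :
    toSeq A k = ∅ := by
  refine Function.extend_apply' A _ k ?_
  rintro ⟨i, hi⟩
  have := (Fintype.equivFin ι i).2
  exact absurd hk (not_le.2 (hi ▸ this))

lemma toSeq_cases {ι : Type*} [Fintype ι] (A : ι → Set E) (k : ℕ) :
    (∃ i, (Fintype.equivFin ι i : ℕ) = k ∧ toSeq A k = A i) ∨ toSeq A k = ∅ := by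
  rcases lt_or_ge k (Fintype.card ι) with hk | hk
  · refine Or.inl ⟨(Fintype.equivFin ι).symm ⟨k, hk⟩, by simp, ?_⟩
    rw [← toSeq_val A]
    simp
  · exact Or.inr (toSeq_eq_empty A hk)

lemma measurableSet_toSeq [MeasurableSpace E] {ι : Type*} [Fintype ι] {A : ι → Set E} (hA : ∀ i, MeasurableSet (A i))
    (k : ℕ) : MeasurableSet (toSeq A k) := by
  rcases toSeq_cases A k with ⟨i, -, h⟩ | h <;> rw [h]
  exacts [hA i, MeasurableSet.empty]

lemma disjoint_toSeq {ι : Type*} [Fintype ι] {A : ι → Set E}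
    (hd : Pairwise (fun i j => Disjoint (A i) (A j))) :
    Pairwise (fun i j => Disjoint (toSeq A i) (toSeq A j)) := by
  intro k l hkl
  rcases toSeq_cases A k with ⟨i, hi, h⟩ | h <;> rcases toSeq_cases A l with ⟨j, hj, h'⟩ | h' <;>
    rw [h, h'] <;> try simp
  refine hd fun hij => hkl ?_
  rw [← hi, ← hj, hij]

lemma iUnion_toSeq {ι : Type*} [Fintype ι] (A : ι → Set E) : ⋃ k, toSeq A k = ⋃ i, A i := by
  refine subset_antisymm (iUnion_subset fun k => ?_) (iUnion_subset fun i => ?_)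
  · rcases toSeq_cases A k with ⟨i, -, h⟩ | h <;> rw [h]
    exacts [subset_iUnion A i, empty_subset _]
  · rw [← toSeq_val A i]
    exact subset_iUnion _ _

variable {Ω : Type*} [MeasurableSpace Ω] [MeasurableSpace E] {P : Measure Ω}
  {φ : ℂ → ℂ} {Λ : Measure E} {μ : Set E → Ω → ℝ}

variable (hμ : IsIndepScattered P φ Λ μ)
include hμ

/-- Additivity along the constant sequence `∅` makes the partial sums `n μ(∅)` converge, so their
increments tend to `0`. -/
lemma ae_empty : ∀ᵐ w ∂P, μ ∅ w = 0 := by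
  have h := hμ.additive (fun _ => ∅) (fun _ => MeasurableSet.empty) (by simp)
    (fun _ _ _ => disjoint_bot_left)
  filter_upwards [h] with w hw
  simp only [Finset.sum_const, Finset.card_range, iUnion_empty, nsmul_eq_mul] at hw
  have h1 := (tendsto_add_atTop_iff_nat 1).2 hw
  have h2 := h1.sub hw
  simp only [Nat.cast_add, Nat.cast_one, add_mul, one_mul, add_sub_cancel_left, sub_self] at h2
  exact tendsto_nhds_unique tendsto_const_nhds h2

lemma ae_iUnion_fintype {ι : Type*} [Fintype ι] {A : ι → Set E} (hA : ∀ i, MeasurableSet (A i))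
    (hfin : Λ (⋃ i, A i) < ∞) (hd : Pairwise (fun i j => Disjoint (A i) (A j))) :
    ∀ᵐ w ∂P, μ (⋃ i, A i) w = ∑ i, μ (A i) w := by
  have h := hμ.additive (toSeq A) (measurableSet_toSeq hA) (by rwa [iUnion_toSeq])
    (disjoint_toSeq hd)
  rw [iUnion_toSeq] at h
  filter_upwards [h, hμ.ae_empty] with w hw hw0
  refine tendsto_nhds_unique hw (tendsto_const_nhds.congr' ?_)
  filter_upwards [eventually_ge_atTop (Fintype.card ι)] with n hn
  rw [← Finset.sum_subset (Finset.range_mono hn) (fun k _ hk => by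
    rw [toSeq_eq_empty A (by simpa using hk), hw0]), Finset.sum_range,
    ← (Fintype.equivFin ι).sum_comp]
  exact Finset.sum_congr rfl fun i _ => by rw [toSeq_val]

lemma iIndepFun_fintype {ι : Type*} [Fintype ι] {A : ι → Set E} (hA : ∀ i, MeasurableSet (A i))
    (hfin : ∀ i, Λ (A i) < ∞) (hd : Pairwise (fun i j => Disjoint (A i) (A j))) :
    iIndepFun (fun i => μ (A i)) P := by
  have h := hμ.indep (toSeq A) (measurableSet_toSeq hA) (fun k => by
    rcases toSeq_cases A k with ⟨i, -, h⟩ | h <;> rw [h]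
    exacts [hfin i, by simp]) (disjoint_toSeq hd)
  have h2 := h.precomp (equivFin_val_injective ι)
  simpa only [Function.comp_def, toSeq_val] using h2

lemma ae_union {A B : Set E} (hA : MeasurableSet A) (hB : MeasurableSet B) (hAf : Λ A < ∞)
    (hBf : Λ B < ∞) (hd : Disjoint A B) : ∀ᵐ w ∂P, μ (A ∪ B) w = μ A w + μ B w := by
  have h := hμ.ae_iUnion_fintype (A := fun b : Bool => cond b A B) (by rintro (_ | _) <;> simpa)
    (by rw [← union_eq_iUnion]; exact measure_union_lt_top hAf hBf)
    (by rintro (_ | _) (_ | _) h <;> simp_all [disjoint_comm])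
  rw [← union_eq_iUnion] at h
  simpa using h

/-- The values on the subsets of a set are jointly independent of the value on a disjoint set. -/
lemma indepFun_process [IsProbabilityMeasure P] {E₁ D : Set E} (hD : MeasurableSet D) (hDf : Λ D < ∞)
    (hdisj : Disjoint E₁ D) :
    IndepFun (μ D)
      (fun w (A : {A : Set E // MeasurableSet A ∧ Λ A < ∞ ∧ A ⊆ E₁}) => μ A.1 w) P := by
  classical
  refine IndepFun.indepFun_process (hμ.measurable D hD hDf)
    (fun A => hμ.measurable A.1 A.2.1 A.2.2.1) fun I => ?_
  set U : Set E := ⋃ i : I, i.1.1 with hU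
  have hUm : MeasurableSet U := MeasurableSet.iUnion fun i => i.1.2.1
  have hUf : Λ U < ∞ :=
    (measure_iUnion_fintype_le Λ _).trans_lt (ENNReal.sum_lt_top.2 fun i _ => i.1.2.2.1)
  have hUE : U ⊆ E₁ := iUnion_subset fun i => i.1.2.2.2
  -- The sets of the finite family may overlap, whereas independence is given for disjoint sets. So
  -- they are cut into the atoms of the algebra they generate, indexed by membership patterns.
  set atom : (I → Bool) → Set E := fun J => U ∩ {p | ∀ i : I, p ∈ i.1.1 ↔ J i = true} with hatom
  have hatm : ∀ J, MeasurableSet (atom J) := by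
    intro J
    refine hUm.inter ?_
    rw [Set.ofPred_forall]
    refine MeasurableSet.iInter fun i => ?_
    rcases h : J i with _ | _
    · have : {p | p ∈ i.1.1 ↔ false = true} = (i.1.1)ᶜ := by ext; simp
      rw [this]
      exact i.1.2.1.compl
    · have : {p | p ∈ i.1.1 ↔ true = true} = i.1.1 := by ext; simp
      rw [this]
      exact i.1.2.1
  have hatd : ∀ J J', J ≠ J' → Disjoint (atom J) (atom J') := by
    intro J J' hJ
    refine disjoint_left.2 fun p hp hp' => hJ (funext fun i => ?_)
    have := (hp.2 i).symm.trans (hp'.2 i)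
    exact Bool.eq_iff_iff.2 this
  -- The index `none` carries `D` and the other indices carry the atoms; the grouping `{none}`
  -- against the rest gives the independence sought.
  set A : Option (I → Bool) → Set E := fun o => o.elim D atom with hAdef
  have hind := hμ.iIndepFun_fintype (A := A) (by rintro (_ | J); exacts [hD, hatm J])
    (by rintro (_ | J); exacts [hDf, (measure_mono inter_subset_left).trans_lt hUf])
    (by
      rintro (_ | J) (_ | J') h
      · exact absurd rfl h
      · exact (hdisj.mono_left (inter_subset_left.trans hUE)).symm
      · exact hdisj.mono_left (inter_subset_left.trans hUE)
      · exact hatd J J' fun h' => h (by rw [h']))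
  have hAm : ∀ o, Measurable (μ (A o)) := by
    rintro (_ | J)
    exacts [hμ.measurable _ hD hDf,
      hμ.measurable _ (hatm J) ((measure_mono inter_subset_left).trans_lt hUf)]
  have h2 := hind.indepFun_finset {none} (Finset.univ.erase none) (by simp) hAm
  have hm1 : Measurable (fun f : ({none} : Finset (Option (I → Bool))) → ℝ =>
      f ⟨none, by simp⟩) := measurable_pi_apply _
  have hm2 : Measurable (fun (f : (Finset.univ.erase (none : Option (I → Bool)) : Finset _) → ℝ)
      (i : I) => ∑ J : {J : I → Bool // J i = true}, f ⟨some J.1, by simp⟩) := by fun_prop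
  have h3 := h2.comp hm1 hm2
  refine h3.congr (ae_of_all _ fun w => rfl) ?_
  have hun : ∀ i : I, i.1.1 = ⋃ J : {J : I → Bool // J i = true}, atom J.1 := by
    intro i
    ext p
    simp only [mem_iUnion]
    constructor
    · intro hp
      exact ⟨⟨fun j => decide (p ∈ j.1.1), by simpa using hp⟩, mem_iUnion.2 ⟨i, hp⟩,
        fun j => by simp⟩
    · rintro ⟨J, -, hJ⟩
      exact (hJ i).2 J.2
  have hae : ∀ᵐ w ∂P, ∀ i : I, μ i.1.1 w = ∑ J : {J : I → Bool // J i = true}, μ (atom J.1) w := by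
    refine ae_all_iff.2 fun i => ?_
    have := hμ.ae_iUnion_fintype (A := fun J : {J : I → Bool // J i = true} => atom J.1)
      (fun J => hatm J.1) (by rw [← hun i]; exact i.1.2.2.1)
      (fun J J' h => hatd _ _ fun h' => h (Subtype.ext h'))
    rwa [← hun i] at this
  filter_upwards [hae] with w hw
  funext i
  exact (hw i).symm

end IsIndepScattered

/-! ### Completed sub-σ-algebras -/

/-- The measurable sets that agree almost everywhere with a set of `m`. -/
@[reducible]
def completion {Ω : Type*} [mΩ : MeasurableSpace Ω] (P : Measure Ω) (m : MeasurableSpace Ω) :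
    MeasurableSpace Ω :=
  @eventuallyMeasurableSpace Ω m (ae P) _ ⊓ mΩ

section Completion

variable {Ω : Type*} {m m' : MeasurableSpace Ω} [mΩ : MeasurableSpace Ω] {P : Measure Ω}

lemma completion_le : completion P m ≤ mΩ := inf_le_right

lemma le_completion (hm : m ≤ mΩ) : m ≤ completion P m :=
  le_inf (@le_eventuallyMeasurableSpace Ω m (ae P) _) hm

lemma completion_mono (h : m ≤ m') : completion P m ≤ completion P m' := by
  rintro s ⟨⟨t, ht, hst⟩, hs⟩
  exact ⟨⟨t, h t ht, hst⟩, hs⟩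

lemma measurable_completion_of_ae_eq {β : Type*} [MeasurableSpace β] {f g : Ω → β}
    (hf : Measurable[completion P m] f) (hg : Measurable g) (hfg : g =ᵐ[P] f) :
    Measurable[completion P m] g := by
  intro s hs
  obtain ⟨⟨t, ht, hst⟩, -⟩ := hf hs
  exact ⟨⟨t, ht, (hfg.preimage s).trans hst⟩, hg hs⟩

lemma indep_completion (h : Indep m m' P) :
    Indep (completion P m) m' P := by
  rw [Indep_iff] at h ⊢
  rintro s u ⟨⟨t, ht, hst⟩, hs⟩ hu
  rw [measure_congr hst, measure_congr (hst.inter (ae_eq_refl u)), h t u ht hu]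

end Completion

/-! ### Exponential moments and conditional expectations of a scattered random measure -/

namespace IsIndepScattered

variable {Ω E : Type*} [mΩ : MeasurableSpace Ω] [MeasurableSpace E] {P : Measure Ω}
  {L : LevyTriplet} {Λ : Measure E} {μ : Set E → Ω → ℝ}

/-- The completed σ-algebra generated by the values on the subsets of `E₁`. -/
@[reducible]
def sigmaOn (P : Measure Ω) (Λ : Measure E) (μ : Set E → Ω → ℝ) (E₁ : Set E) : MeasurableSpace Ω :=
  completion P (MeasurableSpace.comap
    (fun w (A : {A : Set E // MeasurableSet A ∧ Λ A < ∞ ∧ A ⊆ E₁}) => μ A.1 w)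
      MeasurableSpace.pi)

lemma sigmaOn_mono {E₁ E₂ : Set E} (h : E₁ ⊆ E₂) :
    sigmaOn P Λ μ E₁ ≤ sigmaOn P Λ μ E₂ := by
  refine completion_mono ?_
  have hmeas : Measurable (fun (f : {A : Set E // MeasurableSet A ∧ Λ A < ∞ ∧ A ⊆ E₂} → ℝ)
      (A : {A : Set E // MeasurableSet A ∧ Λ A < ∞ ∧ A ⊆ E₁}) =>
      f ⟨A.1, A.2.1, A.2.2.1, A.2.2.2.trans h⟩) := by fun_prop
  rintro s ⟨t, ht, rfl⟩
  exact ⟨_, hmeas ht, rfl⟩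

variable (hμ : IsIndepScattered P L.φ Λ μ)
include hμ

lemma measurable_sigmaOn {E₁ A : Set E} (hA : MeasurableSet A) (hAf : Λ A < ∞) (hAE : A ⊆ E₁) :
    Measurable[sigmaOn P Λ μ E₁] (μ A) := by
  have h0 := comap_measurable (m := MeasurableSpace.pi)
    (fun w (A : {A : Set E // MeasurableSet A ∧ Λ A < ∞ ∧ A ⊆ E₁}) => μ A.1 w)
  have h1 : Measurable (fun f : {A : Set E // MeasurableSet A ∧ Λ A < ∞ ∧ A ⊆ E₁} → ℝ =>
      f ⟨A, hA, hAf, hAE⟩) := measurable_pi_apply _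
  refine (h1.comp h0).mono (le_completion (Measurable.comap_le ?_)) le_rfl
  exact measurable_pi_lambda _ fun A => hμ.measurable A.1 A.2.1 A.2.2.1

variable [IsProbabilityMeasure P]

lemma indep_sigmaOn {E₁ D : Set E} (hD : MeasurableSet D) (hDf : Λ D < ∞) (hdisj : Disjoint E₁ D) :
    Indep (MeasurableSpace.comap (μ D) inferInstance) (sigmaOn P Λ μ E₁) P :=
  (indep_completion (hμ.indepFun_process hD hDf hdisj).symm).symm

variable (hν : ∫⁻ x in Icc (-1) 1, ENNReal.ofReal |x| ∂L.ν < ∞) (hψ2 : L.PsiFinite 2)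
include hν hψ2

lemma lintegral_exp {A : Set E} (hA : MeasurableSet A) (hAf : Λ A < ∞) {c : ℝ} (hc : 0 < c)
    (hc2 : c ≤ 2) : ∫⁻ w, ENNReal.ofReal (Real.exp (c * μ A w)) ∂P
      = ENNReal.ofReal (Real.exp ((Λ A).toReal * L.ψ c)) :=
  LevyTriplet.lintegral_exp_eq hν hψ2 (hμ.measurable A hA hAf) ENNReal.toReal_nonneg
    (hμ.law A hA hAf) hc hc2

variable (hψ1 : L.ψ 1 = 0)
include hψ1

lemma lintegral_exp_one {A : Set E} (hA : MeasurableSet A) (hAf : Λ A < ∞) :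
    ∫⁻ w, ENNReal.ofReal (Real.exp (μ A w)) ∂P = 1 := by
  have := hμ.lintegral_exp hν hψ2 hA hAf one_pos one_le_two
  simpa [hψ1] using this

lemma integrable_exp {A : Set E} (hA : MeasurableSet A) (hAf : Λ A < ∞) :
    Integrable (fun w => Real.exp (μ A w)) P := by
  refine ⟨(hμ.measurable A hA hAf).exp.aestronglyMeasurable, ?_⟩
  rw [hasFiniteIntegral_iff_ofReal (ae_of_all _ fun w => (Real.exp_pos _).le),
    hμ.lintegral_exp_one hν hψ2 hψ1 hA hAf]
  exact ENNReal.one_lt_top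

lemma integral_exp {A : Set E} (hA : MeasurableSet A) (hAf : Λ A < ∞) :
    ∫ w, Real.exp (μ A w) ∂P = 1 := by
  rw [integral_eq_lintegral_of_nonneg_ae (ae_of_all _ fun w => (Real.exp_pos _).le)
    (hμ.measurable A hA hAf).exp.aestronglyMeasurable, hμ.lintegral_exp_one hν hψ2 hψ1 hA hAf]
  rfl

/-- The intersection is counted twice: the product is `exp(2 μ(A ∩ B)) exp(μ(A \ B)) exp(μ(B \ A))`
with independent factors, and the last two have mean one. -/
lemma lintegral_exp_mul_exp {A B : Set E} (hA : MeasurableSet A) (hB : MeasurableSet B)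
    (hAf : Λ A < ∞) (hBf : Λ B < ∞) :
    ∫⁻ w, ENNReal.ofReal (Real.exp (μ A w)) * ENNReal.ofReal (Real.exp (μ B w)) ∂P
      = ENNReal.ofReal (Real.exp ((Λ (A ∩ B)).toReal * L.ψ 2)) := by
  have hI := hA.inter hB
  have hIf : Λ (A ∩ B) < ∞ := (measure_mono inter_subset_left).trans_lt hAf
  have hA' := hA.diff hB
  have hA'f : Λ (A \ B) < ∞ := (measure_mono sdiff_subset).trans_lt hAf
  have hB' := hB.diff hA
  have hB'f : Λ (B \ A) < ∞ := (measure_mono sdiff_subset).trans_lt hBf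
  have e1 := hμ.ae_union hI hA' hIf hA'f (disjoint_sdiff_inter.symm)
  have e2 := hμ.ae_union hI hB' hIf hB'f (by
    rw [inter_comm]; exact disjoint_sdiff_inter.symm)
  rw [inter_union_sdiff] at e1
  rw [inter_comm A B, inter_union_sdiff, inter_comm B A] at e2
  have hind := hμ.iIndepFun_fintype (A := ![A ∩ B, A \ B, B \ A])
    (by intro i; fin_cases i; exacts [hI, hA', hB'])
    (by intro i; fin_cases i; exacts [hIf, hA'f, hB'f])
    (by
      have d1 : Disjoint (A ∩ B) (A \ B) := disjoint_sdiff_inter.symm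
      have d2 : Disjoint (A ∩ B) (B \ A) := by rw [inter_comm]; exact disjoint_sdiff_inter.symm
      have d3 : Disjoint (A \ B) (B \ A) := disjoint_sdiff_sdiff
      intro i j h
      fin_cases i <;> fin_cases j <;> first | exact absurd rfl h | skip
      exacts [d1, d2, d1.symm, d3, d2.symm, d3.symm])
  have h2 := hind.comp ![fun t => ENNReal.ofReal (Real.exp (2 * t)),
    fun t => ENNReal.ofReal (Real.exp t), fun t => ENNReal.ofReal (Real.exp t)]
    (by intro i; fin_cases i <;> simp <;> fun_prop)
  have hmI := hμ.measurable _ hI hIf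
  have hmA := hμ.measurable _ hA' hA'f
  have hmB := hμ.measurable _ hB' hB'f
  have h3 := lintegral_prod_eq_prod_lintegral_of_indepFun Finset.univ _ h2
    (by intro i; fin_cases i <;> simp [Function.comp_def] <;> fun_prop)
  simp only [Fin.prod_univ_three, Function.comp_def, Matrix.cons_val_zero, Matrix.cons_val_one,
    Matrix.cons_val] at h3
  rw [hμ.lintegral_exp hν hψ2 hI hIf two_pos le_rfl, hμ.lintegral_exp_one hν hψ2 hψ1 hA' hA'f,
    hμ.lintegral_exp_one hν hψ2 hψ1 hB' hB'f, mul_one, mul_one] at h3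
  rw [← h3]
  refine lintegral_congr_ae ?_
  filter_upwards [e1, e2] with w h1 h2
  rw [h1, h2, ← ENNReal.ofReal_mul (by positivity), ← ENNReal.ofReal_mul (by positivity),
    ← ENNReal.ofReal_mul (by positivity), ← Real.exp_add, ← Real.exp_add, ← Real.exp_add]
  congr 2
  ring

/-- The factor `exp(μ A)` is known and can be pulled out; `exp(μ D)` is independent of everything
inside `E₁` and has mean one. -/
lemma condExp_exp {E₁ A D : Set E} (hA : MeasurableSet A) (hAf : Λ A < ∞) (hAE : A ⊆ E₁)
    (hD : MeasurableSet D) (hDf : Λ D < ∞) (hdisj : Disjoint E₁ D) :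
    P[fun w => Real.exp (μ (A ∪ D) w) | sigmaOn P Λ μ E₁] =ᵐ[P] fun w => Real.exp (μ A w) := by
  have hle : sigmaOn P Λ μ E₁ ≤ mΩ := completion_le
  have e := hμ.ae_union hA hD hAf hDf (hdisj.mono_left hAE)
  have e' : (fun w => Real.exp (μ (A ∪ D) w)) =ᵐ[P]
      (fun w => Real.exp (μ A w)) * fun w => Real.exp (μ D w) := by
    filter_upwards [e] with w hw
    simp [hw, Real.exp_add]
  have hint := (hμ.integrable_exp hν hψ2 hψ1 (hA.union hD) (measure_union_lt_top hAf hDf)).congr e'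
  refine (condExp_congr_ae e').trans ?_
  refine (condExp_mul_of_stronglyMeasurable_left
    (hμ.measurable_sigmaOn hA hAf hAE).exp.stronglyMeasurable hint
    (hμ.integrable_exp hν hψ2 hψ1 hD hDf)).trans ?_
  have h1 := condExp_indep_eq (hμ.measurable D hD hDf).comap_le hle
    (f := fun w => Real.exp (μ D w))
    ((Real.measurable_exp.comp (comap_measurable (μ D))).stronglyMeasurable)
    (hμ.indep_sigmaOn hD hDf hdisj)
  filter_upwards [h1] with w hw
  simp [hw, hμ.integral_exp hν hψ2 hψ1 hD hDf]

end IsIndepScattered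

/-! ### The measure of the cones -/

lemma measurableSet_pos_snd : MeasurableSet {p : ℝ × ℝ | 0 < p.2} :=
  measurableSet_lt measurable_const measurable_snd

lemma measurableEmbedding_coe_S : MeasurableEmbedding (Subtype.val : S → ℝ × ℝ) :=
  MeasurableEmbedding.subtype_coe measurableSet_pos_snd

lemma theta_apply (A : Set S) : θ A = ((volume : Measure (ℝ × ℝ)).withDensity
    (fun p => ENNReal.ofReal ((p.2 ^ 2)⁻¹))) (Subtype.val '' A) :=
  measurableEmbedding_coe_S.comap_apply _ _

instance : SigmaFinite θ := by
  set ρ := (volume : Measure (ℝ × ℝ)).withDensity (fun p => ENNReal.ofReal ((p.2 ^ 2)⁻¹)) with hρ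
  have : SigmaFinite ρ := SigmaFinite.withDensity_ofReal _
  refine ⟨⟨⟨fun n => Subtype.val ⁻¹' spanningSets ρ n, fun n => trivial, fun n => ?_, ?_⟩⟩⟩
  · rw [theta_apply]
    exact (measure_mono (image_preimage_subset _ _)).trans_lt (measure_spanningSets_lt_top ρ n)
  · rw [← preimage_iUnion, iUnion_spanningSets, preimage_univ]

lemma lintegral_ofReal_inv {v T : ℝ} (hv : 0 < v) (hvT : v ≤ T) :
    ∫⁻ y in Ioc v T, ENNReal.ofReal y⁻¹ = ENNReal.ofReal (Real.log (T / v)) := by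
  have hT : 0 < T := hv.trans_le hvT
  rw [← integral_inv_of_pos hv hT, intervalIntegral.integral_of_le hvT,
    ofReal_integral_eq_lintegral_ofReal]
  · refine (intervalIntegrable_iff_integrableOn_Ioc_of_le hvT).1 ?_
    exact intervalIntegral.intervalIntegrable_inv (fun x hx => by
      rw [uIcc_of_le hvT] at hx
      exact (hv.trans_le hx.1).ne') continuousOn_id
  · refine (ae_restrict_iff' measurableSet_Ioc).2 (ae_of_all _ fun y hy => ?_)
    exact inv_nonneg.2 (hv.trans hy.1).le

lemma lintegral_ofReal_mul_inv_sq {T : ℝ} (hT : 0 < T) :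
    ∫⁻ y in Ioi T, ENNReal.ofReal (T * (y ^ 2)⁻¹) = 1 := by
  have e : ∀ y ∈ Ioi T, T * (y ^ 2)⁻¹ = T * y ^ (-2 : ℝ) := fun y hy => by
    rw [Real.rpow_neg (hT.trans hy).le]
    norm_num
  rw [setLIntegral_congr_fun measurableSet_Ioi (fun y hy => by rw [e y hy]),
    ← ofReal_integral_eq_lintegral_ofReal]
  · rw [integral_const_mul, integral_Ioi_rpow_of_lt (by norm_num) hT]
    norm_num
    rw [Real.rpow_neg_one]
    field_simp
  · exact (integrableOn_Ioi_rpow_of_lt (by norm_num) hT).const_mul _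
  · refine (ae_restrict_iff' measurableSet_Ioi).2 (ae_of_all _ fun y hy => ?_)
    have : 0 < y := hT.trans hy
    positivity

/-- The slice at height `y` has length `min(y, T)`. Integrated against `y⁻²`, the heights in `(v,
T]` contribute `log(T / v)` and those above `T` contribute `1`. -/
lemma theta_coneA_le {T v : ℝ} (hv : 0 < v) (hvT : v ≤ T) (t : ℝ) :
    θ (coneA T v t) ≤ ENNReal.ofReal (1 + Real.log (T / v)) := by
  have hT : 0 < T := hv.trans_le hvT
  set Q : Set (ℝ × ℝ) := {p | v ≤ p.2 ∧ p.1 ∈ Icc (t - min p.2 T / 2) (t + min p.2 T / 2)} with hQ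
  have hQm : MeasurableSet Q := by
    have e : Q = {p | v ≤ p.2} ∩ ({p | t - min p.2 T / 2 ≤ p.1} ∩ {p | p.1 ≤ t + min p.2 T / 2}) := by
      ext p; exact Iff.rfl
    rw [e]
    refine (measurableSet_le measurable_const measurable_snd).inter
      ((measurableSet_le ?_ ?_).inter (measurableSet_le ?_ ?_)) <;> fun_prop
  have hsub : Subtype.val '' coneA T v t ⊆ Q := by
    rintro _ ⟨p, ⟨h1, h2, h3⟩, rfl⟩
    exact ⟨h1, by linarith, by linarith⟩
  have h1 : θ (coneA T v t) ≤ ∫⁻ p in Q, ENNReal.ofReal ((p.2 ^ 2)⁻¹) := by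
    rw [theta_apply, ← withDensity_apply _ hQm]
    exact measure_mono hsub
  have h2 : ∫⁻ p in Q, ENNReal.ofReal ((p.2 ^ 2)⁻¹) =
      ∫⁻ y in Ici v, ENNReal.ofReal (min y T * (y ^ 2)⁻¹) := by
    rw [← lintegral_indicator hQm, Measure.volume_eq_prod,
      lintegral_prod_symm _ ((Measurable.indicator (by fun_prop) hQm).aemeasurable),
      ← lintegral_indicator measurableSet_Ici]
    refine lintegral_congr fun y => ?_
    by_cases hy : y ∈ Ici v
    · rw [indicator_of_mem hy]
      have e : ∀ s : ℝ, Q.indicator (fun p => ENNReal.ofReal ((p.2 ^ 2)⁻¹)) (s, y) =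
          (Icc (t - min y T / 2) (t + min y T / 2)).indicator
            (fun _ => ENNReal.ofReal ((y ^ 2)⁻¹)) s := by
        intro s
        by_cases hs : s ∈ Icc (t - min y T / 2) (t + min y T / 2)
        · rw [indicator_of_mem hs, indicator_of_mem (show (s, y) ∈ Q from ⟨hy, hs⟩)]
        · rw [indicator_of_notMem hs, indicator_of_notMem fun h : (s, y) ∈ Q => hs h.2]
      simp_rw [e]
      rw [lintegral_indicator measurableSet_Icc, setLIntegral_const, Real.volume_Icc,
        ← ENNReal.ofReal_mul (by positivity)]
      congr 1
      ring
    · rw [indicator_of_notMem hy]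
      have e : ∀ s : ℝ, Q.indicator (fun p => ENNReal.ofReal ((p.2 ^ 2)⁻¹)) (s, y) = 0 :=
        fun s => indicator_of_notMem (fun h : (s, y) ∈ Q => hy h.1) _
      simp_rw [e, lintegral_zero]
  have h3 : ∫⁻ y in Ici v, ENNReal.ofReal (min y T * (y ^ 2)⁻¹) =
      ENNReal.ofReal (Real.log (T / v)) + 1 := by
    rw [setLIntegral_congr Ioi_ae_eq_Ici.symm, ← Ioc_union_Ioi_eq_Ioi hvT,
      lintegral_union measurableSet_Ioi (by
        rw [disjoint_left]; intro y h1 h2; exact absurd h1.2 (not_le.2 h2))]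
    rw [← lintegral_ofReal_inv hv hvT, ← lintegral_ofReal_mul_inv_sq hT]
    congr 1
    · refine setLIntegral_congr_fun measurableSet_Ioc fun y hy => ?_
      have : 0 < y := hv.trans hy.1
      simp only [min_eq_left hy.2]
      congr 1
      field_simp
    · refine setLIntegral_congr_fun measurableSet_Ioi fun y hy => ?_
      simp only [min_eq_right (le_of_lt (mem_Ioi.1 hy))]
  refine h1.trans (le_of_eq ?_)
  rw [h2, h3, add_comm (1 : ℝ), ENNReal.ofReal_add (Real.log_nonneg ((one_le_div hv).2 hvT))
    zero_le_one, ENNReal.ofReal_one]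

/-- An upper bound of `log (1 / v)`, infinite at `v = 0`. -/
def invSqrt (v : ℝ) : ℝ≥0∞ := 2 * ENNReal.ofReal |v| ^ (-(1 / 2) : ℝ)

lemma measurable_invSqrt : Measurable invSqrt := by
  unfold invSqrt
  fun_prop

lemma log_inv_le_invSqrt (v : ℝ) : ENNReal.ofReal (Real.log |v|⁻¹) ≤ invSqrt v := by
  rcases eq_or_ne v 0 with rfl | hv
  · simp
  have hv' : 0 < |v| := abs_pos.2 hv
  unfold invSqrt
  rw [ENNReal.ofReal_rpow_of_pos hv', show (2 : ℝ≥0∞) = ENNReal.ofReal 2 by simp,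
    ← ENNReal.ofReal_mul zero_le_two]
  refine ENNReal.ofReal_le_ofReal ?_
  have h1 : Real.log |v|⁻¹ = 2 * Real.log (|v| ^ (-(1 / 2) : ℝ)) := by
    rw [Real.log_rpow hv', Real.log_inv]
    ring
  have h2 := Real.log_le_sub_one_of_pos (Real.rpow_pos_of_pos hv' (-(1 / 2)))
  rw [h1]
  linarith

/-- A common point of height `y` forces `|s - t| ≤ min(y, T)`, so the intersection lies in a cone
cut at `|s - t|`, whatever `l` is. The free length `d`, later `‖x - y‖`, splits the logarithm into a
deterministic part and a scale-free part to be averaged over the rotations. -/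
lemma theta_inter_le {T l s t d : ℝ} (hl : 0 < l) (hlT : l < T) (hd : 0 < d) :
    θ (coneA T l s ∩ coneA T l t) ≤
      ENNReal.ofReal (1 + Real.posLog (T / d)) + invSqrt ((s - t) / d) := by
  have hT := hl.trans hlT
  have hmem : ∀ p ∈ coneA T l s ∩ coneA T l t, |s - t| ≤ min p.1.2 T := by
    rintro p ⟨⟨-, h1, h2⟩, -, h3, h4⟩
    rw [abs_le]
    constructor <;> linarith
  -- For `s = t` the right side is infinite, since `0 ^ (-1/2) = ∞` in `ℝ≥0∞`.
  rcases eq_or_ne s t with rfl | hst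
  · simp [invSqrt]
  have hu : 0 < |s - t| := abs_pos.2 (sub_ne_zero.2 hst)
  rcases lt_or_ge T |s - t| with hTu | hTu
  · have : coneA T l s ∩ coneA T l t = ∅ := by
      refine eq_empty_of_forall_notMem fun p hp => ?_
      exact absurd ((hmem p hp).trans (min_le_right _ _)) (not_le.2 hTu)
    simp [this]
  · have hsub : coneA T l s ∩ coneA T l t ⊆ coneA T |s - t| s := fun p hp =>
      ⟨(hmem p hp).trans (min_le_left _ _), hp.1.2⟩
    refine ((measure_mono hsub).trans (theta_coneA_le hu hTu s)).trans ?_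
    have h1 : Real.log (T / |s - t|) = Real.log (T / d) + Real.log |(s - t) / d|⁻¹ := by
      rw [← Real.log_mul (by positivity) (by positivity)]
      congr 1
      rw [abs_div, abs_of_pos hd]
      field_simp
    rw [h1, ← add_assoc]
    refine ENNReal.ofReal_add_le.trans (add_le_add (ENNReal.ofReal_le_ofReal ?_)
      (log_inv_le_invSqrt _))
    gcongr
    exact le_max_right _ _

/-! ### Measurability and mass of the cone products over the orthogonal group. -/

section Cone

variable {m : ℕ} [NeZero m]

lemma measurable_firstCoord (x : EuclideanSpace ℝ (Fin m)) :
    Measurable fun g : G m => firstCoord g x := by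
  refine Continuous.measurable ?_
  unfold firstCoord Matrix.mulVec dotProduct
  refine continuous_finsetSum _ fun j _ => ?_
  exact (continuous_subtype_val.matrix_elem 0 j).mul continuous_const

lemma firstCoord_sub (g : G m) (x y : EuclideanSpace ℝ (Fin m)) :
    firstCoord g (x - y) = firstCoord g x - firstCoord g y := by
  simp [firstCoord, Matrix.mulVec_sub]

lemma measurableSet_cone (T l : ℝ) (x : EuclideanSpace ℝ (Fin m)) :
    MeasurableSet (cone T l x) := by
  have h0 : Measurable fun p : G m × S => firstCoord p.1 x :=
    (measurable_firstCoord x).comp measurable_fst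
  have h1 : Measurable fun p : G m × S => p.2.1.1 :=
    measurable_fst.comp (measurable_subtype_coe.comp measurable_snd)
  have h2 : Measurable fun p : G m × S => p.2.1.2 :=
    measurable_snd.comp (measurable_subtype_coe.comp measurable_snd)
  have e : cone T l x = {p | l ≤ p.2.1.2} ∩
      ({p | -(min p.2.1.2 T) / 2 ≤ p.2.1.1 - firstCoord p.1 x} ∩
      {p | p.2.1.1 - firstCoord p.1 x ≤ min p.2.1.2 T / 2}) := by ext p; exact Iff.rfl
  rw [e]
  refine (measurableSet_le measurable_const h2).inter
    ((measurableSet_le ?_ ?_).inter (measurableSet_le ?_ ?_)) <;> fun_prop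

variable (H : Measure (G m)) [IsProbabilityMeasure H]

lemma measure_cone_le {T l : ℝ} (hl : 0 < l) (hlT : l < T) (x : EuclideanSpace ℝ (Fin m)) :
    (H.prod θ) (cone T l x) ≤ ENNReal.ofReal (1 + Real.log (T / l)) := by
  rw [Measure.prod_apply (measurableSet_cone T l x)]
  refine (lintegral_mono fun g => theta_coneA_le hl hlT.le (firstCoord g x)).trans ?_
  simp

lemma measure_cone_lt_top {T l : ℝ} (hl : 0 < l) (hlT : l < T) (x : EuclideanSpace ℝ (Fin m)) :
    (H.prod θ) (cone T l x) < ∞ :=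
  (measure_cone_le H hl hlT x).trans_lt ENNReal.ofReal_lt_top

lemma measure_cone_inter_le {T l : ℝ} (hl : 0 < l) (hlT : l < T)
    {x y : EuclideanSpace ℝ (Fin m)} (hxy : x ≠ y) :
    (H.prod θ) (cone T l x ∩ cone T l y) ≤ ENNReal.ofReal (1 + Real.posLog (T / ‖x - y‖))
      + ∫⁻ g, invSqrt (firstCoord g (x - y) / ‖x - y‖) ∂H := by
  rw [Measure.prod_apply ((measurableSet_cone T l x).inter (measurableSet_cone T l y))]
  have hd : 0 < ‖x - y‖ := norm_pos_iff.2 (sub_ne_zero.2 hxy)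
  calc _ ≤ ∫⁻ g, (ENNReal.ofReal (1 + Real.posLog (T / ‖x - y‖))
        + invSqrt (firstCoord g (x - y) / ‖x - y‖)) ∂H := by
        refine lintegral_mono fun g => ?_
        rw [firstCoord_sub]
        exact theta_inter_le hl hlT hd
    _ = _ := by
        rw [lintegral_add_left measurable_const]
        simp

end Cone

/-! ### Averages over the orthogonal group -/

section Haar

variable {m : ℕ}

lemma transpose_mul_coe (g : G m) : g.1.transpose * g.1 = 1 :=
  (Matrix.mem_orthogonalGroup_iff' _ _).1 g.2

lemma norm_toEuclideanLin (g : G m) (z : EuclideanSpace ℝ (Fin m)) :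
    ‖Matrix.toEuclideanLin g.1 z‖ = ‖z‖ := by
  have h : ∀ v : EuclideanSpace ℝ (Fin m), ‖v‖ ^ 2 = v.ofLp ⬝ᵥ v.ofLp := fun v => by
    rw [EuclideanSpace.real_norm_sq_eq]
    simp [dotProduct, pow_two]
  have h2 : ‖Matrix.toEuclideanLin g.1 z‖ ^ 2 = ‖z‖ ^ 2 := by
    have e : (Matrix.toEuclideanLin g.1 z).ofLp = Matrix.mulVec g.1 z.ofLp := rfl
    rw [h, h, e, Matrix.dotProduct_mulVec, Matrix.vecMul_mulVec,
      ← Matrix.dotProduct_mulVec, transpose_mul_coe, Matrix.one_mulVec]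
  exact (sq_eq_sq₀ (norm_nonneg _) (norm_nonneg _)).1 h2

/-- The isometry of Euclidean space given by an orthogonal matrix. -/
def isom (g : G m) : EuclideanSpace ℝ (Fin m) ≃ₗᵢ[ℝ] EuclideanSpace ℝ (Fin m) :=
  LinearIsometry.toLinearIsometryEquiv ⟨Matrix.toEuclideanLin g.1, norm_toEuclideanLin g⟩ rfl

lemma isom_apply (g : G m) (z : EuclideanSpace ℝ (Fin m)) :
    (isom g z).ofLp = Matrix.mulVec g.1 z.ofLp := rfl

/-- The reflection in the hyperplane orthogonal to `z - z'` exchanges two vectors of equal norm.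
With right invariance, this transitivity makes the law of `firstCoord g z` depend only on `‖z‖`. -/
lemma exists_isom_eq {z z' : EuclideanSpace ℝ (Fin m)} (h : ‖z‖ = ‖z'‖) :
    ∃ g : G m, isom g z = z' := by
  set ρ := (Submodule.span ℝ {z - z'})ᗮ.reflection with hρ
  set b := (EuclideanSpace.basisFun (Fin m) ℝ) with hb
  have hmem := LinearIsometryEquiv.toMatrix_mem_unitaryGroup ρ b b
  have hmem' : LinearMap.toMatrix b.toBasis b.toBasis ρ.toLinearEquiv.toLinearMap ∈
      Matrix.orthogonalGroup (Fin m) ℝ := by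
    rw [Matrix.mem_orthogonalGroup_iff]
    exact (Matrix.mem_unitaryGroup_iff.1 hmem)
  refine ⟨⟨_, hmem'⟩, ?_⟩
  rw [← Submodule.reflection_sub h]
  ext i
  rw [isom_apply]
  have := LinearMap.toMatrix_mulVec_repr b.toBasis b.toBasis ρ.toLinearEquiv.toLinearMap z
  have h3 := congrFun this i
  have h4 : ⇑(b.toBasis.repr z) = z.ofLp := by
    ext j
    simp [hb]
  rw [h4] at h3
  simpa [hb] using h3

variable [NeZero m]

lemma firstCoord_mul (g h : G m) (z : EuclideanSpace ℝ (Fin m)) :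
    firstCoord (g * h) z = firstCoord g (isom h z) := by
  unfold firstCoord
  rw [isom_apply, Matrix.mulVec_mulVec]
  rfl

lemma firstCoord_smul (g : G m) (a : ℝ) (z : EuclideanSpace ℝ (Fin m)) :
    firstCoord g (a • z) = a * firstCoord g z := by
  simp [firstCoord, Matrix.mulVec_smul]

lemma measurable_firstCoord_uncurry :
    Measurable fun p : EuclideanSpace ℝ (Fin m) × G m => firstCoord p.2 p.1 := by
  have h1 : ∀ j : Fin m, Measurable fun p : EuclideanSpace ℝ (Fin m) × G m => p.2.1 0 j := fun j =>
    (Continuous.measurable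
      (continuous_subtype_val.matrix_elem 0 j : Continuous fun g : G m => g.1 0 j)).comp
      measurable_snd
  have h2 : ∀ j : Fin m, Measurable fun p : EuclideanSpace ℝ (Fin m) × G m => p.1.ofLp j := fun j =>
    (Continuous.measurable (by fun_prop : Continuous fun z : EuclideanSpace ℝ (Fin m) =>
      z.ofLp j)).comp measurable_fst
  unfold firstCoord Matrix.mulVec dotProduct
  exact Finset.measurable_sum _ fun j _ => (h1 j).mul (h2 j)

lemma lintegral_invSqrt_Icc_lt_top : ∫⁻ v in Icc (-1 : ℝ) 1, invSqrt v < ∞ := by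
  have h1 : ∫⁻ v in Ioc (0 : ℝ) 1, invSqrt v < ∞ := by
    have hi : IntegrableOn (fun x : ℝ => 2 * x ^ (-(1 / 2) : ℝ)) (Ioc 0 1) :=
      (((intervalIntegrable_iff_integrableOn_Ioc_of_le zero_le_one).1
        (intervalIntegral.intervalIntegrable_rpow' (by norm_num))).const_mul 2)
    have := hi.lintegral_lt_top
    refine lt_of_le_of_lt (le_of_eq ?_) this
    refine setLIntegral_congr_fun measurableSet_Ioc fun x hx => ?_
    simp only [invSqrt]
    rw [abs_of_pos hx.1, ENNReal.ofReal_rpow_of_pos hx.1, ENNReal.ofReal_mul zero_le_two]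
    simp
  have h2 : ∫⁻ v in Ico (-1 : ℝ) 0, invSqrt v < ∞ := by
    have := (Measure.measurePreserving_neg (volume : Measure ℝ)).setLIntegral_comp_preimage
      (measurableSet_Ioc (a := (0 : ℝ)) (b := 1)) measurable_invSqrt
    have hs : (Neg.neg ⁻¹' Ioc (0 : ℝ) 1) = Ico (-1 : ℝ) 0 := by
      ext x; simp [and_comm, neg_le]
    rw [hs] at this
    have e : ∀ x, invSqrt (-x) = invSqrt x := fun x => by simp [invSqrt]
    simp_rw [e] at this
    rwa [this]
  have hsub : Icc (-1 : ℝ) 1 ⊆ (Ico (-1 : ℝ) 0 ∪ Ioc 0 1) ∪ {0} := by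
    intro x hx
    rcases lt_trichotomy x 0 with h | h | h
    · exact Or.inl (Or.inl ⟨hx.1, h⟩)
    · exact Or.inr h
    · exact Or.inl (Or.inr ⟨h, hx.2⟩)
  calc _ ≤ ∫⁻ v in (Ico (-1 : ℝ) 0 ∪ Ioc 0 1) ∪ {0}, invSqrt v := lintegral_mono_set hsub
    _ ≤ (∫⁻ v in Ico (-1 : ℝ) 0 ∪ Ioc 0 1, invSqrt v) + ∫⁻ v in {0}, invSqrt v :=
        lintegral_union_le _ _ _
    _ = (∫⁻ v in Ico (-1 : ℝ) 0 ∪ Ioc 0 1, invSqrt v) := by simp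
    _ ≤ _ := lintegral_union_le _ _ _
    _ < ∞ := ENNReal.add_lt_top.2 ⟨h2, h1⟩

/-- The ball lies in a cube, where the coordinates separate and `|v|^(-1/2)` is integrable on `[-1,
1]`. -/
lemma lintegral_ball_invSqrt_lt_top :
    ∫⁻ z : EuclideanSpace ℝ (Fin m) in Metric.ball 0 1, invSqrt (z 0) < ∞ := by
  set Q : Set (Fin m → ℝ) := univ.pi fun _ => Icc (-1 : ℝ) 1 with hQ
  have hQm : MeasurableSet Q := MeasurableSet.univ_pi fun _ => measurableSet_Icc
  have hsub : Metric.ball (0 : EuclideanSpace ℝ (Fin m)) 1 ⊆ WithLp.ofLp ⁻¹' Q := by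
    intro z hz i _
    rw [mem_ball_zero_iff] at hz
    have := (PiLp.norm_apply_le z i).trans hz.le
    exact abs_le.1 this
  refine (lintegral_mono_set hsub).trans_lt ?_
  have hm : Measurable fun f : Fin m → ℝ => invSqrt (f 0) :=
    measurable_invSqrt.comp (measurable_pi_apply 0)
  rw [(PiLp.volume_preserving_ofLp (Fin m)).setLIntegral_comp_preimage hQm hm, volume_pi, hQ,
    Measure.restrict_pi_pi, ← lintegral_map (f := invSqrt) (g := fun f : Fin m → ℝ => f 0)
      measurable_invSqrt (measurable_pi_apply 0)]
  have := Measure.pi_map_eval (fun _ : Fin m => (volume : Measure ℝ).restrict (Icc (-1 : ℝ) 1)) 0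
  have h2 : Measure.map (fun f : Fin m → ℝ => f 0) (Measure.pi fun _ : Fin m =>
      (volume : Measure ℝ).restrict (Icc (-1 : ℝ) 1)) = _ := this
  rw [h2, lintegral_smul_measure]
  refine ENNReal.mul_lt_top ?_ lintegral_invSqrt_Icc_lt_top
  refine ENNReal.prod_lt_top fun i _ => ?_
  simp

variable (H : Measure (G m)) [H.IsMulRightInvariant]

lemma lintegral_firstCoord_eq {F : ℝ → ℝ≥0∞} {z z' : EuclideanSpace ℝ (Fin m)} (h : ‖z‖ = ‖z'‖) :
    ∫⁻ g, F (firstCoord g z) ∂H = ∫⁻ g, F (firstCoord g z') ∂H := by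
  obtain ⟨k, rfl⟩ := exists_isom_eq h
  simp_rw [← firstCoord_mul]
  exact (lintegral_mul_right_eq_self (μ := H) (fun g => F (firstCoord g z)) k).symm

lemma lintegral_invSqrt_firstCoord_eq {z z' : EuclideanSpace ℝ (Fin m)} (hz : z ≠ 0)
    (hz' : z' ≠ 0) : ∫⁻ g, invSqrt (firstCoord g z / ‖z‖) ∂H
      = ∫⁻ g, invSqrt (firstCoord g z' / ‖z'‖) ∂H := by
  have h := lintegral_firstCoord_eq H (F := invSqrt) (z := ‖z‖⁻¹ • z) (z' := ‖z'‖⁻¹ • z') (by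
    rw [norm_smul, norm_smul, norm_inv, norm_inv, norm_norm, norm_norm,
      inv_mul_cancel₀ (norm_ne_zero_iff.2 hz), inv_mul_cancel₀ (norm_ne_zero_iff.2 hz')])
  simp_rw [firstCoord_smul] at h
  simpa only [div_eq_inv_mul] using h

/-- The law of the first coordinate on the sphere is never computed. The average `c` is the same for
all directions, so `c` times the volume of the unit ball is an integral over the ball and the group.
After exchanging the integrals, rotation invariance of Lebesgue measure removes `g`. -/
lemma exists_lintegral_invSqrt_le [IsProbabilityMeasure H] : ∃ C : ℝ≥0, ∀ z : EuclideanSpace ℝ (Fin m), z ≠ 0 →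
    ∫⁻ g, invSqrt (firstCoord g z / ‖z‖) ∂H ≤ C := by
  set e : EuclideanSpace ℝ (Fin m) := EuclideanSpace.single 0 1 with he
  have he0 : e ≠ 0 := by
    intro h
    have := congrArg norm h
    simp [he] at this
  set c := ∫⁻ g, invSqrt (firstCoord g e / ‖e‖) ∂H with hc
  suffices hfin : c < ∞ by
    refine ⟨c.toNNReal, fun z hz => ?_⟩
    rw [ENNReal.coe_toNNReal hfin.ne]
    exact (lintegral_invSqrt_firstCoord_eq H hz he0).le
  set U := Metric.ball (0 : EuclideanSpace ℝ (Fin m)) 1 with hU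
  have hpos : 0 < volume U := Metric.measure_ball_pos _ _ one_pos
  -- Since `‖z‖ < 1`, the normalization increases the argument in absolute value, hence decreases
  -- `invSqrt`.
  have hmono : ∀ z ∈ U, ∀ g : G m, z ≠ 0 → invSqrt (firstCoord g z / ‖z‖) ≤
      invSqrt (firstCoord g z) := by
    intro z hz g hz0
    rw [hU, mem_ball_zero_iff] at hz
    unfold invSqrt
    rw [ENNReal.rpow_neg, ENNReal.rpow_neg]
    refine mul_le_mul_right (ENNReal.inv_le_inv.2 (ENNReal.rpow_le_rpow
      (ENNReal.ofReal_le_ofReal ?_) (by norm_num))) 2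
    rw [abs_div, abs_norm, le_div_iff₀ (norm_pos_iff.2 hz0)]
    nlinarith [abs_nonneg (firstCoord g z)]
  have h1 : c * volume U ≤ ∫⁻ z in U, ∫⁻ g, invSqrt (firstCoord g z) ∂H := by
    rw [← setLIntegral_const]
    refine lintegral_mono_ae ?_
    have hne : ∀ᵐ z ∂(volume.restrict U), z ≠ (0 : EuclideanSpace ℝ (Fin m)) := by
      refine ae_restrict_of_ae ?_
      have := (measure_singleton (μ := (volume : Measure (EuclideanSpace ℝ (Fin m)))) 0)
      exact compl_mem_ae_iff.2 this
    filter_upwards [hne, ae_restrict_mem measurableSet_ball] with z hz hzU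
    rw [hc, lintegral_invSqrt_firstCoord_eq H he0 hz]
    exact lintegral_mono fun g => hmono z hzU g hz
  have h2 : ∫⁻ z in U, ∫⁻ g, invSqrt (firstCoord g z) ∂H =
      ∫⁻ g, (∫⁻ z in U, invSqrt (firstCoord g z)) ∂H :=
    lintegral_lintegral_swap (measurable_invSqrt.comp measurable_firstCoord_uncurry).aemeasurable
  have h3 : ∀ g : G m, ∫⁻ z in U, invSqrt (firstCoord g z) = ∫⁻ z in U, invSqrt (z 0) := by
    intro g
    have hm : Measurable fun z : EuclideanSpace ℝ (Fin m) => invSqrt (z 0) :=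
      measurable_invSqrt.comp (Continuous.measurable (by fun_prop))
    have := (isom g).measurePreserving.setLIntegral_comp_preimage
      (measurableSet_ball (x := (0 : EuclideanSpace ℝ (Fin m))) (ε := 1)) hm
    rw [(isom g).preimage_ball, map_zero] at this
    exact this
  rw [h2] at h1
  simp_rw [h3] at h1
  rw [lintegral_const, measure_univ, mul_one] at h1
  by_contra hcon
  rw [not_lt, top_le_iff] at hcon
  rw [hcon, ENNReal.top_mul hpos.ne', top_le_iff] at h1
  exact lintegral_ball_invSqrt_lt_top.ne h1

end Haar

/-! ### Energy estimates -/

section Energy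

/-- Dyadic shells: if `2^(-(n+1)) < d < 2^(-n)`, the term of index `n` alone dominates `d^(-p)`. The
summand `1` covers `d ≥ 1`, and at `d = 0` the series diverges. -/
lemma rpow_neg_le_tsum {p d : ℝ} (hp : 0 ≤ p) (hd : 0 ≤ d) :
    ENNReal.ofReal d ^ (-p) ≤ 1 + ∑' n : ℕ,
      {e : ℝ | e < (1 / 2) ^ n}.indicator (fun _ => ENNReal.ofReal ((2 ^ (n + 1) : ℝ) ^ p)) d := by
  rcases le_or_gt 1 d with h1 | h1
  · refine le_trans ?_ le_self_add
    rw [ENNReal.rpow_neg]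
    exact ENNReal.inv_le_one.2 (by
      simpa using ENNReal.rpow_le_rpow (ENNReal.one_le_ofReal.2 h1) hp)
  refine le_trans ?_ le_add_self
  rcases hd.eq_or_lt with rfl | hd0
  · have : ∑' n : ℕ, {e : ℝ | e < (1 / 2) ^ n}.indicator
        (fun _ => ENNReal.ofReal ((2 ^ (n + 1) : ℝ) ^ p)) 0 = ∞ := by
      rw [eq_top_iff, ← ENNReal.tsum_const_eq_top_of_ne_zero (α := ℕ) one_ne_zero]
      refine ENNReal.tsum_le_tsum fun n => ?_
      rw [indicator_of_mem (by simp)]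
      rw [ENNReal.one_le_ofReal]
      exact Real.one_le_rpow (one_le_pow₀ one_le_two) hp
    rw [this]
    exact le_top
  · obtain ⟨n, hn1, hn2⟩ := exists_nat_pow_near_of_lt_one hd0 h1.le (y := (1 / 2 : ℝ))
      (by norm_num) (by norm_num)
    -- The indicators are strict, to match open balls; when `d` is exactly `(1/2)^n`, the term of
    -- index `n - 1` serves, and `n > 0` because `d < 1`.
    rcases eq_or_lt_of_le hn2 with h | h
    · rcases Nat.eq_zero_or_pos n with rfl | hn
      · simp at h; exact absurd h h1.ne
      · refine le_trans ?_ (ENNReal.le_tsum (n - 1))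
        have : d < (1 / 2) ^ (n - 1) := by
          rw [h]
          exact pow_lt_pow_right_of_lt_one₀ (by norm_num) (by norm_num) (by omega)
        rw [indicator_of_mem (by exact this), ENNReal.ofReal_rpow_of_pos hd0]
        refine ENNReal.ofReal_le_ofReal ?_
        rw [Real.rpow_neg hd, ← Real.inv_rpow hd, show n - 1 + 1 = n by omega]
        refine Real.rpow_le_rpow (inv_nonneg.2 hd) ?_ hp
        rw [h]
        simp
    · refine le_trans ?_ (ENNReal.le_tsum n)
      rw [indicator_of_mem (by exact h), ENNReal.ofReal_rpow_of_pos hd0]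
      refine ENNReal.ofReal_le_ofReal ?_
      rw [Real.rpow_neg hd, ← Real.inv_rpow hd]
      refine Real.rpow_le_rpow (inv_nonneg.2 hd) ?_ hp
      rw [inv_le_comm₀ hd0 (by positivity)]
      refine le_of_lt (lt_of_le_of_lt (le_of_eq ?_) hn1)
      simp

variable {E : Type*} [NormedAddCommGroup E] [MeasurableSpace E] [BorelSpace E]

/-- Frostman's condition bounds the potential, uniformly in the base point. -/
lemma lintegral_rpow_neg_le {ρ : Measure E} {p β D : ℝ} (hp : 0 ≤ p)
    (hD : 0 ≤ D) {x : E} (hρ1 : ρ univ ≤ 1)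
    (hx : ∀ r : ℝ, 0 < r → ρ (Metric.ball x r) ≤ ENNReal.ofReal D * ENNReal.ofReal (2 * r) ^ β) :
    ∫⁻ y, ENNReal.ofReal ‖x - y‖ ^ (-p) ∂ρ ≤
      1 + ENNReal.ofReal (2 ^ p * D * 2 ^ β) * (1 - ENNReal.ofReal (2 ^ (p - β)))⁻¹ := by
  have hmeas : Measurable fun y : E => ‖x - y‖ := by fun_prop
  have hmi : ∀ n : ℕ, Measurable fun y : E => {e : ℝ | e < (1 / 2) ^ n}.indicator
      (fun _ => ENNReal.ofReal ((2 ^ (n + 1) : ℝ) ^ p)) ‖x - y‖ := fun n =>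
    (measurable_const.indicator measurableSet_Iio).comp hmeas
  calc ∫⁻ y, ENNReal.ofReal ‖x - y‖ ^ (-p) ∂ρ
      ≤ ∫⁻ y, (1 + ∑' n : ℕ, {e : ℝ | e < (1 / 2) ^ n}.indicator
          (fun _ => ENNReal.ofReal ((2 ^ (n + 1) : ℝ) ^ p)) ‖x - y‖) ∂ρ :=
        lintegral_mono fun y => rpow_neg_le_tsum hp (norm_nonneg _)
    _ = ρ univ + ∑' n : ℕ, ∫⁻ y, {e : ℝ | e < (1 / 2) ^ n}.indicator
          (fun _ => ENNReal.ofReal ((2 ^ (n + 1) : ℝ) ^ p)) ‖x - y‖ ∂ρ := by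
        rw [lintegral_add_left measurable_const, lintegral_tsum fun n => (hmi n).aemeasurable]
        simp
    _ ≤ 1 + ∑' n : ℕ, ENNReal.ofReal (2 ^ p * D * 2 ^ β) * ENNReal.ofReal (2 ^ (p - β)) ^ n := by
        gcongr with n
        have e : ∀ y, {e : ℝ | e < (1 / 2) ^ n}.indicator
            (fun _ => ENNReal.ofReal ((2 ^ (n + 1) : ℝ) ^ p)) ‖x - y‖ =
            (Metric.ball x ((1 / 2) ^ n)).indicator
            (fun _ => ENNReal.ofReal ((2 ^ (n + 1) : ℝ) ^ p)) y := by
          intro y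
          have : y ∈ Metric.ball x ((1 / 2) ^ n) ↔ ‖x - y‖ ∈ {e : ℝ | e < (1 / 2) ^ n} := by
            rw [Metric.mem_ball', dist_eq_norm]
            rfl
          by_cases h : y ∈ Metric.ball x ((1 / 2) ^ n)
          · rw [indicator_of_mem h, indicator_of_mem (this.1 h)]
          · rw [indicator_of_notMem h, indicator_of_notMem fun h' => h (this.2 h')]
        simp_rw [e]
        rw [lintegral_indicator measurableSet_ball, setLIntegral_const]
        refine (mul_le_mul_right (hx _ (by positivity)) _).trans (le_of_eq ?_)
        rw [ENNReal.ofReal_rpow_of_pos (by positivity), ← ENNReal.ofReal_mul hD,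
          ← ENNReal.ofReal_mul (by positivity), ← ENNReal.ofReal_pow (by positivity),
          ← ENNReal.ofReal_mul (by positivity)]
        congr 1
        have a : ((2 : ℝ) ^ (n + 1)) ^ p = (2 ^ p) ^ n * 2 ^ p := by
          rw [← Real.rpow_pow_comm zero_le_two, pow_succ]
        have b : (2 * (1 / 2 : ℝ) ^ n) ^ β = 2 ^ β * ((2 ^ β) ^ n)⁻¹ := by
          rw [Real.mul_rpow zero_le_two (by positivity), ← Real.rpow_pow_comm (by norm_num),
            one_div, Real.inv_rpow zero_le_two, inv_pow]
        rw [a, b, Real.rpow_sub two_pos, div_pow]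
        ring
    _ = _ := by rw [ENNReal.tsum_mul_left, ENNReal.tsum_geometric]

end Energy

/-! ### Bounded potentials for measures of the class `R_α^e`. -/

section ClassRe

variable {m : ℕ}

/-- A ball of radius `r` has diameter at most `2r`, so the class gives Frostman's condition with
exponent `α + δ > p` on `K`, and the dyadic series is geometric with ratio `2^(p - α - δ) < 1`. -/
lemma ClassRe.exists_compact {α p : ℝ} {B : Set (EuclideanSpace ℝ (Fin m))}
    {κ : Measure (EuclideanSpace ℝ (Fin m))} [IsProbabilityMeasure κ] (hκB : κ Bᶜ = 0)
    (hκ : ClassRe α B κ) (hp : 0 ≤ p) (hpα : p < α) {ε : ℝ} (hε : 0 < ε) :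
    ∃ K : Set (EuclideanSpace ℝ (Fin m)), IsCompact K ∧ κ Kᶜ ≤ ENNReal.ofReal ε ∧
      ∃ C : ℝ≥0∞, C < ∞ ∧ ∀ x ∈ K, ∫⁻ y in K, ENNReal.ofReal ‖x - y‖ ^ (-p) ∂κ ≤ C := by
  obtain ⟨δ, hδ, D, hD, K, hK, hKε, hball⟩ := hκ ε hε
  have hemb : MeasurableEmbedding (Subtype.val : closure B → EuclideanSpace ℝ (Fin m)) :=
    MeasurableEmbedding.subtype_coe isClosed_closure.measurableSet
  have hcl : κ (closure B)ᶜ = 0 :=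
    measure_mono_null (compl_subset_compl.2 subset_closure) hκB
  refine ⟨Subtype.val '' K, hK.image continuous_subtype_val, ?_,
    1 + ENNReal.ofReal (2 ^ p * D * 2 ^ (α + δ)) * (1 - ENNReal.ofReal (2 ^ (p - (α + δ))))⁻¹,
    ?_, ?_⟩
  · rw [hemb.comap_apply] at hKε
    have hsub : (Subtype.val '' K)ᶜ ⊆ (closure B)ᶜ ∪ Subtype.val '' Kᶜ := by
      intro x hx
      by_cases h : x ∈ closure B
      · refine Or.inr ⟨⟨x, h⟩, fun hK => hx ⟨_, hK, rfl⟩, rfl⟩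
      · exact Or.inl h
    calc κ (Subtype.val '' K)ᶜ ≤ κ (closure B)ᶜ + κ (Subtype.val '' Kᶜ) :=
          (measure_mono hsub).trans (measure_union_le _ _)
      _ ≤ ENNReal.ofReal ε := by rw [hcl, zero_add]; exact hKε.le
  · refine ENNReal.add_lt_top.2 ⟨ENNReal.one_lt_top,
      ENNReal.mul_lt_top ENNReal.ofReal_lt_top (ENNReal.inv_lt_top.2 (tsub_pos_of_lt ?_))⟩
    rw [ENNReal.ofReal_lt_one]
    exact Real.rpow_lt_one_of_one_lt_of_neg one_lt_two (by linarith)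
  · rintro _ ⟨x, hxK, rfl⟩
    refine lintegral_rpow_neg_le hp hD.le ?_ fun r hr => ?_
    · exact (measure_mono (subset_univ _)).trans (by simpa using prob_le_one)
    · have h1 := hball x r hr
      rw [Measure.restrict_apply measurableSet_ball, hemb.comap_apply] at h1
      have h2 : Metric.ball (x : EuclideanSpace ℝ (Fin m)) r ∩ Subtype.val '' K ⊆
          Subtype.val '' (Metric.ball x r ∩ K) := by
        rintro _ ⟨hy, y, hyK, rfl⟩
        exact ⟨y, ⟨hy, hyK⟩, rfl⟩
      rw [Measure.restrict_apply measurableSet_ball]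
      refine ((measure_mono h2).trans h1).trans ?_
      gcongr
      · linarith
      · refine Metric.ediam_le fun a ha b hb => ?_
        rw [edist_dist]
        refine ENNReal.ofReal_le_ofReal ?_
        have := dist_triangle_right a b x
        rw [Metric.mem_ball] at ha hb
        linarith

end ClassRe

/-! ### Positive martingale fields -/

/-- A field `exp(om l x)`, `0 < l < T`, such that for each `x` it is a martingale of mean one as `l`
decreases, with moments of order two, and such that its integrals over large subsets of the space
are bounded in `L²`. -/
structure IsMartingaleField {Ω E : Type*} [mΩ : MeasurableSpace Ω] [MeasurableSpace E]
    (P : Measure Ω) (κ : Measure E) (T : ℝ) (om : ℝ → E → Ω → ℝ)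
    (ℱ : Filtration (Ioo (0 : ℝ) T)ᵒᵈ mΩ) : Prop where
  measurable : ∀ l ∈ Ioo 0 T, Measurable fun p : E × Ω => om l p.1 p.2
  lintegral_eq : ∀ l ∈ Ioo 0 T, ∀ x, ∫⁻ w, ENNReal.ofReal (Real.exp (om l x w)) ∂P = 1
  condExp_eq : ∀ i j : (Ioo (0 : ℝ) T)ᵒᵈ, i ≤ j → ∀ x,
    P[fun w => Real.exp (om (OrderDual.ofDual j).1 x w) | ℱ i] =ᵐ[P]
      fun w => Real.exp (om (OrderDual.ofDual i).1 x w)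
  complete : ∀ (i : (Ioo (0 : ℝ) T)ᵒᵈ) (f g : Ω → ℝ), StronglyMeasurable[ℱ i] f → Measurable g →
    g =ᵐ[P] f → StronglyMeasurable[ℱ i] g
  sq_le : ∀ a ∈ Ioo 0 T, ∃ M : ℝ≥0, ∀ l ∈ Ico a T, ∀ x,
    ∫⁻ w, ENNReal.ofReal (Real.exp (om l x w)) ^ 2 ∂P ≤ M
  regular : ∀ᵐ w ∂P, ∀ x, ∀ l ∈ Ioo 0 T, ContinuousWithinAt (fun r => om r x w) (Iic l) l
  trunc : ∀ ε : ℝ, 0 < ε → ∃ K : Set E, MeasurableSet K ∧ κ Kᶜ ≤ ENNReal.ofReal ε ∧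
    ∃ M : ℝ≥0, ∀ l ∈ Ioo 0 T,
      ∫⁻ w, (∫⁻ x in K, ENNReal.ofReal (Real.exp (om l x w)) ∂κ) ^ 2 ∂P ≤ M

/-! ### The process `ω_l(x)` gives a martingale field. -/

section Omega

/-- The part of the space above the scale `l`. -/
def above (m : ℕ) (l : ℝ) : Set (G m × S) := {p | l ≤ p.2.1.2}

lemma above_anti {m : ℕ} {l l' : ℝ} (h : l' ≤ l) : above m l ⊆ above m l' :=
  fun _ hp => h.trans hp

variable {m : ℕ} [NeZero m] {T : ℝ} {L : LevyTriplet} {Ω : Type*} [mΩ : MeasurableSpace Ω]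
  {P : Measure Ω} [IsProbabilityMeasure P] {μ : Set (G m × S) → Ω → ℝ}
  {H : Measure (G m)} [IsProbabilityMeasure H]
  {om : ℝ → EuclideanSpace ℝ (Fin m) → Ω → ℝ}

lemma cone_subset_above (T l : ℝ) (x : EuclideanSpace ℝ (Fin m)) : cone T l x ⊆ above m l :=
  fun _ h => h.1

lemma cone_anti {l l' : ℝ} (h : l' ≤ l) (x : EuclideanSpace ℝ (Fin m)) :
    cone T l x ⊆ cone T l' x :=
  fun _ hp => ⟨h.trans hp.1, hp.2⟩

lemma disjoint_above_cone_sdiff (T l l' : ℝ) (x : EuclideanSpace ℝ (Fin m)) :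
    Disjoint (above m l) (cone T l' x \ cone T l x) :=
  disjoint_left.2 fun _ hp hq => hq.2 ⟨hp, hq.1.2⟩

/-- The filtration generated by the random measure above the decreasing scale `l`. -/
def scaleFiltration (P : Measure Ω) (H : Measure (G m)) (μ : Set (G m × S) → Ω → ℝ) (T : ℝ) :
    Filtration (Ioo (0 : ℝ) T)ᵒᵈ mΩ where
  seq i := IsIndepScattered.sigmaOn P (H.prod θ) μ (above m (OrderDual.ofDual i).1)
  mono' _ _ h := IsIndepScattered.sigmaOn_mono (above_anti h)
  le' _ := completion_le

variable (hμ : IsIndepScattered P L.φ (H.prod θ) μ) (hom : IsOmega P T μ om)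
  (hψ1 : L.ψ 1 = 0) (hψ2 : L.PsiFinite 2)
  (hν : ∫⁻ x in Icc (-1) 1, ENNReal.ofReal |x| ∂L.ν < ∞)
include hμ hom hψ1 hψ2 hν

lemma lintegral_exp_om_mul {l : ℝ} (hl : l ∈ Ioo 0 T) (x y : EuclideanSpace ℝ (Fin m)) :
    ∫⁻ w, ENNReal.ofReal (Real.exp (om l x w)) * ENNReal.ofReal (Real.exp (om l y w)) ∂P =
      ENNReal.ofReal (Real.exp (((H.prod θ) (cone T l x ∩ cone T l y)).toReal * L.ψ 2)) := by
  rw [← hμ.lintegral_exp_mul_exp hν hψ2 hψ1 (measurableSet_cone T l x) (measurableSet_cone T l y)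
    (measure_cone_lt_top H hl.1 hl.2 x) (measure_cone_lt_top H hl.1 hl.2 y)]
  refine lintegral_congr_ae ?_
  filter_upwards [hom.ae_eq l hl x, hom.ae_eq l hl y] with w h1 h2
  rw [h1, h2]

/-- The two-point function is bounded by a Riesz kernel. -/
lemma exists_lintegral_exp_om_mul_le [H.IsMulRightInvariant] :
    ∃ C : ℝ≥0, ∀ l ∈ Ioo 0 T, ∀ x y,
    ∫⁻ w, ENNReal.ofReal (Real.exp (om l x w)) * ENNReal.ofReal (Real.exp (om l y w)) ∂P ≤
      C * (1 + ENNReal.ofReal ‖x - y‖ ^ (-(max (L.ψ 2) 0))) := by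
  obtain ⟨C, hC⟩ := exists_lintegral_invSqrt_le H
  -- The positive part spares a proof that `ψ 2` is nonnegative; when it is not, the two-point
  -- function is at most `1`.
  set p := max (L.ψ 2) 0 with hp
  have hp0 : 0 ≤ p := le_max_right _ _
  set C2 : ℝ := max 1 (Real.exp (p * (1 + C)) * max 1 (T ^ p)) with hC2
  have hC2_one : 1 ≤ C2 := le_max_left _ _
  refine ⟨C2.toNNReal, fun l hl x y => ?_⟩
  have hT : 0 < T := hl.1.trans hl.2
  rw [lintegral_exp_om_mul hμ hom hψ1 hψ2 hν hl]
  change _ ≤ ENNReal.ofReal C2 * _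
  have hC2' : 1 ≤ ENNReal.ofReal C2 := by rwa [ENNReal.one_le_ofReal]
  rcases le_or_gt (L.ψ 2) 0 with hψ | hψ
  · calc _ ≤ ENNReal.ofReal 1 := by
          refine ENNReal.ofReal_le_ofReal (Real.exp_le_one_iff.2 ?_)
          exact mul_nonpos_of_nonneg_of_nonpos ENNReal.toReal_nonneg hψ
      _ = 1 * 1 := by simp
      _ ≤ _ := mul_le_mul' hC2' le_self_add
  · have hpψ : p = L.ψ 2 := max_eq_left hψ.le
    rcases eq_or_ne x y with rfl | hxy
    · have : ENNReal.ofReal ‖x - x‖ ^ (-p) = ∞ := by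
        rw [sub_self, norm_zero, ENNReal.ofReal_zero, ENNReal.zero_rpow_of_neg]
        linarith
      rw [this, add_top, ENNReal.mul_top (by positivity)]
      exact le_top
    · have hd : 0 < ‖x - y‖ := norm_pos_iff.2 (sub_ne_zero.2 hxy)
      have h1 := (measure_cone_inter_le H hl.1 hl.2 hxy).trans
        (add_le_add_right (hC _ (sub_ne_zero.2 hxy)) _)
      have h2 : ((H.prod θ) (cone T l x ∩ cone T l y)).toReal ≤
          1 + Real.posLog (T / ‖x - y‖) + C := by
        refine ENNReal.toReal_le_of_le_ofReal
          (by have := Real.posLog_nonneg (x := T / ‖x - y‖); positivity) (h1.trans (le_of_eq ?_))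
        rw [ENNReal.ofReal_add (q := (C : ℝ)) (by
          have := Real.posLog_nonneg (x := T / ‖x - y‖); positivity) C.2,
          ENNReal.ofReal_coe_nnreal]
      -- The left side is `1` if `‖x - y‖ ≥ T` and `T^p ‖x - y‖^(-p)` otherwise.
      have h3 : Real.exp (p * Real.posLog (T / ‖x - y‖)) ≤
          max 1 (T ^ p) * (1 + ‖x - y‖ ^ (-p)) := by
        have hd' : 0 < ‖x - y‖ ^ (-p) := Real.rpow_pos_of_pos hd _
        rcases le_total (Real.log (T / ‖x - y‖)) 0 with h | h
        · rw [Real.posLog, max_eq_left h, mul_zero, Real.exp_zero]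
          nlinarith [le_max_left 1 (T ^ p)]
        · rw [Real.posLog, max_eq_right h, mul_comm, ← Real.rpow_def_of_pos (by positivity),
            Real.div_rpow hT.le hd.le, div_eq_mul_inv, ← Real.rpow_neg hd.le]
          have h4 := le_max_right 1 (T ^ p)
          have h5 := le_max_left 1 (T ^ p)
          nlinarith
      rw [ENNReal.ofReal_rpow_of_pos hd, ← ENNReal.ofReal_one,
        ← ENNReal.ofReal_add zero_le_one (by positivity), ← ENNReal.ofReal_mul (by positivity)]
      refine ENNReal.ofReal_le_ofReal ?_
      calc Real.exp (((H.prod θ) (cone T l x ∩ cone T l y)).toReal * L.ψ 2)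
          ≤ Real.exp ((1 + Real.posLog (T / ‖x - y‖) + C) * L.ψ 2) := by gcongr
        _ = Real.exp (p * (1 + C)) * Real.exp (p * Real.posLog (T / ‖x - y‖)) := by
            rw [← Real.exp_add, hpψ]
            congr 1
            ring
        _ ≤ Real.exp (p * (1 + C)) * (max 1 (T ^ p) * (1 + ‖x - y‖ ^ (-p))) := by gcongr
        _ = (Real.exp (p * (1 + C)) * max 1 (T ^ p)) * (1 + ‖x - y‖ ^ (-p)) := by ring
        _ ≤ C2 * (1 + ‖x - y‖ ^ (-p)) := by
            gcongr
            exact le_max_right _ _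

/-- By Tonelli the second moment is the double integral of the two-point function over `K × K`,
which the potential bound controls. -/
lemma exists_lintegral_sq_le [H.IsMulRightInvariant]
    {κ : Measure (EuclideanSpace ℝ (Fin m))} [IsProbabilityMeasure κ]
    {K : Set (EuclideanSpace ℝ (Fin m))} {C : ℝ≥0∞} (hCf : C < ∞)
    (hK : MeasurableSet K)
    (hC : ∀ x ∈ K, ∫⁻ y in K, ENNReal.ofReal ‖x - y‖ ^ (-(max (L.ψ 2) 0)) ∂κ ≤ C) :
    ∃ M : ℝ≥0, ∀ l ∈ Ioo 0 T,
      ∫⁻ w, (∫⁻ x in K, ENNReal.ofReal (Real.exp (om l x w)) ∂κ) ^ 2 ∂P ≤ M := by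
  obtain ⟨C1, hC1⟩ := exists_lintegral_exp_om_mul_le hμ hom hψ1 hψ2 hν
  refine ⟨(C1 * (1 + C)).toNNReal, fun l hl => ?_⟩
  rw [ENNReal.coe_toNNReal (ENNReal.mul_lt_top ENNReal.coe_lt_top
    (ENNReal.add_lt_top.2 ⟨ENNReal.one_lt_top, hCf⟩)).ne]
  set Y : EuclideanSpace ℝ (Fin m) → Ω → ℝ≥0∞ := fun x w =>
    ENNReal.ofReal (Real.exp (om l x w)) with hY
  have hm : Measurable fun q : EuclideanSpace ℝ (Fin m) × Ω => Y q.1 q.2 :=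
    ENNReal.measurable_ofReal.comp (Real.measurable_exp.comp (hom.measurable l hl))
  have hmx : ∀ x, Measurable (Y x) := fun x => hm.comp measurable_prodMk_left
  have hmw : ∀ w, Measurable fun x => Y x w := fun w => hm.comp measurable_prodMk_right
  calc ∫⁻ w, (∫⁻ x in K, Y x w ∂κ) ^ 2 ∂P
      = ∫⁻ w, ∫⁻ x in K, ∫⁻ y in K, Y x w * Y y w ∂κ ∂κ ∂P := by
        refine lintegral_congr fun w => ?_
        simp_rw [lintegral_const_mul _ (hmw w)]
        rw [lintegral_mul_const _ (hmw w), pow_two]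
    _ = ∫⁻ x in K, ∫⁻ w, ∫⁻ y in K, Y x w * Y y w ∂κ ∂P ∂κ := by
        refine lintegral_lintegral_swap ?_
        refine Measurable.aemeasurable ?_
        refine Measurable.lintegral_prod_right
          (f := fun (q : Ω × EuclideanSpace ℝ (Fin m)) y => Y q.2 q.1 * Y y q.1) ?_
        exact (hm.comp ((measurable_snd.comp measurable_fst).prodMk
          (measurable_fst.comp measurable_fst))).mul
          (hm.comp (measurable_snd.prodMk (measurable_fst.comp measurable_fst)))
    _ = ∫⁻ x in K, ∫⁻ y in K, ∫⁻ w, Y x w * Y y w ∂P ∂κ ∂κ := by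
        refine lintegral_congr fun x => ?_
        refine lintegral_lintegral_swap (Measurable.aemeasurable ?_)
        exact ((hmx x).comp measurable_fst).mul (hm.comp (measurable_snd.prodMk measurable_fst))
    _ ≤ ∫⁻ x in K, C1 * (1 + C) ∂κ := by
        refine setLIntegral_mono' hK fun x hx => ?_
        refine (lintegral_mono fun y => hC1 l hl x y).trans ?_
        rw [lintegral_const_mul _ (by fun_prop), lintegral_add_left measurable_const]
        gcongr
        · simpa using prob_le_one
        · exact hC x hx
    _ ≤ C1 * (1 + C) := by
        rw [setLIntegral_const]
        exact mul_le_of_le_one_right' prob_le_one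

theorem isMartingaleField [H.IsMulRightInvariant] {B : Set (EuclideanSpace ℝ (Fin m))}
    {α : ℝ} (hα : 0 < α)
    {κ : Measure (EuclideanSpace ℝ (Fin m))} [IsProbabilityMeasure κ] (hκB : κ Bᶜ = 0)
    (hκ : ClassRe α B κ) (hψα : L.ψ 2 < α) :
    IsMartingaleField P κ T om (scaleFiltration P H μ T) where
  measurable := hom.measurable
  lintegral_eq l hl x := by
    rw [← hμ.lintegral_exp_one hν hψ2 hψ1 (measurableSet_cone T l x)
      (measure_cone_lt_top H hl.1 hl.2 x)]
    refine lintegral_congr_ae ?_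
    filter_upwards [hom.ae_eq l hl x] with w h
    rw [h]
  condExp_eq i j hij x := by
    set l := (OrderDual.ofDual i) with hl
    set r := (OrderDual.ofDual j) with hr
    have hrl : r.1 ≤ l.1 := hij
    have h := hμ.condExp_exp hν hψ2 hψ1 (E₁ := above m l.1) (A := cone T l.1 x)
      (D := cone T r.1 x \ cone T l.1 x) (measurableSet_cone T l.1 x)
      (measure_cone_lt_top H l.2.1 l.2.2 x) (cone_subset_above T l.1 x)
      ((measurableSet_cone T r.1 x).diff (measurableSet_cone T l.1 x))
      ((measure_mono sdiff_subset).trans_lt (measure_cone_lt_top H r.2.1 r.2.2 x))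
      (disjoint_above_cone_sdiff T l.1 r.1 x)
    rw [union_sdiff_cancel (cone_anti hrl x)] at h
    have h1 : (fun w => Real.exp (om r.1 x w)) =ᵐ[P] fun w => Real.exp (μ (cone T r.1 x) w) := by
      filter_upwards [hom.ae_eq r.1 r.2 x] with w h
      rw [h]
    have h2 : (fun w => Real.exp (om l.1 x w)) =ᵐ[P] fun w => Real.exp (μ (cone T l.1 x) w) := by
      filter_upwards [hom.ae_eq l.1 l.2 x] with w h
      rw [h]
    exact ((condExp_congr_ae h1).trans h).trans h2.symm
  complete i f g hf hg hgf :=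
    (measurable_completion_of_ae_eq hf.measurable hg hgf).stronglyMeasurable
  sq_le a ha := by
    refine ⟨(Real.exp ((1 + Real.log (T / a)) * |L.ψ 2|)).toNNReal, fun l hl' x => ?_⟩
    have hl : l ∈ Ioo 0 T := ⟨ha.1.trans_le hl'.1, hl'.2⟩
    have h0 : 0 ≤ 1 + Real.log (T / l) := by
      have := Real.log_nonneg ((one_le_div hl.1).2 hl.2.le)
      linarith
    simp_rw [pow_two]
    rw [lintegral_exp_om_mul hμ hom hψ1 hψ2 hν hl, inter_self]
    refine ENNReal.ofReal_le_ofReal (Real.exp_le_exp.2 ?_)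
    have h1 : ((H.prod θ) (cone T l x)).toReal ≤ 1 + Real.log (T / l) :=
      ENNReal.toReal_le_of_le_ofReal h0 (measure_cone_le H hl.1 hl.2 x)
    have h2 : Real.log (T / l) ≤ Real.log (T / a) := by
      have := hl.1.trans hl.2
      have := hl.1
      have := ha.1
      refine Real.log_le_log (by positivity) ?_
      gcongr
      exact hl'.1
    calc _ ≤ ((H.prod θ) (cone T l x)).toReal * |L.ψ 2| := by
          gcongr
          exact le_abs_self _
      _ ≤ _ := by
          gcongr
          linarith
  regular := hom.regular
  trunc ε hε := by
    obtain ⟨K, hK, hKε, C, hCf, hC⟩ := hκ.exists_compact hκB (le_max_right (L.ψ 2) 0)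
      (max_lt hψα hα) hε
    exact ⟨K, hK.measurableSet, hKε,
      exists_lintegral_sq_le hμ hom hψ1 hψ2 hν hCf hK.measurableSet hC⟩

end Omega

/-! ### Maximal inequalities over countable sets of times -/

section Maximal

variable {Ω ι : Type*} [mΩ : MeasurableSpace Ω] {P : Measure Ω} [LinearOrder ι]
  {𝒢 : Filtration ι mΩ} {Z : ι → Ω → ℝ}

/-- Reduction to discrete time: a finite set of times is enumerated increasingly. The index `j`
obtained is its last element. -/
lemma maximal_ineq_finset [IsFiniteMeasure P] (hZ : Submartingale Z 𝒢 P) (h0 : 0 ≤ Z) {s : Finset ι}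
    (hs : s.Nonempty) (ε : ℝ≥0) :
    ∃ j ∈ s, ε * P {w | ∃ i ∈ s, (ε : ℝ) ≤ Z i w} ≤
      ∫⁻ w in {w | ∃ i ∈ s, (ε : ℝ) ≤ Z i w}, ENNReal.ofReal (Z j w) ∂P := by
  have hk : 0 < s.card := hs.card_pos
  set e := s.orderEmbOfFin rfl with he
  -- The enumeration is frozen at the last time, to give a sequence over all of `ℕ`.
  set g : ℕ → ι := fun n => e ⟨min n (s.card - 1), by omega⟩ with hg
  have hgm : Monotone g := fun a b hab => e.monotone (by
    rw [Fin.mk_le_mk]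
    omega)
  have hgs : ∀ n, g n ∈ s := fun n => s.orderEmbOfFin_mem rfl _
  set 𝒢' : Filtration ℕ mΩ := ⟨fun n => 𝒢 (g n), fun a b hab => 𝒢.mono (hgm hab),
    fun n => 𝒢.le _⟩ with h𝒢'
  have hZ' : Submartingale (fun n => Z (g n)) 𝒢' P :=
    ⟨fun n => hZ.1 (g n), fun a b hab => hZ.2.1 _ _ (hgm hab), fun n => hZ.2.2 _⟩
  have hset : {w | (ε : ℝ) ≤ (Finset.range (s.card - 1 + 1)).sup'
      Finset.nonempty_range_add_one fun k => Z (g k) w} = {w | ∃ i ∈ s, (ε : ℝ) ≤ Z i w} := by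
    ext w
    simp only [mem_ofPred_eq, Finset.le_sup'_iff, Finset.mem_range]
    constructor
    · rintro ⟨n, -, hn⟩
      exact ⟨g n, hgs n, hn⟩
    · rintro ⟨i, hi, hiw⟩
      have : i ∈ Set.range e := by
        rw [he, Finset.range_orderEmbOfFin]
        exact hi
      obtain ⟨⟨n, hn⟩, rfl⟩ := this
      refine ⟨n, by omega, ?_⟩
      have : (⟨min n (s.card - 1), by omega⟩ : Fin s.card) = ⟨n, hn⟩ := by
        ext
        simp only
        omega
      simp only [hg, this]
      exact hiw
  have h := maximal_ineq hZ' (fun n => h0 (g n)) (ε := ε) (s.card - 1)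
  rw [hset] at h
  refine ⟨g (s.card - 1), hgs _, ?_⟩
  rw [← ofReal_integral_eq_lintegral_ofReal (hZ.2.2 _).integrableOn (ae_of_all _ fun w => h0 _ w)]
  exact h

lemma measure_exists_le_of_finset {d : ℕ → ι} {ε : ℝ} {C : ℝ≥0∞}
    (h : ∀ s : Finset ι, s.Nonempty → (∀ i ∈ s, i ∈ range d) →
      P {w | ∃ i ∈ s, ε ≤ Z i w} ≤ C) : P {w | ∃ n, ε ≤ Z (d n) w} ≤ C := by
  have hU : {w | ∃ n, ε ≤ Z (d n) w} = ⋃ N : ℕ, {w | ∃ n ≤ N, ε ≤ Z (d n) w} := by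
    ext w
    simp only [mem_ofPred_eq, mem_iUnion]
    exact ⟨fun ⟨n, hn⟩ => ⟨n, n, le_rfl, hn⟩, fun ⟨_, n, _, hn⟩ => ⟨n, hn⟩⟩
  have hmono : Monotone fun N : ℕ => {w | ∃ n ≤ N, ε ≤ Z (d n) w} :=
    fun a b hab w ⟨n, hn, hw⟩ => ⟨n, hn.trans hab, hw⟩
  rw [hU, hmono.measure_iUnion]
  refine iSup_le fun N => ?_
  have := h ((Finset.range (N + 1)).image d) (by simp) (by
    intro i hi
    obtain ⟨n, -, rfl⟩ := Finset.mem_image.1 hi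
    exact mem_range_self n)
  refine (measure_mono ?_).trans this
  rintro w ⟨n, hn, hw⟩
  exact ⟨d n, Finset.mem_image_of_mem d (Finset.mem_range.2 (by omega)), hw⟩

/-- Doob's weak type `L¹` inequality. -/
lemma measure_exists_ge_le [IsFiniteMeasure P] (hZ : Submartingale Z 𝒢 P) (h0 : 0 ≤ Z) {d : ℕ → ι} {ε : ℝ≥0}
    (hε : 0 < ε) {C : ℝ≥0∞} (hC : ∀ n, ∫⁻ w, ENNReal.ofReal (Z (d n) w) ∂P ≤ C) :
    P {w | ∃ n, (ε : ℝ) ≤ Z (d n) w} ≤ C / ε := by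
  refine measure_exists_le_of_finset fun s hs hsd => ?_
  obtain ⟨j, hj, h⟩ := maximal_ineq_finset hZ h0 hs ε
  obtain ⟨n, rfl⟩ := hsd j hj
  rw [ENNReal.le_div_iff_mul_le (Or.inl (by exact_mod_cast hε.ne')) (Or.inl ENNReal.coe_ne_top),
    mul_comm]
  exact h.trans ((setLIntegral_le_lintegral _ _).trans (hC n))

/-- Doob's weak type `L²` inequality. -/
lemma measure_exists_ge_le_sq [IsFiniteMeasure P] (hZ : Submartingale Z 𝒢 P) (h0 : 0 ≤ Z) {d : ℕ → ι} {ε : ℝ≥0}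
    (hε : 0 < ε) {M : ℝ≥0} (hM : ∀ n, ∫⁻ w, ENNReal.ofReal (Z (d n) w) ^ 2 ∂P ≤ M) :
    P {w | ∃ n, (ε : ℝ) ≤ Z (d n) w} ≤ M / ε ^ 2 := by
  refine measure_exists_le_of_finset fun s hs hsd => ?_
  obtain ⟨j, hj, h⟩ := maximal_ineq_finset hZ h0 hs ε
  obtain ⟨n, rfl⟩ := hsd j hj
  set A := {w | ∃ i ∈ s, (ε : ℝ) ≤ Z i w} with hA
  -- Integrating `2εZ ≤ ε² + Z²` over `A` turns the `L¹` inequality into `2ε² P(A) ≤ ε² P(A) + M`,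
  -- without passing through the submartingale `Z²`.
  have hpt : ∀ w, 2 * ε * ENNReal.ofReal (Z (d n) w) ≤ ε ^ 2 + ENNReal.ofReal (Z (d n) w) ^ 2 := by
    intro w
    have h1 : 2 * (ε : ℝ≥0∞) * ENNReal.ofReal (Z (d n) w) =
        ((2 * ε * (Z (d n) w).toNNReal : ℝ≥0) : ℝ≥0∞) := by push_cast; rfl
    have h2 : (ε : ℝ≥0∞) ^ 2 + ENNReal.ofReal (Z (d n) w) ^ 2 =
        ((ε ^ 2 + (Z (d n) w).toNNReal ^ 2 : ℝ≥0) : ℝ≥0∞) := by push_cast; rfl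
    rw [h1, h2, ENNReal.coe_le_coe]
    exact two_mul_le_add_sq _ _
  have h3 : 2 * ε * (ε * P A) ≤ ε ^ 2 * P A + M := by
    calc 2 * ε * (ε * P A) ≤ 2 * ε * ∫⁻ w in A, ENNReal.ofReal (Z (d n) w) ∂P := by gcongr
      _ = ∫⁻ w in A, 2 * ε * ENNReal.ofReal (Z (d n) w) ∂P := by
          rw [lintegral_const_mul' _ _ (by finiteness)]
      _ ≤ ∫⁻ w in A, (ε ^ 2 + ENNReal.ofReal (Z (d n) w) ^ 2) ∂P := lintegral_mono hpt
      _ = ε ^ 2 * P A + ∫⁻ w in A, ENNReal.ofReal (Z (d n) w) ^ 2 ∂P := by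
          rw [lintegral_add_left measurable_const, setLIntegral_const]
      _ ≤ ε ^ 2 * P A + M := by
          gcongr
          exact (setLIntegral_le_lintegral _ _).trans (hM n)
  have h4 : ε ^ 2 * P A ≤ M := by
    have h5 : 2 * (ε : ℝ≥0∞) * (ε * P A) = ε ^ 2 * P A + ε ^ 2 * P A := by ring
    rw [h5] at h3
    exact (ENNReal.add_le_add_iff_left (by finiteness)).1 h3
  rw [ENNReal.le_div_iff_mul_le (Or.inl (by positivity)) (Or.inl (by finiteness)), mul_comm]
  exact h4

end Maximal

/-! ### Conditional expectations of integrals over a parameter -/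

section CondExp

variable {Ω E : Type*} {m : MeasurableSpace Ω} [mΩ : MeasurableSpace Ω] [MeasurableSpace E]
  {P : Measure Ω} [IsProbabilityMeasure P]

/-- Conditional expectation is self-adjoint. Here `s` need not belong to `m`: testing against all
events later identifies a conditional expectation whose candidate is not known in advance to be
`m`-measurable. -/
lemma setIntegral_condExp_eq (hm : m ≤ mΩ) {s : Set Ω} (hs : MeasurableSet s) {X : Ω → ℝ}
    (hX : Integrable X P) :
    ∫ w in s, P[X | m] w ∂P = ∫ w, P[s.indicator (fun _ => (1 : ℝ)) | m] w * X w ∂P := by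
  set A : Ω → ℝ := s.indicator fun _ => 1 with hA
  have hAi : Integrable A P := (integrable_const 1).indicator hs
  have hAb : ∀ w, ‖A w‖ ≤ 1 := fun w => by
    rw [hA]
    refine (norm_indicator_le_norm_self _ _).trans (by simp)
  have hZb : ∀ᵐ w ∂P, ‖P[A | m] w‖ ≤ (1 : ℝ) :=
    ae_bdd_abs_condExp_of_ae_bdd_abs (R := 1) (ae_of_all _ fun w => by simpa using hAb w)
  have h1 := condExp_stronglyMeasurable_mul_of_bound hm (stronglyMeasurable_condExp (f := A)
    (μ := P) (m := m)) hX _ hZb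
  have hgi : Integrable (A * P[X | m]) P :=
    integrable_condExp.bdd_mul hAi.aestronglyMeasurable (ae_of_all _ hAb)
  have h2 := condExp_mul_of_stronglyMeasurable_right (m := m)
    (stronglyMeasurable_condExp (f := X) (μ := P)) hgi hAi
  calc ∫ w in s, P[X | m] w ∂P = ∫ w, (A * P[X | m]) w ∂P := by
        rw [← integral_indicator hs]
        refine integral_congr_ae (ae_of_all _ fun w => ?_)
        by_cases h : w ∈ s <;> simp [hA, h]
    _ = ∫ w, (P[A | m] * P[X | m]) w ∂P := by
        rw [← integral_condExp hm]
        exact integral_congr_ae h2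
    _ = ∫ w, (P[A | m] * X) w ∂P := by
        rw [← integral_condExp hm (f := P[A | m] * X)]
        exact (integral_congr_ae h1).symm

variable {κ : Measure E} [SFinite κ] {Y Y' : E → Ω → ℝ}

/-- Conditional expectation commutes with integration over a parameter. -/
lemma condExp_integral_eq (hm : m ≤ mΩ)
    (hY : Integrable (fun p : E × Ω => Y p.1 p.2) (κ.prod P))
    (hY' : Integrable (fun p : E × Ω => Y' p.1 p.2) (κ.prod P))
    (h : ∀ᵐ x ∂κ, P[Y' x | m] =ᵐ[P] Y x) :
    P[fun w => ∫ x, Y' x w ∂κ | m] =ᵐ[P] fun w => ∫ x, Y x w ∂κ := by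
  have hi : Integrable (fun w => ∫ x, Y x w ∂κ) P := hY.integral_prod_right
  have hi' : Integrable (fun w => ∫ x, Y' x w ∂κ) P := hY'.integral_prod_right
  refine Integrable.ae_eq_of_forall_setIntegral_eq _ _ integrable_condExp hi fun s hs _ => ?_
  rw [setIntegral_condExp_eq hm hs hi']
  set Z := P[s.indicator (fun _ => (1 : ℝ)) | m] with hZ
  have hZm : Measurable Z := (stronglyMeasurable_condExp.mono hm).measurable
  have hZb : ∀ᵐ w ∂P, ‖Z w‖ ≤ (1 : ℝ) :=
    ae_bdd_abs_condExp_of_ae_bdd_abs (R := 1) (ae_of_all _ fun w => by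
      have := norm_indicator_le_norm_self (s := s) (fun _ : Ω => (1 : ℝ)) w
      simpa using this)
  have hZY : Integrable (fun p : E × Ω => Z p.2 * Y' p.1 p.2) (κ.prod P) :=
    hY'.bdd_mul (hZm.comp measurable_snd).aestronglyMeasurable
      (Measure.quasiMeasurePreserving_snd.ae hZb)
  calc ∫ w, Z w * ∫ x, Y' x w ∂κ ∂P = ∫ w, ∫ x, Z w * Y' x w ∂κ ∂P := by
        simp_rw [integral_const_mul]
    _ = ∫ x, ∫ w, Z w * Y' x w ∂P ∂κ := (integral_integral_swap hZY).symm
    _ = ∫ x, ∫ w in s, Y x w ∂P ∂κ := by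
        refine integral_congr_ae ?_
        filter_upwards [h, hY'.prod_right_ae] with x hx hx'
        rw [← setIntegral_condExp_eq hm hs hx']
        exact setIntegral_congr_ae hs (hx.mono fun w hw _ => hw)
    _ = ∫ w in s, ∫ x, Y x w ∂κ ∂P := by
        refine integral_integral_swap (f := Y) (ν := P.restrict s) ?_
        exact hY.mono_measure (Measure.prod_mono le_rfl Measure.restrict_le_self)

end CondExp

/-! ### `L²`-bounded martingales -/

section LTwo

variable {Ω ι : Type*} [mΩ : MeasurableSpace Ω] {P : Measure Ω} [IsProbabilityMeasure P]
  [Preorder ι] {𝒢 : Filtration ι mΩ} {X : ι → Ω → ℝ}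

/-- The increment `X j - X i` is orthogonal to `X i`. -/
lemma integral_sq_sub_eq (hX : Martingale X 𝒢 P) (h2 : ∀ i, MemLp (X i) 2 P) {i j : ι}
    (hij : i ≤ j) :
    ∫ w, (X j w - X i w) ^ 2 ∂P = ∫ w, X j w ^ 2 ∂P - ∫ w, X i w ^ 2 ∂P := by
  have hij2 : Integrable (X i * X j) P := (h2 i).integrable_mul (h2 j)
  have hii : Integrable (fun w => X i w ^ 2) P := (h2 i).integrable_sq
  have hjj : Integrable (fun w => X j w ^ 2) P := (h2 j).integrable_sq
  have h3 : ∫ w, (X i * X j) w ∂P = ∫ w, X i w ^ 2 ∂P := by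
    rw [← integral_condExp (𝒢.le i)]
    refine integral_congr_ae ?_
    filter_upwards [condExp_mul_of_stronglyMeasurable_left (hX.1 i) hij2 (hX.integrable j),
      hX.2 i j hij] with w h1 h2
    rw [h1, Pi.mul_apply, h2, pow_two]
  have e : ∀ w, (X j w - X i w) ^ 2 = X j w ^ 2 - 2 * (X i * X j) w + X i w ^ 2 := fun w => by
    simp only [Pi.mul_apply]
    ring
  simp_rw [e]
  have h4 : Integrable (fun w => X j w ^ 2 - 2 * (X i * X j) w) P := hjj.sub (hij2.const_mul 2)
  rw [integral_add h4 hii, integral_sub hjj (hij2.const_mul 2), integral_const_mul, h3]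
  ring

lemma integral_abs_le_of_sq {Z : Ω → ℝ} (hZ : MemLp Z 2 P) {ε : ℝ} (hε : 0 < ε)
    (h : ∫ w, Z w ^ 2 ∂P ≤ ε ^ 2) : ∫ w, |Z w| ∂P ≤ ε := by
  have h1 : ∀ w, |Z w| ≤ ε / 2 + (2 * ε)⁻¹ * Z w ^ 2 := fun w => by
    have h3 : ε / 2 + (2 * ε)⁻¹ * Z w ^ 2 - |Z w| = (2 * ε)⁻¹ * (|Z w| - ε) ^ 2 := by
      rw [← sq_abs (Z w)]
      field_simp
      ring
    have : 0 ≤ (2 * ε)⁻¹ * (|Z w| - ε) ^ 2 := by positivity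
    linarith
  calc ∫ w, |Z w| ∂P ≤ ∫ w, (ε / 2 + (2 * ε)⁻¹ * Z w ^ 2) ∂P :=
        integral_mono (hZ.integrable one_le_two).abs
          ((integrable_const _).add (hZ.integrable_sq.const_mul _)) h1
    _ = ε / 2 + (2 * ε)⁻¹ * ∫ w, Z w ^ 2 ∂P := by
        rw [integral_add (integrable_const _) (hZ.integrable_sq.const_mul _), integral_const_mul]
        simp
    _ ≤ ε / 2 + (2 * ε)⁻¹ * ε ^ 2 := by gcongr
    _ = ε := by field_simp; ring

/-- An `L²`-bounded martingale is Cauchy in `L¹`. -/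
lemma exists_integral_abs_sub_le [Nonempty ι] (hX : Martingale X 𝒢 P) (h2 : ∀ i, MemLp (X i) 2 P)
    {M : ℝ} (hM : ∀ i, ∫ w, X i w ^ 2 ∂P ≤ M) {ε : ℝ} (hε : 0 < ε) :
    ∃ i₀, ∀ j, i₀ ≤ j → ∫ w, |X j w - X i₀ w| ∂P ≤ ε := by
  have hbdd : BddAbove (range fun i => ∫ w, X i w ^ 2 ∂P) := ⟨M, by rintro _ ⟨i, rfl⟩; exact hM i⟩
  -- The second moment at `i₀` is within `ε²` of the supremum, so by orthogonality no later
  -- increment has second moment above `ε²`.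
  obtain ⟨i₀, hi₀⟩ := exists_lt_of_lt_ciSup
    (show (⨆ i, ∫ w, X i w ^ 2 ∂P) - ε ^ 2 < ⨆ i, ∫ w, X i w ^ 2 ∂P by
      have : 0 < ε ^ 2 := by positivity
      linarith)
  refine ⟨i₀, fun j hj => integral_abs_le_of_sq ((h2 j).sub (h2 i₀)) hε ?_⟩
  have h3 := integral_sq_sub_eq hX h2 hj
  have h4 := le_ciSup hbdd j
  simp only [Pi.sub_apply]
  linarith

end LTwo

/-! ### The martingales of a martingale field -/

/-- The integral of `f` against `exp(om l x) κ(dx)`. -/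
def chaosInt {Ω E : Type*} [MeasurableSpace E] (κ : Measure E) (om : ℝ → E → Ω → ℝ) (f : E → ℝ)
    (l : ℝ) (w : Ω) : ℝ :=
  ∫ x, f x * Real.exp (om l x w) ∂κ

lemma enorm_chaosInt_le {Ω E : Type*} [MeasurableSpace E] (κ : Measure E) (om : ℝ → E → Ω → ℝ) (l : ℝ) (f : E → ℝ) (w : Ω) :
    ‖chaosInt κ om f l w‖ₑ ≤ ∫⁻ x, ‖f x‖ₑ * ENNReal.ofReal (Real.exp (om l x w)) ∂κ := by
  refine (enorm_integral_le_lintegral_enorm _).trans (le_of_eq (lintegral_congr fun x => ?_))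
  rw [enorm_mul, Real.enorm_of_nonneg (Real.exp_pos (om l x w)).le]

namespace IsMartingaleField

variable {Ω E : Type*} [mΩ : MeasurableSpace Ω] [MeasurableSpace E] {P : Measure Ω}
  {κ : Measure E} {T : ℝ} {om : ℝ → E → Ω → ℝ} {ℱ : Filtration (Ioo (0 : ℝ) T)ᵒᵈ mΩ} {f : E → ℝ}
  {c : ℝ}

variable (hF : IsMartingaleField P κ T om ℱ)
include hF

lemma measurable_exp {l : ℝ} (hl : l ∈ Ioo 0 T) :
    Measurable fun p : E × Ω => Real.exp (om l p.1 p.2) :=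
  Real.measurable_exp.comp (hF.measurable l hl)

lemma measurable_chaosInt [SFinite κ] {l : ℝ} (hl : l ∈ Ioo 0 T) (hf : Measurable f) :
    Measurable (chaosInt κ om f l) := by
  have h1 : StronglyMeasurable fun p : Ω × E => f p.2 * Real.exp (om l p.2 p.1) :=
    ((hf.comp measurable_snd).mul ((hF.measurable_exp hl).comp measurable_swap)).stronglyMeasurable
  exact h1.integral_prod_right.measurable

lemma lintegral_sq_chaosInt_le (hfc : ∀ x, |f x| ≤ c) {K : Set E} (hK : MeasurableSet K)
    (hfK : ∀ x ∉ K, f x = 0) {M : ℝ≥0} {l : ℝ} (hl : l ∈ Ioo 0 T)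
    (hM : ∫⁻ w, (∫⁻ x in K, ENNReal.ofReal (Real.exp (om l x w)) ∂κ) ^ 2 ∂P ≤ M) :
    ∫⁻ w, ‖chaosInt κ om f l w‖ₑ ^ 2 ∂P ≤ ENNReal.ofReal c ^ 2 * M := by
  have hm : ∀ w, Measurable fun x => ENNReal.ofReal (Real.exp (om l x w)) := fun w =>
    (ENNReal.measurable_ofReal.comp (hF.measurable_exp hl)).comp measurable_prodMk_right
  calc _ ≤ ∫⁻ w, ENNReal.ofReal c ^ 2 *
        (∫⁻ x in K, ENNReal.ofReal (Real.exp (om l x w)) ∂κ) ^ 2 ∂P := by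
        refine lintegral_mono fun w => ?_
        rw [← mul_pow, ← lintegral_const_mul _ (hm w)]
        refine pow_le_pow_left' ((enorm_chaosInt_le κ om l f w).trans ?_) 2
        rw [← lintegral_indicator hK]
        refine lintegral_mono fun x => ?_
        by_cases hx : x ∈ K
        · rw [indicator_of_mem hx, Real.enorm_eq_ofReal_abs]
          exact mul_le_mul_left (ENNReal.ofReal_le_ofReal (hfc x)) _
        · rw [indicator_of_notMem hx, hfK x hx]
          simp
    _ ≤ _ := by
        rw [lintegral_const_mul' _ _ (by finiteness)]
        gcongr

variable [IsProbabilityMeasure P] [IsProbabilityMeasure κ]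

lemma lintegral_prod_eq {l : ℝ} (hl : l ∈ Ioo 0 T) {g : E → ℝ≥0∞} (hg : Measurable g) :
    ∫⁻ w, ∫⁻ x, g x * ENNReal.ofReal (Real.exp (om l x w)) ∂κ ∂P = ∫⁻ x, g x ∂κ := by
  have hm : Measurable fun p : E × Ω => ENNReal.ofReal (Real.exp (om l p.1 p.2)) :=
    ENNReal.measurable_ofReal.comp (hF.measurable_exp hl)
  have hmx : ∀ x, Measurable fun w => ENNReal.ofReal (Real.exp (om l x w)) := fun x =>
    hm.comp measurable_prodMk_left
  rw [lintegral_lintegral_swap]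
  · refine lintegral_congr fun x => ?_
    rw [lintegral_const_mul _ (hmx x), hF.lintegral_eq l hl, mul_one]
  · exact ((hg.comp measurable_snd).mul (hm.comp measurable_swap)).aemeasurable

lemma integrable_prod {l : ℝ} (hl : l ∈ Ioo 0 T) (hf : Measurable f) (hfc : ∀ x, |f x| ≤ c) :
    Integrable (fun p : E × Ω => f p.1 * Real.exp (om l p.1 p.2)) (κ.prod P) := by
  have hi : Integrable (fun p : E × Ω => Real.exp (om l p.1 p.2)) (κ.prod P) := by
    refine ⟨(hF.measurable_exp hl).aestronglyMeasurable, ?_⟩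
    have hm : Measurable fun p : E × Ω => ENNReal.ofReal (Real.exp (om l p.1 p.2)) :=
      ENNReal.measurable_ofReal.comp (hF.measurable_exp hl)
    rw [hasFiniteIntegral_iff_ofReal (ae_of_all _ fun p => (Real.exp_pos _).le),
      lintegral_prod _ hm.aemeasurable]
    simp [hF.lintegral_eq l hl]
  exact hi.bdd_mul (hf.comp measurable_fst).aestronglyMeasurable (ae_of_all _ fun p => hfc p.1)

lemma integrable_chaosInt {l : ℝ} (hl : l ∈ Ioo 0 T) (hf : Measurable f) (hfc : ∀ x, |f x| ≤ c) :
    Integrable (chaosInt κ om f l) P :=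
  (hF.integrable_prod hl hf hfc).integral_prod_right

lemma condExp_chaosInt {i j : (Ioo (0 : ℝ) T)ᵒᵈ} (hij : i ≤ j) (hf : Measurable f)
    (hfc : ∀ x, |f x| ≤ c) :
    P[chaosInt κ om f (OrderDual.ofDual j).1 | ℱ i] =ᵐ[P]
      chaosInt κ om f (OrderDual.ofDual i).1 := by
  refine condExp_integral_eq (ℱ.le i) (hF.integrable_prod (OrderDual.ofDual i).2 hf hfc)
    (hF.integrable_prod (OrderDual.ofDual j).2 hf hfc) (ae_of_all _ fun x => ?_)
  refine (condExp_smul (μ := P) (f x) (fun w => Real.exp (om (OrderDual.ofDual j).1 x w))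
    (ℱ i)).trans ?_
  filter_upwards [hF.condExp_eq i j hij x] with w hw
  rw [Pi.smul_apply, hw, smul_eq_mul]

/-- Adaptedness comes from completeness of the filtration: the integral agrees almost surely with
its own conditional expectation. No measurability of the field jointly in the point and `ℱ i` is
needed. -/
lemma martingale_chaosInt (hf : Measurable f) (hfc : ∀ x, |f x| ≤ c) :
    Martingale (fun (i : (Ioo (0 : ℝ) T)ᵒᵈ) => chaosInt κ om f (OrderDual.ofDual i).1) ℱ P :=
  ⟨fun i => hF.complete i _ _ stronglyMeasurable_condExp
    (hF.measurable_chaosInt (OrderDual.ofDual i).2 hf) (hF.condExp_chaosInt le_rfl hf hfc).symm,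
    fun _ _ hij => hF.condExp_chaosInt hij hf hfc⟩

lemma integral_chaosInt {l : ℝ} (hl : l ∈ Ioo 0 T) (hf : Measurable f) (hfc : ∀ x, |f x| ≤ c) :
    ∫ w, chaosInt κ om f l w ∂P = ∫ x, f x ∂κ := by
  unfold chaosInt
  rw [← integral_integral_swap (f := fun x w => f x * Real.exp (om l x w))
    (hF.integrable_prod hl hf hfc)]
  refine integral_congr_ae (ae_of_all _ fun x => ?_)
  simp only
  rw [integral_const_mul, integral_eq_lintegral_of_nonneg_ae
    (ae_of_all _ fun w => (Real.exp_pos _).le)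
    ((hF.measurable_exp hl).comp measurable_prodMk_left).aestronglyMeasurable,
    hF.lintegral_eq l hl]
  simp

lemma integral_abs_chaosInt_le {l : ℝ} (hl : l ∈ Ioo 0 T) (hf : Measurable f)
    (hfc : ∀ x, |f x| ≤ c) {K : Set E} (hK : MeasurableSet K) (hfK : ∀ x ∉ K, f x = 0) :
    ∫ w, |chaosInt κ om f l w| ∂P ≤ c * κ.real K := by
  have hc : 0 ≤ c := by
    obtain ⟨x⟩ : Nonempty E := nonempty_of_isProbabilityMeasure κ
    exact (abs_nonneg _).trans (hfc x)
  rw [integral_eq_lintegral_of_nonneg_ae (ae_of_all _ fun w => abs_nonneg _)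
    (hF.measurable_chaosInt hl hf).abs.aestronglyMeasurable]
  refine ENNReal.toReal_le_of_le_ofReal (by positivity) ?_
  calc ∫⁻ w, ENNReal.ofReal |chaosInt κ om f l w| ∂P
      ≤ ∫⁻ w, ∫⁻ x, ‖f x‖ₑ * ENNReal.ofReal (Real.exp (om l x w)) ∂κ ∂P := by
        refine lintegral_mono fun w => ?_
        rw [← Real.enorm_eq_ofReal_abs]
        exact enorm_chaosInt_le κ om l f w
    _ = ∫⁻ x, ‖f x‖ₑ ∂κ := hF.lintegral_prod_eq hl hf.enorm
    _ ≤ ∫⁻ x, K.indicator (fun _ => ENNReal.ofReal c) x ∂κ := by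
        refine lintegral_mono fun x => ?_
        by_cases hx : x ∈ K
        · rw [indicator_of_mem hx, Real.enorm_eq_ofReal_abs]
          exact ENNReal.ofReal_le_ofReal (hfc x)
        · rw [indicator_of_notMem hx, hfK x hx]
          simp
    _ = ENNReal.ofReal (c * κ.real K) := by
        rw [lintegral_indicator_const hK, ENNReal.ofReal_mul hc, ofReal_measureReal]

/-- The integrals of a bounded function are Cauchy in `L¹` as the scale decreases to zero. -/
lemma exists_integral_abs_chaosInt_sub_le (hT : 0 < T) (hf : Measurable f) (hfc : ∀ x, |f x| ≤ c)
    {ε : ℝ} (hε : 0 < ε) : ∃ l₀ ∈ Ioo 0 T, ∀ r ∈ Ioc 0 l₀, ∀ s ∈ Ioc 0 l₀,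
      ∫ w, |chaosInt κ om f r w - chaosInt κ om f s w| ∂P ≤ ε := by
  have hc : 0 ≤ c := by
    obtain ⟨x⟩ : Nonempty E := nonempty_of_isProbabilityMeasure κ
    exact (abs_nonneg _).trans (hfc x)
  have : Nonempty (Ioo (0 : ℝ) T)ᵒᵈ := ⟨OrderDual.toDual ⟨T / 2, by constructor <;> linarith⟩⟩
  -- With this choice the part of `f` off `K` has `L¹` norm at most `ε/8` at every scale, and the
  -- part on `K` is an `L²`-bounded martingale. The `+ 1` allows `c = 0`.
  obtain ⟨K, hK, hKε, M, hM⟩ := hF.trunc (ε / (8 * (c + 1))) (by positivity)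
  have hKr : κ.real Kᶜ ≤ ε / (8 * (c + 1)) := ENNReal.toReal_le_of_le_ofReal (by positivity) hKε
  set f₁ : E → ℝ := K.indicator f with hf₁
  set f₂ : E → ℝ := Kᶜ.indicator f with hf₂
  have hf₁m : Measurable f₁ := hf.indicator hK
  have hf₂m : Measurable f₂ := hf.indicator hK.compl
  have hf₁c : ∀ x, |f₁ x| ≤ c := fun x => (norm_indicator_le_norm_self f x).trans (hfc x)
  have hf₂c : ∀ x, |f₂ x| ≤ c := fun x => (norm_indicator_le_norm_self f x).trans (hfc x)
  have hsq : ∀ l ∈ Ioo 0 T,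
      ∫⁻ w, ‖chaosInt κ om f₁ l w‖ₑ ^ 2 ∂P ≤ ENNReal.ofReal c ^ 2 * M := fun l hl =>
    hF.lintegral_sq_chaosInt_le hf₁c hK (fun x hx => indicator_of_notMem hx f) hl (hM l hl)
  have hmem : ∀ i : (Ioo (0 : ℝ) T)ᵒᵈ, MemLp (chaosInt κ om f₁ (OrderDual.ofDual i).1) 2 P := by
    intro i
    refine ⟨(hF.measurable_chaosInt (OrderDual.ofDual i).2 hf₁m).aestronglyMeasurable, ?_⟩
    rw [eLpNorm_lt_top_iff_lintegral_rpow_enorm_lt_top two_ne_zero ENNReal.ofNat_ne_top]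
    simp only [ENNReal.toReal_ofNat, ENNReal.rpow_ofNat]
    exact (hsq _ (OrderDual.ofDual i).2).trans_lt (by finiteness)
  have hbd : ∀ i : (Ioo (0 : ℝ) T)ᵒᵈ, ∫ w, chaosInt κ om f₁ (OrderDual.ofDual i).1 w ^ 2 ∂P ≤
      c ^ 2 * M := by
    intro i
    rw [integral_eq_lintegral_of_nonneg_ae (ae_of_all _ fun w => sq_nonneg _)
      (hmem i).integrable_sq.aestronglyMeasurable]
    refine ENNReal.toReal_le_of_le_ofReal (by positivity) ?_
    rw [ENNReal.ofReal_mul (by positivity), ENNReal.ofReal_pow hc, ENNReal.ofReal_coe_nnreal]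
    refine le_trans (le_of_eq (lintegral_congr fun w => ?_)) (hsq _ (OrderDual.ofDual i).2)
    rw [← sq_abs, ENNReal.ofReal_pow (abs_nonneg _), Real.enorm_eq_ofReal_abs]
  obtain ⟨i₀, hi₀⟩ := exists_integral_abs_sub_le (hF.martingale_chaosInt hf₁m hf₁c) hmem hbd
    (ε := ε / 4) (by positivity)
  set l₀ := OrderDual.ofDual i₀ with hl₀
  have hin : ∀ r ∈ Ioc 0 l₀.1, r ∈ Ioo 0 T := fun r hr => ⟨hr.1, hr.2.trans_lt l₀.2.2⟩
  have hone : ∀ r ∈ Ioc 0 l₀.1,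
      ∫ w, |chaosInt κ om f r w - chaosInt κ om f l₀.1 w| ∂P ≤ ε / 2 := by
    intro r hr
    have hrT := hin r hr
    have h1 := hi₀ (OrderDual.toDual ⟨r, hrT⟩) hr.2
    have h2 : ∀ l ∈ Ioo 0 T, ∫ w, |chaosInt κ om f₂ l w| ∂P ≤ ε / 8 := by
      intro l hl
      refine (hF.integral_abs_chaosInt_le hl hf₂m hf₂c hK.compl
        fun x hx => indicator_of_notMem hx f).trans ?_
      calc c * κ.real Kᶜ ≤ (c + 1) * (ε / (8 * (c + 1))) := by gcongr; linarith
        _ = ε / 8 := by field_simp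
    have hsplit : ∀ l ∈ Ioo 0 T, ∀ᵐ w ∂P, chaosInt κ om f l w =
        chaosInt κ om f₁ l w + chaosInt κ om f₂ l w := by
      intro l hl
      filter_upwards [(hF.integrable_prod hl hf₁m hf₁c).prod_left_ae,
        (hF.integrable_prod hl hf₂m hf₂c).prod_left_ae] with w hw1 hw2
      unfold chaosInt
      rw [← integral_add hw1 hw2]
      refine integral_congr_ae (ae_of_all _ fun x => ?_)
      simp only
      rw [← add_mul, hf₁, hf₂, ← Pi.add_apply (K.indicator f), indicator_self_add_compl]
    have hA := hF.integrable_chaosInt hrT hf₁m hf₁c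
    have hA' := hF.integrable_chaosInt l₀.2 hf₁m hf₁c
    have hB := hF.integrable_chaosInt hrT hf₂m hf₂c
    have hB' := hF.integrable_chaosInt l₀.2 hf₂m hf₂c
    have hA2 : Integrable (fun w => |chaosInt κ om f₁ r w - chaosInt κ om f₁ l₀.1 w|) P :=
      (hA.sub hA').abs
    have hB2 : Integrable (fun w => |chaosInt κ om f₂ r w| + |chaosInt κ om f₂ l₀.1 w|) P :=
      hB.abs.add hB'.abs
    calc ∫ w, |chaosInt κ om f r w - chaosInt κ om f l₀.1 w| ∂P
        ≤ ∫ w, (|chaosInt κ om f₁ r w - chaosInt κ om f₁ l₀.1 w| +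
          (|chaosInt κ om f₂ r w| + |chaosInt κ om f₂ l₀.1 w|)) ∂P := by
          refine integral_mono_ae ((hF.integrable_chaosInt hrT hf hfc).sub
            (hF.integrable_chaosInt l₀.2 hf hfc)).abs (hA2.add hB2) ?_
          filter_upwards [hsplit r hrT, hsplit l₀.1 l₀.2] with w h3 h4
          rw [h3, h4, add_sub_add_comm]
          exact (abs_add_le _ _).trans (add_le_add_right (abs_sub _ _) _)
      _ = ∫ w, |chaosInt κ om f₁ r w - chaosInt κ om f₁ l₀.1 w| ∂P +
          (∫ w, |chaosInt κ om f₂ r w| ∂P + ∫ w, |chaosInt κ om f₂ l₀.1 w| ∂P) := by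
          rw [integral_add hA2 hB2, integral_add hB.abs hB'.abs]
      _ ≤ ε / 4 + (ε / 8 + ε / 8) := by
          gcongr
          exacts [h1, h2 r hrT, h2 _ l₀.2]
      _ = ε / 2 := by ring
  refine ⟨l₀.1, l₀.2, fun r hr s hs => ?_⟩
  have hr' := hF.integrable_chaosInt (hin r hr) hf hfc
  have hs' := hF.integrable_chaosInt (hin s hs) hf hfc
  have h0 := hF.integrable_chaosInt l₀.2 hf hfc
  calc ∫ w, |chaosInt κ om f r w - chaosInt κ om f s w| ∂P
      ≤ ∫ w, (|chaosInt κ om f r w - chaosInt κ om f l₀.1 w| +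
        |chaosInt κ om f s w - chaosInt κ om f l₀.1 w|) ∂P := by
        refine integral_mono (hr'.sub hs').abs ((hr'.sub h0).abs.add (hs'.sub h0).abs) fun w => ?_
        have := abs_sub_le (chaosInt κ om f r w) (chaosInt κ om f l₀.1 w) (chaosInt κ om f s w)
        rwa [abs_sub_comm (chaosInt κ om f l₀.1 w)] at this
    _ ≤ ε / 2 + ε / 2 := by
        rw [integral_add]
        · exact add_le_add (hone r hr) (hone s hs)
        · exact (hr'.sub h0).abs
        · exact (hs'.sub h0).abs
    _ = ε := by ring

end IsMartingaleField

/-! ### Dense sequences and left-continuity -/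

/-- Density is stated from the left, to match left-continuity in the scale; the endpoint `b` is
included. -/
lemma exists_dense_seq {a b : ℝ} (h : a < b) : ∃ d : ℕ → ℝ, (∀ n, d n ∈ Ioo a b) ∧
    ∀ l ∈ Ioc a b, ∀ c < l, ∃ n, d n ∈ Ioo c l := by
  have : Nonempty (Ioo a b) := (nonempty_Ioo.2 h).to_subtype
  refine ⟨fun n => (TopologicalSpace.denseSeq (Ioo a b) n).1, fun n => Subtype.coe_prop _,
    fun l hl c hc => ?_⟩
  refine (TopologicalSpace.denseRange_denseSeq (Ioo a b)).exists_mem_open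
    (isOpen_Ioo.preimage continuous_subtype_val : IsOpen (Subtype.val ⁻¹' Ioo c l)) ?_
  obtain ⟨r, hr⟩ := exists_between (max_lt hc hl.1)
  exact ⟨⟨r, (le_max_right _ _).trans_lt hr.1, hr.2.trans_le hl.2⟩,
    (le_max_left _ _).trans_lt hr.1, hr.2⟩

lemma le_of_continuousWithinAt_Iic {β : Type*} [TopologicalSpace β] [Preorder β]
    [ClosedIicTopology β] {d : ℕ → ℝ} {l : ℝ} (hd : ∀ c < l, ∃ n, d n ∈ Ioo c l) {g : ℝ → β}
    (hg : ContinuousWithinAt g (Iic l) l) {C : β} (hC : ∀ n, g (d n) ≤ C) : g l ≤ C := by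
  have hg' : Tendsto g (𝓝[<] l) (𝓝 (g l)) := hg.mono_left (nhdsWithin_mono l Iio_subset_Iic_self)
  refine isClosed_Iic.mem_of_frequently_of_tendsto (f := g) (b := 𝓝[<] l) (s := Iic C) ?_ hg'
  refine Filter.frequently_iff.2 fun {U} hU => ?_
  obtain ⟨c, hc, hcU⟩ := (mem_nhdsLT_iff_exists_Ioo_subset (a := l)).1 hU
  obtain ⟨n, hn⟩ := hd c hc
  exact ⟨d n, hcU hn, hC n⟩

/-! ### Integrals and tails -/

lemma min_natCast_le_sum (s : ℝ≥0∞) (n : ℕ) :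
    min s n ≤ ∑ k ∈ Finset.range n, if (k : ℝ≥0∞) < s then 1 else 0 := by
  induction n with
  | zero => simp
  | succ n ih =>
    rw [Finset.sum_range_succ]
    by_cases h : (n : ℝ≥0∞) < s
    · rw [if_pos h]
      rw [min_eq_right h.le] at ih
      calc min s ((n + 1 : ℕ) : ℝ≥0∞) ≤ n + 1 := by
            push_cast
            exact min_le_right _ _
        _ ≤ _ := by gcongr
    · rw [if_neg h, add_zero]
      refine le_trans ?_ ih
      rw [min_eq_left (not_lt.1 h)]
      exact min_le_left _ _

lemma le_tsum_ite (s : ℝ≥0∞) : s ≤ ∑' k : ℕ, if (k : ℝ≥0∞) < s then 1 else 0 := by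
  refine le_of_forall_lt fun b hb => ?_
  obtain ⟨n, hn⟩ := ENNReal.exists_nat_gt hb.ne_top
  calc b < min s n := lt_min hb hn
    _ ≤ _ := min_natCast_le_sum s n
    _ ≤ _ := ENNReal.sum_le_tsum _

lemma summable_div_sq (M : ℝ≥0) : Summable fun k : ℕ => M / ((k + 1 : ℕ) : ℝ≥0) ^ 2 := by
  have h1 : Summable fun k : ℕ => (((k + 1 : ℕ) : ℝ) ^ 2)⁻¹ :=
    (summable_nat_add_iff 1).2 (Real.summable_nat_pow_inv.2 one_lt_two)
  rw [← NNReal.summable_coe]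
  refine (h1.mul_left (M : ℝ)).congr fun k => ?_
  push_cast
  rw [div_eq_mul_inv]

lemma lintegral_le_of_tail {Ω : Type*} [MeasurableSpace Ω] {P : Measure Ω} [IsProbabilityMeasure P]
    {S : Ω → ℝ≥0∞} (hS : Measurable S) {M : ℝ≥0}
    (h : ∀ k : ℕ, 0 < k → P {w | (k : ℝ≥0∞) < S w} ≤ M / k ^ 2) :
    ∫⁻ w, S w ∂P ≤ ((1 + ∑' k : ℕ, M / ((k + 1 : ℕ) : ℝ≥0) ^ 2 : ℝ≥0) : ℝ≥0∞) := by
  have hms : ∀ k : ℕ, MeasurableSet {w | (k : ℝ≥0∞) < S w} := fun k =>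
    measurableSet_lt measurable_const hS
  calc ∫⁻ w, S w ∂P ≤ ∫⁻ w, ∑' k : ℕ, (if (k : ℝ≥0∞) < S w then 1 else 0) ∂P :=
        lintegral_mono fun w => le_tsum_ite _
    _ = ∑' k : ℕ, P {w | (k : ℝ≥0∞) < S w} := by
        rw [lintegral_tsum fun k =>
          (Measurable.ite (hms k) measurable_const measurable_const).aemeasurable]
        refine tsum_congr fun k => ?_
        rw [← lintegral_indicator_one (hms k)]
        simp only [indicator_apply, mem_ofPred_eq, Pi.one_apply]
    _ ≤ 1 + ∑' k : ℕ, ((M / ((k + 1 : ℕ) : ℝ≥0) ^ 2 : ℝ≥0) : ℝ≥0∞) := by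
        rw [tsum_eq_zero_add' ENNReal.summable]
        refine add_le_add prob_le_one (ENNReal.tsum_le_tsum fun k => ?_)
        refine (h (k + 1) k.succ_pos).trans (le_of_eq ?_)
        rw [ENNReal.coe_div (by positivity)]
        push_cast
        rfl
    _ = _ := by
        rw [ENNReal.coe_add, ENNReal.coe_tsum (summable_div_sq M), ENNReal.coe_one]

/-! ### Maximal inequality for the increments of a martingale -/

/-- From `i₀` onwards `X - X i₀` is a martingale, so its absolute value is a nonnegative
submartingale to which the weak `L¹` inequality applies. -/
lemma measure_exists_abs_sub_ge_le {Ω ι : Type*} [mΩ : MeasurableSpace Ω] {P : Measure Ω}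
    [IsFiniteMeasure P] [LinearOrder ι] {𝒢 : Filtration ι mΩ} {X : ι → Ω → ℝ}
    (hX : Martingale X 𝒢 P) (i₀ : ι) {d : ℕ → ι} (hd : ∀ n, i₀ ≤ d n) {ε : ℝ≥0} (hε : 0 < ε)
    {δ : ℝ} (hδ : ∀ n, ∫ w, |X (d n) w - X i₀ w| ∂P ≤ δ) :
    P {w | ∃ n, (ε : ℝ) ≤ |X (d n) w - X i₀ w|} ≤ ENNReal.ofReal δ / ε := by
  let 𝒢' : Filtration (Ici i₀) mΩ := ⟨fun i => 𝒢 i, fun _ _ h => 𝒢.mono h, fun i => 𝒢.le i⟩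
  have hm : Martingale (fun i : Ici i₀ => X i - X i₀) 𝒢' P := by
    refine ⟨fun i => (hX.1 i).sub ((hX.1 i₀).mono (𝒢.mono i.2)), fun i j hij => ?_⟩
    refine (condExp_sub (hX.integrable _) (hX.integrable _) _).trans ?_
    have h1 : P[X i₀ | 𝒢' i] = X i₀ := condExp_of_stronglyMeasurable (𝒢'.le i)
      ((hX.1 i₀).mono (𝒢.mono i.2)) (hX.integrable _)
    rw [h1]
    filter_upwards [hX.2 i.1 j.1 hij] with w hw
    simp only [Pi.sub_apply]
    rw [← hw]
  have hs : Submartingale (fun (i : Ici i₀) w => |X i w - X i₀ w|) 𝒢' P :=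
    hm.submartingale.sup hm.neg.submartingale
  refine measure_exists_ge_le (d := fun n => ⟨d n, hd n⟩) hs (fun i w => abs_nonneg _) hε
    fun n => ?_
  rw [← ofReal_integral_eq_lintegral_ofReal (hs.integrable ⟨d n, hd n⟩)
    (ae_of_all _ fun w => abs_nonneg _)]
  exact ENNReal.ofReal_le_ofReal (hδ n)

namespace IsMartingaleField

variable {Ω E : Type*} [mΩ : MeasurableSpace Ω] [MeasurableSpace E] {P : Measure Ω}
  {κ : Measure E} {T : ℝ} {om : ℝ → E → Ω → ℝ} {ℱ : Filtration (Ioo (0 : ℝ) T)ᵒᵈ mΩ} {f : E → ℝ}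
  {c : ℝ} [IsProbabilityMeasure P] [IsProbabilityMeasure κ] (hF : IsMartingaleField P κ T om ℱ)
include hF

/-! ### Domination -/

omit [IsProbabilityMeasure P] [IsProbabilityMeasure κ] in
lemma martingale_exp (x : E) : Martingale
    (fun (i : (Ioo (0 : ℝ) T)ᵒᵈ) w => Real.exp (om (OrderDual.ofDual i).1 x w)) ℱ P :=
  ⟨fun i => hF.complete i _ _ stronglyMeasurable_condExp
    ((hF.measurable_exp (OrderDual.ofDual i).2).comp measurable_prodMk_left)
    (hF.condExp_eq i i le_rfl x).symm, fun i j hij => hF.condExp_eq i j hij x⟩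

omit [IsProbabilityMeasure κ] in
-- The weak `L²` inequality gives tails `M / k²`, which are summable. The second moments are assumed
-- bounded only above a fixed scale `a > 0`, so the domination is local in the scale.
lemma exists_lintegral_iSup_le {a : ℝ} (ha : a ∈ Ioo 0 T) {d : ℕ → ℝ} (hd : ∀ n, d n ∈ Ioo a T) :
    ∃ C : ℝ≥0, ∀ x, ∫⁻ w, ⨆ n, ENNReal.ofReal (Real.exp (om (d n) x w)) ∂P ≤ C := by
  obtain ⟨M, hM⟩ := hF.sq_le a ha
  have hd' : ∀ n, d n ∈ Ioo 0 T := fun n => ⟨ha.1.trans (hd n).1, (hd n).2⟩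
  refine ⟨_, fun x => lintegral_le_of_tail (M := M) (Measurable.iSup fun n => ENNReal.measurable_ofReal.comp
    ((hF.measurable_exp (hd' n)).comp measurable_prodMk_left)) fun k hk => ?_⟩
  refine (measure_mono fun w hw => ?_).trans (measure_exists_ge_le_sq
    (d := fun n => OrderDual.toDual ⟨d n, hd' n⟩) (hF.martingale_exp x).submartingale
    (fun i w => (Real.exp_pos _).le) (ε := (k : ℝ≥0)) (by exact_mod_cast hk) (M := M)
    fun n => hM _ ⟨(hd n).1.le, (hd n).2⟩ x)
  obtain ⟨n, hn⟩ := lt_iSup_iff.1 (show (k : ℝ≥0∞) < _ from hw)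
  refine ⟨n, ?_⟩
  have h1 : ENNReal.ofReal k < ENNReal.ofReal (Real.exp (om (d n) x w)) := by
    rwa [ENNReal.ofReal_natCast]
  exact ((ENNReal.ofReal_lt_ofReal_iff (Real.exp_pos _)).1 h1).le

/-- The supremum over a dense sequence of scales is integrable for `κ ⊗ P`, and left-continuity
extends the bound to all scales. This majorant lets left-continuity pass under the integral against
`κ`. -/
lemma ae_exists_dominated {a : ℝ} (ha : a ∈ Ioo 0 T) : ∀ᵐ w ∂P, ∃ S : E → ℝ, Integrable S κ ∧
    ∀ᵐ x ∂κ, ∀ l ∈ Ioo a T, Real.exp (om l x w) ≤ S x := by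
  obtain ⟨d, hd, hdd⟩ := exists_dense_seq ha.2
  obtain ⟨C, hC⟩ := hF.exists_lintegral_iSup_le ha hd
  have hd' : ∀ n, d n ∈ Ioo 0 T := fun n => ⟨ha.1.trans (hd n).1, (hd n).2⟩
  have hm : Measurable fun p : E × Ω => ⨆ n, ENNReal.ofReal (Real.exp (om (d n) p.1 p.2)) :=
    Measurable.iSup fun n => ENNReal.measurable_ofReal.comp (hF.measurable_exp (hd' n))
  have hm' : Measurable fun p : Ω × E => ⨆ n, ENNReal.ofReal (Real.exp (om (d n) p.2 p.1)) :=
    hm.comp measurable_swap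
  have hfin : ∫⁻ w, ∫⁻ x, ⨆ n, ENNReal.ofReal (Real.exp (om (d n) x w)) ∂κ ∂P ≠ ∞ := by
    rw [lintegral_lintegral_swap hm'.aemeasurable]
    refine ne_top_of_le_ne_top (b := (C : ℝ≥0∞)) ENNReal.coe_ne_top ?_
    calc _ ≤ ∫⁻ _, (C : ℝ≥0∞) ∂κ := lintegral_mono hC
      _ = C := by simp
  filter_upwards [ae_lt_top hm'.lintegral_prod_right' hfin, hF.regular] with w hw hreg
  have hmw : Measurable fun x => ⨆ n, ENNReal.ofReal (Real.exp (om (d n) x w)) :=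
    hm.comp measurable_prodMk_right
  refine ⟨fun x => (⨆ n, ENNReal.ofReal (Real.exp (om (d n) x w))).toReal,
    integrable_toReal_of_lintegral_ne_top hmw.aemeasurable hw.ne, ?_⟩
  filter_upwards [ae_lt_top hmw hw.ne] with x hx l hl
  refine le_of_continuousWithinAt_Iic (g := fun r => Real.exp (om r x w))
    (hdd l ⟨hl.1, hl.2.le⟩) ?_ fun n => ?_
  · exact Real.continuous_exp.continuousAt.comp_continuousWithinAt
      (hreg x l ⟨ha.1.trans hl.1, hl.2⟩)
  · rw [← ENNReal.ofReal_le_iff_le_toReal hx.ne]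
    exact le_iSup (fun n => ENNReal.ofReal (Real.exp (om (d n) x w))) n

lemma ae_forall_exists_dominated : ∀ᵐ w ∂P, ∀ a ∈ Ioo 0 T, ∃ S : E → ℝ, Integrable S κ ∧
    ∀ᵐ x ∂κ, ∀ l ∈ Ioo a T, Real.exp (om l x w) ≤ S x := by
  by_cases hT : 0 < T
  · have h : ∀ n : ℕ, T / (n + 2) ∈ Ioo 0 T := fun n =>
      ⟨by positivity, div_lt_self hT (by linarith [n.cast_nonneg (α := ℝ)])⟩
    filter_upwards [ae_all_iff.2 fun n => hF.ae_exists_dominated (h n)] with w hw a ha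
    obtain ⟨n, hn⟩ := exists_nat_gt (T / a)
    obtain ⟨S, hS, hSx⟩ := hw n
    refine ⟨S, hS, ?_⟩
    filter_upwards [hSx] with x hx l hl
    refine hx l ⟨lt_trans ?_ hl.1, hl.2⟩
    rw [div_lt_iff₀ (by positivity)]
    rw [div_lt_iff₀ ha.1] at hn
    nlinarith [ha.1]
  · exact ae_of_all _ fun w a ha => absurd (ha.1.trans ha.2) hT

/-- Almost surely, at all scales, the chaos is finite and its integrals are left-continuous. -/
lemma ae_integrable_and_continuousWithinAt : ∀ᵐ w ∂P, ∀ l ∈ Ioo 0 T,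
    Integrable (fun x => Real.exp (om l x w)) κ ∧
    ∀ (f : E → ℝ) (c : ℝ), Measurable f → (∀ x, |f x| ≤ c) →
      ContinuousWithinAt (fun r => chaosInt κ om f r w) (Iic l) l := by
  filter_upwards [hF.ae_forall_exists_dominated, hF.regular] with w hw hreg l hl
  obtain ⟨S, hS, hSx⟩ := hw (l / 2) ⟨half_pos hl.1, (half_lt_self hl.1).trans hl.2⟩
  have hmeas : ∀ r ∈ Ioo 0 T, Measurable fun x => Real.exp (om r x w) := fun r hr =>
    (hF.measurable_exp hr).comp measurable_prodMk_right
  have hlm : l ∈ Ioo (l / 2) T := ⟨half_lt_self hl.1, hl.2⟩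
  have hev : ∀ᶠ r in 𝓝[≤] l, r ∈ Ioo (l / 2) T :=
    mem_nhdsWithin_of_mem_nhds (Ioo_mem_nhds hlm.1 hlm.2)
  refine ⟨hS.mono' (hmeas l hl).aestronglyMeasurable ?_, fun f c hf hfc => ?_⟩
  · filter_upwards [hSx] with x hx
    rw [Real.norm_of_nonneg (Real.exp_pos _).le]
    exact hx l hlm
  · refine continuousWithinAt_of_dominated (bound := fun x => c * S x) ?_ ?_ (hS.const_mul c) ?_
    · filter_upwards [hev] with r hr
      exact (hf.mul (hmeas r ⟨(half_pos hl.1).trans hr.1, hr.2⟩)).aestronglyMeasurable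
    · filter_upwards [hev] with r hr
      filter_upwards [hSx] with x hx
      rw [norm_mul, Real.norm_of_nonneg (Real.exp_pos _).le]
      exact mul_le_mul (hfc x) (hx r hr) (Real.exp_pos _).le ((abs_nonneg _).trans (hfc x))
    · exact ae_of_all _ fun x => continuousWithinAt_const.mul
        (Real.continuous_exp.continuousAt.comp_continuousWithinAt (hreg x l hl))

/-! ### Almost sure convergence -/

lemma ae_exists_forall_abs_sub_le (hT : 0 < T) (hf : Measurable f) (hfc : ∀ x, |f x| ≤ c) {η : ℝ}
    (hη : 0 < η) : ∀ᵐ w ∂P, ∃ l₀ ∈ Ioo 0 T, ∀ r ∈ Ioo 0 l₀,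
      |chaosInt κ om f r w - chaosInt κ om f l₀ w| ≤ η := by
  set B := {w | ¬ ∃ l₀ ∈ Ioo 0 T, ∀ r ∈ Ioo 0 l₀,
    |chaosInt κ om f r w - chaosInt κ om f l₀ w| ≤ η} with hB
  change P B = 0
  -- Below a scale where the martingale is within `δ` of its value in `L¹`, the maximal inequality
  -- makes an oscillation of size `η` at the dense scales unlikely; left-continuity covers the other
  -- scales. As `δ` is free, `B` is null.
  have hbound : ∀ δ : ℝ, 0 < δ → P B ≤ ENNReal.ofReal (δ / η) := by
    intro δ hδ
    obtain ⟨l₀, hl₀, hint⟩ := hF.exists_integral_abs_chaosInt_sub_le hT hf hfc hδ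
    obtain ⟨d, hd, hdd⟩ := exists_dense_seq hl₀.1
    have hd' : ∀ n, d n ∈ Ioo 0 T := fun n => ⟨(hd n).1, (hd n).2.trans hl₀.2⟩
    have h1 := measure_exists_abs_sub_ge_le (hF.martingale_chaosInt hf hfc)
      (OrderDual.toDual ⟨l₀, hl₀⟩) (d := fun n => OrderDual.toDual ⟨d n, hd' n⟩)
      (fun n => (hd n).2.le) (ε := η.toNNReal) (by simpa using hη) (δ := δ)
      fun n => hint (d n) ⟨(hd n).1, (hd n).2.le⟩ l₀ ⟨hl₀.1, le_rfl⟩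
    rw [ENNReal.ofReal_div_of_pos hη]
    refine le_trans (measure_mono_ae ?_) h1
    filter_upwards [hF.ae_integrable_and_continuousWithinAt] with w hw hwB
    by_contra hcon
    have hcon' : ∀ n, |chaosInt κ om f (d n) w - chaosInt κ om f l₀ w| ≤ η := fun n => by
      by_contra h
      refine hcon ⟨n, ?_⟩
      rw [Real.coe_toNNReal _ hη.le]
      exact (not_le.1 h).le
    refine hwB ⟨l₀, hl₀, fun r hr => ?_⟩
    exact le_of_continuousWithinAt_Iic
      (g := fun r => |chaosInt κ om f r w - chaosInt κ om f l₀ w|) (hdd r ⟨hr.1, hr.2.le⟩)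
      (((hw r ⟨hr.1, hr.2.trans hl₀.2⟩).2 f c hf hfc).sub continuousWithinAt_const).abs hcon'
  refine le_antisymm (ENNReal.le_of_forall_pos_le_add fun δ hδ _ => ?_) zero_le
  refine (hbound (δ * η) (by positivity)).trans (le_of_eq ?_)
  rw [mul_div_cancel_right₀ _ hη.ne', zero_add, ENNReal.ofReal_coe_nnreal]

lemma ae_exists_tendsto_chaosInt (hT : 0 < T) (hf : Measurable f) (hfc : ∀ x, |f x| ≤ c) :
    ∀ᵐ w ∂P, ∃ y, Tendsto (fun l => chaosInt κ om f l w) (𝓝[>] 0) (𝓝 y) := by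
  filter_upwards [ae_all_iff.2 fun n : ℕ => hF.ae_exists_forall_abs_sub_le hT hf hfc
    (Nat.one_div_pos_of_nat (α := ℝ) (n := n))] with w hw
  refine cauchy_map_iff_exists_tendsto.1 (Metric.cauchy_iff.2 ⟨inferInstance, fun ε hε => ?_⟩)
  obtain ⟨n, hn⟩ := exists_nat_one_div_lt (half_pos hε)
  obtain ⟨l₀, hl₀, h⟩ := hw n
  refine ⟨_, image_mem_map (Ioo_mem_nhdsGT hl₀.1), ?_⟩
  rintro _ ⟨r, hr, rfl⟩ _ ⟨s, hs, rfl⟩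
  have h1 := h r hr
  have h2 := h s hs
  have h3 := abs_sub_le (chaosInt κ om f r w) (chaosInt κ om f l₀ w) (chaosInt κ om f s w)
  rw [abs_sub_comm (chaosInt κ om f l₀ w)] at h3
  rw [Real.dist_eq]
  linarith

/-- The integrals of a bounded function converge almost surely, and the limit closes the
martingale. -/
lemma exists_limit_chaosInt (hT : 0 < T) (hf : Measurable f) (hfc : ∀ x, |f x| ≤ c) :
    ∃ X : Ω → ℝ, Integrable X P ∧
      (∀ᵐ w ∂P, Tendsto (fun l => chaosInt κ om f l w) (𝓝[>] 0) (𝓝 (X w))) ∧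
      (∫ w, X w ∂P = ∫ x, f x ∂κ) ∧
      ∀ i, P[X | ℱ i] =ᵐ[P] chaosInt κ om f (OrderDual.ofDual i).1 := by
  set s : ℕ → ℝ := fun n => T / (n + 2) with hs
  have hsT : ∀ n, s n ∈ Ioo 0 T := fun n =>
    ⟨by positivity, div_lt_self hT (by linarith [n.cast_nonneg (α := ℝ)])⟩
  have hs0 : Tendsto s atTop (𝓝[>] 0) := by
    refine tendsto_nhdsWithin_iff.2 ⟨?_, Eventually.of_forall fun n => (hsT n).1⟩
    exact tendsto_const_nhds.div_atTop
      (tendsto_atTop_add_const_right _ _ tendsto_natCast_atTop_atTop)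
  have hconv := hF.ae_exists_tendsto_chaosInt hT hf hfc
  obtain ⟨X, hXm, hX⟩ := measurable_limit_of_tendsto_metrizable_ae (L := atTop)
    (fun n => (hF.measurable_chaosInt (hsT n) hf).aemeasurable)
    (hconv.mono fun w ⟨y, hy⟩ => ⟨y, hy.comp hs0⟩)
  have hX' : ∀ᵐ w ∂P, Tendsto (fun l => chaosInt κ om f l w) (𝓝[>] 0) (𝓝 (X w)) := by
    filter_upwards [hconv, hX] with w ⟨y, hy⟩ hw
    rwa [tendsto_nhds_unique hw (hy.comp hs0)]
  -- Fatou's lemma along `s n` transfers the `L¹` Cauchy estimate to the limit `X`.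
  have hL : ∀ ε : ℝ, 0 < ε → ∃ l₀ ∈ Ioo 0 T, ∀ r ∈ Ioc 0 l₀,
      ∫⁻ w, ‖X w - chaosInt κ om f r w‖ₑ ∂P ≤ ENNReal.ofReal ε := by
    intro ε hε
    obtain ⟨l₀, hl₀, h⟩ := hF.exists_integral_abs_chaosInt_sub_le hT hf hfc hε
    refine ⟨l₀, hl₀, fun r hr => ?_⟩
    have hrT : r ∈ Ioo 0 T := ⟨hr.1, hr.2.trans_lt hl₀.2⟩
    have hev : ∀ᶠ n in atTop, s n ∈ Ioc 0 l₀ := hs0 (Ioc_mem_nhdsGT hl₀.1)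
    calc ∫⁻ w, ‖X w - chaosInt κ om f r w‖ₑ ∂P
        = ∫⁻ w, liminf (fun n => ‖chaosInt κ om f (s n) w - chaosInt κ om f r w‖ₑ) atTop ∂P := by
          refine lintegral_congr_ae ?_
          filter_upwards [hX] with w hw
          exact ((hw.sub_const _).enorm.liminf_eq).symm
      _ ≤ liminf (fun n => ∫⁻ w, ‖chaosInt κ om f (s n) w - chaosInt κ om f r w‖ₑ ∂P) atTop :=
          lintegral_liminf_le fun n => ((hF.measurable_chaosInt (hsT n) hf).sub
            (hF.measurable_chaosInt hrT hf)).enorm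
      _ ≤ ENNReal.ofReal ε := by
          refine liminf_le_of_frequently_le' (hev.mono fun n hn => ?_).frequently
          have hi := (hF.integrable_chaosInt (hsT n) hf hfc).sub
            (hF.integrable_chaosInt hrT hf hfc)
          have := ofReal_integral_norm_eq_lintegral_enorm hi
          simp only [Pi.sub_apply] at this
          rw [← this]
          exact ENNReal.ofReal_le_ofReal (h _ hn r hr)
  have hdiff : ∀ ε : ℝ, 0 < ε → ∃ l₀ ∈ Ioo 0 T, ∀ r ∈ Ioc 0 l₀,
      Integrable (fun w => X w - chaosInt κ om f r w) P ∧
      ∫ w, |X w - chaosInt κ om f r w| ∂P ≤ ε := by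
    intro ε hε
    obtain ⟨l₀, hl₀, h⟩ := hL ε hε
    refine ⟨l₀, hl₀, fun r hr => ?_⟩
    have hi : Integrable (fun w => X w - chaosInt κ om f r w) P :=
      ⟨(hXm.sub (hF.measurable_chaosInt ⟨hr.1, hr.2.trans_lt hl₀.2⟩ hf)).aestronglyMeasurable,
        (h r hr).trans_lt ENNReal.ofReal_lt_top⟩
    refine ⟨hi, ?_⟩
    have := h r hr
    rw [← ofReal_integral_norm_eq_lintegral_enorm hi] at this
    exact (ENNReal.ofReal_le_ofReal_iff hε.le).1 this
  have hXi : Integrable X P := by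
    obtain ⟨l₀, hl₀, h⟩ := hdiff 1 one_pos
    have := (h l₀ ⟨hl₀.1, le_rfl⟩).1.add (hF.integrable_chaosInt hl₀ hf hfc)
    refine this.congr (ae_of_all _ fun w => ?_)
    simp
  have hcond : ∀ i, P[X | ℱ i] =ᵐ[P] chaosInt κ om f (OrderDual.ofDual i).1 := by
    intro i
    set Y := chaosInt κ om f (OrderDual.ofDual i).1 with hY
    have hYi : Integrable Y P := hF.integrable_chaosInt (OrderDual.ofDual i).2 hf hfc
    have h0 : ∫ w, |P[X | ℱ i] w - Y w| ∂P ≤ 0 := by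
      refine le_of_forall_pos_le_add fun ε hε => ?_
      rw [zero_add]
      obtain ⟨l₀, hl₀, h⟩ := hdiff ε hε
      -- The scale `r` must be fine enough for `X` to be close in `L¹`, and below the scale of `i`
      -- for the martingale property; conditioning on `ℱ i` then contracts the `L¹` norm.
      set r := min l₀ (OrderDual.ofDual i).1 with hr
      have hr0 : 0 < r := lt_min hl₀.1 (OrderDual.ofDual i).2.1
      have hrT : r ∈ Ioo 0 T := ⟨hr0, (min_le_left _ _).trans_lt hl₀.2⟩
      have hri := hF.condExp_chaosInt (i := i) (j := OrderDual.toDual ⟨r, hrT⟩)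
        (min_le_right _ _ : r ≤ _) hf hfc
      obtain ⟨hint, hle⟩ := h r ⟨hr0, min_le_left _ _⟩
      refine le_trans (le_of_eq (integral_congr_ae ?_)) ((integral_abs_condExp_le (m := ℱ i)
        (fun w => X w - chaosInt κ om f r w)).trans hle)
      filter_upwards [hri, condExp_sub hXi (hF.integrable_chaosInt hrT hf hfc) (ℱ i)] with w h1 h2
      have h3 : P[fun w => X w - chaosInt κ om f r w | ℱ i] w =
        (P[X | ℱ i] - P[chaosInt κ om f r | ℱ i]) w := h2
      rw [h3, Pi.sub_apply, show P[chaosInt κ om f r | ℱ i] w = Y w from h1]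
    have h1 := (integral_eq_zero_iff_of_nonneg_ae (ae_of_all _ fun w => abs_nonneg _)
      (integrable_condExp.sub hYi).abs).1 (le_antisymm h0 (integral_nonneg fun w => abs_nonneg _))
    filter_upwards [h1] with w hw
    exact sub_eq_zero.1 (abs_eq_zero.1 hw)
  refine ⟨X, hXi, hX', ?_, hcond⟩
  rw [← integral_condExp (ℱ.le (OrderDual.toDual ⟨s 0, hsT 0⟩)), integral_congr_ae (hcond _)]
  exact hF.integral_chaosInt (hsT 0) hf hfc

end IsMartingaleField

/-! ### Weak convergence of measures carried by a compact set -/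

section Weak

variable {E : Type*} [NormedAddCommGroup E] [InnerProductSpace ℝ E] [CompleteSpace E]
  [SecondCountableTopology E] [MeasurableSpace E] [BorelSpace E]

omit [CompleteSpace E] in
lemma integral_trig_inner (μ : Measure E) [IsFiniteMeasure μ] (t : E) :
    ∫ x, Real.cos (inner ℝ x t) ∂μ = (charFun μ t).re ∧
    ∫ x, Real.sin (inner ℝ x t) ∂μ = (charFun μ t).im := by
  have hi : Integrable (fun x => Complex.exp ((inner ℝ x t : ℝ) * Complex.I)) μ := by
    refine (integrable_const (1 : ℝ)).mono' (by fun_prop) (ae_of_all _ fun x => ?_)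
    rw [Complex.norm_exp_ofReal_mul_I]
  rw [charFun_apply]
  constructor
  · refine Eq.trans (integral_congr_ae (ae_of_all _ fun x => ?_)) (integral_re hi)
    exact (Complex.exp_ofReal_mul_I_re _).symm
  · refine Eq.trans (integral_congr_ae (ae_of_all _ fun x => ?_)) (integral_im hi)
    exact (Complex.exp_ofReal_mul_I_im _).symm

lemma ext_of_integral_trig {ι : Type*} {t : ι → E} (ht : DenseRange t) {μ ν : Measure E}
    [IsFiniteMeasure μ] [IsFiniteMeasure ν]
    (hcos : ∀ n, ∫ x, Real.cos (inner ℝ x (t n)) ∂μ = ∫ x, Real.cos (inner ℝ x (t n)) ∂ν)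
    (hsin : ∀ n, ∫ x, Real.sin (inner ℝ x (t n)) ∂μ = ∫ x, Real.sin (inner ℝ x (t n)) ∂ν) :
    μ = ν := by
  refine Measure.ext_of_charFun (ht.equalizer continuous_charFun continuous_charFun ?_)
  funext n
  refine Complex.ext ?_ ?_
  · rw [Function.comp_apply, Function.comp_apply, ← (integral_trig_inner μ _).1, hcos,
      (integral_trig_inner ν _).1]
  · rw [Function.comp_apply, Function.comp_apply, ← (integral_trig_inner μ _).2, hsin,
      (integral_trig_inner ν _).2]

omit [InnerProductSpace ℝ E] [CompleteSpace E] [SecondCountableTopology E] in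
lemma continuous_integral_finiteMeasure {g : E → ℝ} (hg : Continuous g) (hg1 : ∀ x, |g x| ≤ 1) :
    Continuous fun μ : FiniteMeasure E => ∫ x, g x ∂(μ : Measure E) :=
  FiniteMeasure.continuous_integral_boundedContinuousFunction
    (BoundedContinuousFunction.ofNormedAddCommGroup g hg 1 hg1)

/-- Measures carried by a fixed compact set, with bounded masses, converge weakly as soon as
their characteristic functions converge at the points of a dense set. -/
lemma exists_weak_limit {ι α : Type*} {F : Filter α} [NeBot F] {ν : α → Measure E}
    [hν : ∀ i, IsFiniteMeasure (ν i)] {K : Set E} (hK : IsCompact K) (hνK : ∀ i, ν i Kᶜ = 0)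
    {C : ℝ≥0} (hC : ∀ᶠ i in F, ν i univ ≤ C) {t : ι → E} (ht : DenseRange t)
    (hcos : ∀ n, ∃ c, Tendsto (fun i => ∫ x, Real.cos (inner ℝ x (t n)) ∂ν i) F (𝓝 c))
    (hsin : ∀ n, ∃ c, Tendsto (fun i => ∫ x, Real.sin (inner ℝ x (t n)) ∂ν i) F (𝓝 c)) :
    ∃ N : Measure E, IsFiniteMeasure N ∧ ∀ f : E →ᵇ ℝ≥0,
      Tendsto (fun i => ∫⁻ x, f x ∂ν i) F (𝓝 (∫⁻ x, f x ∂N)) := by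
  set ν' : α → FiniteMeasure E := fun i => ⟨ν i, hν i⟩ with hν'
  have hcomp := isCompact_setOfPred_finiteMeasure_le_of_isCompact C hK
  set 𝒦 : Set (FiniteMeasure E) := {μ | μ.mass ≤ C ∧ μ Kᶜ = 0} with h𝒦
  have hmem : 𝒦 ∈ map ν' F := by
    refine mem_map.2 (hC.mono fun i hi => ?_)
    constructor
    · rw [← ENNReal.coe_le_coe, FiniteMeasure.ennreal_mass]
      exact hi
    · rw [← ENNReal.coe_eq_zero, FiniteMeasure.ennreal_coeFn_eq_coeFn_toMeasure]
      exact hνK i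
  obtain ⟨y, -, hy⟩ := hcomp.exists_clusterPt (f := map ν' F) (le_principal_iff.2 hmem)
  -- Finite measures on `K` of mass at most `C` form a compact set. A convergent integral takes the
  -- same value at all cluster points, so these share a characteristic function on a dense set and
  -- coincide.
  have huniq : ∀ {g : E → ℝ}, Continuous g → (∀ x, |g x| ≤ 1) →
      (∃ c, Tendsto (fun i => ∫ x, g x ∂ν i) F (𝓝 c)) → ∀ z : FiniteMeasure E,
      ClusterPt z (map ν' F) → ∫ x, g x ∂(z : Measure E) = ∫ x, g x ∂(y : Measure E) := by
    rintro g hg hg1 ⟨c, hc⟩ z hz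
    have h1 : ∀ z : FiniteMeasure E, ClusterPt z (map ν' F) → ∫ x, g x ∂(z : Measure E) = c := by
      intro z hz
      have h2 : ClusterPt (∫ x, g x ∂(z : Measure E)) (𝓝 c) :=
        hz.map (continuous_integral_finiteMeasure hg hg1).continuousAt (tendsto_map'_iff.2 hc)
      have : NeBot (𝓝 (∫ x, g x ∂(z : Measure E)) ⊓ 𝓝 c) := h2
      exact eq_of_nhds_neBot this
    rw [h1 z hz, h1 y hy]
  have hlim : Tendsto ν' F (𝓝 y) := by
    refine hcomp.le_nhds_of_unique_clusterPt hmem fun z _ hz => ?_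
    refine FiniteMeasure.toMeasure_injective (ext_of_integral_trig ht (fun n => ?_) fun n => ?_)
    · exact huniq (by fun_prop) (fun x => Real.abs_cos_le_one _) (hcos n) z hz
    · exact huniq (by fun_prop) (fun x => Real.abs_sin_le_one _) (hsin n) z hz
  exact ⟨y, inferInstance, FiniteMeasure.tendsto_iff_forall_lintegral_tendsto.1 hlim⟩

end Weak

/-! ### Measurable weak limits -/

section MeasurableLimit

variable {Ω E : Type*} [MeasurableSpace Ω] [PseudoEMetricSpace E] [MeasurableSpace E]
  [BorelSpace E]

/-- Thickened indicators approximate closed sets from above, and the closed sets form a generating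
π-system. -/
lemma measurable_of_measurable_lintegral {N : Ω → Measure E} [∀ w, IsFiniteMeasure (N w)]
    (h : ∀ f : E →ᵇ ℝ≥0, Measurable fun w => ∫⁻ x, f x ∂N w) : Measurable N := by
  have hclosed : ∀ s : Set E, IsClosed s → Measurable fun w => N w s := by
    intro s hs
    have h0 : ∀ n : ℕ, (0 : ℝ) < 1 / (n + 1) := fun n => Nat.one_div_pos_of_nat
    refine measurable_of_tendsto_metrizable (fun n => h (thickenedIndicator (h0 n) s))
      (tendsto_pi_nhds.2 fun w => ?_)
    exact tendsto_lintegral_thickenedIndicator_of_isClosed (N w) hs h0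
      tendsto_one_div_add_atTop_nhds_zero_nat
  refine Measurable.measure_of_isPiSystem (S := {s | IsClosed s}) ?_ isPiSystem_isClosed hclosed
    (hclosed univ isClosed_univ)
  rw [BorelSpace.measurable_eq (α := E), borel_eq_generateFrom_isClosed]

/-- An almost sure weak limit of measurable families of measures has a measurable version. -/
lemma exists_measurable_weak_limit {P : Measure Ω} {ν : ℝ → Ω → Measure E} {s : ℕ → ℝ}
    (hs : Tendsto s atTop (𝓝[>] 0))
    (hν : ∀ n, ∀ f : E →ᵇ ℝ≥0, Measurable fun w => ∫⁻ x, f x ∂ν (s n) w)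
    (h : ∀ᵐ w ∂P, ∃ N : Measure E, IsFiniteMeasure N ∧ ∀ f : E →ᵇ ℝ≥0,
      Tendsto (fun l => ∫⁻ x, f x ∂ν l w) (𝓝[>] 0) (𝓝 (∫⁻ x, f x ∂N))) :
    ∃ N : Ω → Measure E, Measurable N ∧ (∀ w, IsFiniteMeasure (N w)) ∧
      ∀ᵐ w ∂P, ∀ f : E →ᵇ ℝ≥0,
        Tendsto (fun l => ∫⁻ x, f x ∂ν l w) (𝓝[>] 0) (𝓝 (∫⁻ x, f x ∂N w)) := by
  classical
  obtain ⟨B, hBs, hBm, hB0⟩ := exists_measurable_superset_of_null (ae_iff.1 h)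
  have h' : ∀ w, w ∉ B → ∃ N : Measure E, IsFiniteMeasure N ∧ ∀ f : E →ᵇ ℝ≥0,
      Tendsto (fun l => ∫⁻ x, f x ∂ν l w) (𝓝[>] 0) (𝓝 (∫⁻ x, f x ∂N)) := fun w hw => by
    by_contra hcon
    exact hw (hBs hcon)
  set N : Ω → Measure E := fun w => if hw : w ∈ B then 0 else (h' w hw).choose with hN
  -- Setting `N` to zero on a measurable null set keeps it a pointwise limit of measurable
  -- functions.
  have hN0 : ∀ w ∈ B, N w = 0 := fun w hw => dif_pos hw
  have hN1 : ∀ w, w ∉ B → IsFiniteMeasure (N w) ∧ ∀ f : E →ᵇ ℝ≥0,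
      Tendsto (fun l => ∫⁻ x, f x ∂ν l w) (𝓝[>] 0) (𝓝 (∫⁻ x, f x ∂N w)) := fun w hw => by
    have : N w = (h' w hw).choose := dif_neg hw
    rw [this]
    exact (h' w hw).choose_spec
  have hNf : ∀ w, IsFiniteMeasure (N w) := fun w => by
    by_cases hw : w ∈ B
    · rw [hN0 w hw]
      infer_instance
    · exact (hN1 w hw).1
  refine ⟨N, measurable_of_measurable_lintegral fun f => ?_, hNf, ?_⟩
  · refine measurable_of_tendsto_metrizable (fun n => (hν n f).indicator hBm.compl)
      (tendsto_pi_nhds.2 fun w => ?_)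
    by_cases hw : w ∈ B
    · simp [hN0 w hw, hw]
    · simp only [indicator_of_mem (show w ∈ Bᶜ from hw)]
      exact ((hN1 w hw).2 f).comp hs
  · have : ∀ᵐ w ∂P, w ∉ B := measure_eq_zero_iff_ae_notMem.1 hB0
    exact this.mono fun w hw => (hN1 w hw).2

end MeasurableLimit

lemma IsChaosLimit.ae_eq {Ω E : Type*} [MeasurableSpace Ω] [TopologicalSpace E]
    [HasOuterApproxClosed E] [MeasurableSpace E] [BorelSpace E] {P : Measure Ω} {κ : Measure E}
    {om : ℝ → E → Ω → ℝ} {N N' : Ω → Measure E} (h : IsChaosLimit P κ om N)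
    (h' : IsChaosLimit P κ om N') : N =ᵐ[P] N' := by
  filter_upwards [h.finite, h.tendsto, h'.tendsto] with w _ h1 h2
  exact ext_of_forall_lintegral_eq_of_IsFiniteMeasure fun f => tendsto_nhds_unique (h1 f) (h2 f)


/-! ### The limit of the chaos of a martingale field -/

lemma lintegral_chaos {Ω E : Type*} [MeasurableSpace E] {κ : Measure E} {om : ℝ → E → Ω → ℝ}
    {l : ℝ} {w : Ω} (h : Measurable fun x => Real.exp (om l x w)) {g : E → ℝ≥0∞}
    (hg : Measurable g) :
    ∫⁻ x, g x ∂chaos κ om l w = ∫⁻ x, g x * ENNReal.ofReal (Real.exp (om l x w)) ∂κ := by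
  have h' : Measurable fun x => ENNReal.ofReal (Real.exp (om l x w)) :=
    ENNReal.measurable_ofReal.comp h
  rw [chaos, lintegral_withDensity_eq_lintegral_mul _ h' hg]
  exact lintegral_congr fun x => mul_comm _ _

lemma integral_chaos {Ω E : Type*} [MeasurableSpace E] {κ : Measure E} {om : ℝ → E → Ω → ℝ}
    {l : ℝ} {w : Ω} (h : Measurable fun x => Real.exp (om l x w)) (g : E → ℝ) :
    ∫ x, g x ∂chaos κ om l w = chaosInt κ om g l w := by
  have h' : Measurable fun x => ENNReal.ofReal (Real.exp (om l x w)) :=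
    ENNReal.measurable_ofReal.comp h
  rw [chaos, integral_withDensity_eq_integral_toReal_smul h'
    (ae_of_all _ fun x => ENNReal.ofReal_lt_top)]
  refine integral_congr_ae (ae_of_all _ fun x => ?_)
  simp only
  rw [ENNReal.toReal_ofReal (Real.exp_pos _).le, smul_eq_mul, mul_comm]

namespace IsMartingaleField

section General

variable {Ω E : Type*} [mΩ : MeasurableSpace Ω] [MeasurableSpace E] {P : Measure Ω}
  {κ : Measure E} {T : ℝ} {om : ℝ → E → Ω → ℝ} {ℱ : Filtration (Ioo (0 : ℝ) T)ᵒᵈ mΩ} {f : E → ℝ}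
  {c : ℝ} (hF : IsMartingaleField P κ T om ℱ)
include hF

lemma measurable_exp_left {l : ℝ} (hl : l ∈ Ioo 0 T) (w : Ω) :
    Measurable fun x => Real.exp (om l x w) :=
  (hF.measurable_exp hl).comp measurable_prodMk_right

lemma chaos_real_eq {l : ℝ} (hl : l ∈ Ioo 0 T) {A : Set E} (hA : MeasurableSet A) (w : Ω) :
    (chaos κ om l w).real A = chaosInt κ om (A.indicator 1) l w := by
  rw [← integral_chaos (hF.measurable_exp_left hl w), integral_indicator_one hA]

variable [IsProbabilityMeasure P] [IsProbabilityMeasure κ]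

lemma ae_isFiniteMeasure_chaos : ∀ᵐ w ∂P, ∀ l ∈ Ioo 0 T, IsFiniteMeasure (chaos κ om l w) := by
  filter_upwards [hF.ae_integrable_and_continuousWithinAt] with w hw l hl
  exact isFiniteMeasure_withDensity_ofReal (hw l hl).1.2

/-- For each `A`, the mass of `A` converges almost surely, to a variable of mean `κ A`. -/
lemma exists_limit_chaos (hT : 0 < T) {A : Set E} (hA : MeasurableSet A) :
    ∃ X : Ω → ℝ≥0∞, (∀ᵐ w ∂P, Tendsto (fun l => chaos κ om l w A) (𝓝[>] 0) (𝓝 (X w))) ∧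
      ∫⁻ w, X w ∂P = κ A := by
  obtain ⟨X, hXi, hX, hXe, -⟩ := hF.exists_limit_chaosInt (f := A.indicator 1) (c := 1) hT
    (measurable_one.indicator hA) fun x => by
      by_cases hx : x ∈ A <;> simp [hx]
  refine ⟨fun w => ENNReal.ofReal (X w), ?_, ?_⟩
  · filter_upwards [hX, hF.ae_isFiniteMeasure_chaos] with w hw hfin
    refine ((ENNReal.continuous_ofReal.tendsto _).comp hw).congr' ?_
    filter_upwards [Ioo_mem_nhdsGT hT] with l hl
    have := hfin l hl
    rw [Function.comp_apply, ← hF.chaos_real_eq hl hA, ofReal_measureReal]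
  · have h0 : 0 ≤ᵐ[P] X := by
      filter_upwards [hX] with w hw
      refine ge_of_tendsto' hw fun l => integral_nonneg fun x => ?_
      exact mul_nonneg (indicator_nonneg (fun _ _ => zero_le_one) _) (Real.exp_pos _).le
    rw [← ofReal_integral_eq_lintegral_ofReal hXi h0, hXe, integral_indicator_one hA,
      ofReal_measureReal]

/-- All these variables are conditional expectations of one integrable limit. -/
lemma uniformIntegrable_chaosInt (hT : 0 < T) (hf : Measurable f) (hfc : ∀ x, |f x| ≤ c) :
    UniformIntegrable (fun l : Ioo (0 : ℝ) T => chaosInt κ om f l.1) 1 P := by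
  obtain ⟨X, hX, -, -, h⟩ := hF.exists_limit_chaosInt hT hf hfc
  exact (hX.uniformIntegrable_condExp
    (ℱ := fun l : Ioo (0 : ℝ) T => (ℱ (OrderDual.toDual l) : MeasurableSpace Ω))
    fun l => ℱ.le _).ae_eq fun l => h (OrderDual.toDual l)

end General

variable {Ω E : Type*} [mΩ : MeasurableSpace Ω] [NormedAddCommGroup E] [InnerProductSpace ℝ E]
  [CompleteSpace E] [SecondCountableTopology E] [MeasurableSpace E] [BorelSpace E]
  {P : Measure Ω} [IsProbabilityMeasure P] {κ : Measure E} [IsProbabilityMeasure κ] {T : ℝ}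
  {om : ℝ → E → Ω → ℝ} {ℱ : Filtration (Ioo (0 : ℝ) T)ᵒᵈ mΩ} {N : Ω → Measure E}
  (hF : IsMartingaleField P κ T om ℱ)
include hF

lemma ae_exists_weak_limit (hT : 0 < T) {K : Set E} (hK : IsCompact K) (hκK : κ Kᶜ = 0) :
    ∀ᵐ w ∂P, ∃ N : Measure E, IsFiniteMeasure N ∧ ∀ f : E →ᵇ ℝ≥0,
      Tendsto (fun l => ∫⁻ x, f x ∂chaos κ om l w) (𝓝[>] 0) (𝓝 (∫⁻ x, f x ∂N)) := by
  set t : ℕ → E := TopologicalSpace.denseSeq E with ht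
  have hcos : ∀ᵐ w ∂P, ∀ n, ∃ y, Tendsto
      (fun l => chaosInt κ om (fun x => Real.cos (inner ℝ x (t n))) l w) (𝓝[>] 0) (𝓝 y) :=
    ae_all_iff.2 fun n => hF.ae_exists_tendsto_chaosInt hT (by fun_prop)
      fun x => Real.abs_cos_le_one _
  have hsin : ∀ᵐ w ∂P, ∀ n, ∃ y, Tendsto
      (fun l => chaosInt κ om (fun x => Real.sin (inner ℝ x (t n))) l w) (𝓝[>] 0) (𝓝 y) :=
    ae_all_iff.2 fun n => hF.ae_exists_tendsto_chaosInt hT (by fun_prop)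
      fun x => Real.abs_sin_le_one _
  have hXlt : ∀ᵐ w ∂P, ∃ C : ℝ≥0, ∀ᶠ l in 𝓝[>] 0, chaos κ om l w univ ≤ C := by
    obtain ⟨Y, hYi, hY, -, -⟩ := hF.exists_limit_chaosInt (f := univ.indicator 1) (c := 1) hT
      (measurable_one.indicator MeasurableSet.univ) fun x => by simp
    filter_upwards [hY, hF.ae_isFiniteMeasure_chaos] with w hw hfin
    refine ⟨(Y w + 1).toNNReal, ?_⟩
    filter_upwards [hw.eventually (ge_mem_nhds (lt_add_one (Y w))), Ioo_mem_nhdsGT hT] with l h hl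
    have := hfin l hl
    rw [← hF.chaos_real_eq hl MeasurableSet.univ] at h
    rw [← ofReal_measureReal]
    exact ENNReal.ofReal_le_ofReal h
  filter_upwards [hcos, hsin, hXlt, hF.ae_isFiniteMeasure_chaos] with w h1 h2 ⟨C, h3⟩ hfin
  classical
  -- The compactness argument wants finite measures for every index; the values outside `(0, T)` do
  -- not affect the limit.
  set ν : ℝ → Measure E := fun l => if l ∈ Ioo 0 T then chaos κ om l w else 0 with hν
  have hev : ∀ᶠ l in 𝓝[>] (0 : ℝ), l ∈ Ioo 0 T := Ioo_mem_nhdsGT hT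
  have hνe : ∀ l ∈ Ioo 0 T, ν l = chaos κ om l w := fun l hl => if_pos hl
  have hνf : ∀ l, IsFiniteMeasure (ν l) := fun l => by
    by_cases hl : l ∈ Ioo 0 T
    · rw [hνe l hl]
      exact hfin l hl
    · simp only [hν, if_neg hl]
      infer_instance
  have hνK : ∀ l, ν l Kᶜ = 0 := fun l => by
    by_cases hl : l ∈ Ioo 0 T
    · rw [hνe l hl]
      exact withDensity_absolutelyContinuous _ _ hκK
    · simp only [hν, if_neg hl]
      rfl
  have htrig : ∀ g : E → ℝ, (∃ y, Tendsto (fun l => chaosInt κ om g l w) (𝓝[>] 0) (𝓝 y)) →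
      ∃ y, Tendsto (fun l => ∫ x, g x ∂ν l) (𝓝[>] 0) (𝓝 y) := by
    rintro g ⟨y, hy⟩
    refine ⟨y, hy.congr' (hev.mono fun l hl => ?_)⟩
    simp only
    rw [hνe l hl, integral_chaos (hF.measurable_exp_left hl w)]
  obtain ⟨N, hN, hlim⟩ := exists_weak_limit (F := 𝓝[>] 0) hK hνK (C := C)
    (by filter_upwards [h3, hev] with l h hl; rwa [hνe l hl])
    (TopologicalSpace.denseRange_denseSeq E) (fun n => htrig _ (h1 n)) fun n => htrig _ (h2 n)
  refine ⟨N, hN, fun f => (hlim f).congr' (hev.mono fun l hl => ?_)⟩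
  simp only
  rw [hνe l hl]

theorem exists_isChaosLimit (hT : 0 < T) {K : Set E} (hK : IsCompact K) (hκK : κ Kᶜ = 0) :
    ∃ N : Ω → Measure E, Measurable N ∧ IsChaosLimit P κ om N := by
  set s : ℕ → ℝ := fun n => T / (n + 2) with hs
  have hsT : ∀ n, s n ∈ Ioo 0 T := fun n =>
    ⟨by positivity, div_lt_self hT (by linarith [n.cast_nonneg (α := ℝ)])⟩
  have hs0 : Tendsto s atTop (𝓝[>] 0) := by
    refine tendsto_nhdsWithin_iff.2 ⟨?_, Eventually.of_forall fun n => (hsT n).1⟩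
    exact tendsto_const_nhds.div_atTop
      (tendsto_atTop_add_const_right _ _ tendsto_natCast_atTop_atTop)
  have hm : ∀ n, ∀ f : E →ᵇ ℝ≥0, Measurable fun w => ∫⁻ x, f x ∂chaos κ om (s n) w := by
    intro n f
    have hf : Measurable fun x => (f x : ℝ≥0∞) :=
      measurable_coe_nnreal_ennreal.comp f.continuous.measurable
    simp_rw [fun w => lintegral_chaos (κ := κ) (hF.measurable_exp_left (hsT n) w) hf]
    have : Measurable fun p : Ω × E =>
        (f p.2 : ℝ≥0∞) * ENNReal.ofReal (Real.exp (om (s n) p.2 p.1)) :=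
      (hf.comp measurable_snd).mul
        (ENNReal.measurable_ofReal.comp ((hF.measurable_exp (hsT n)).comp measurable_swap))
    exact this.lintegral_prod_right'
  obtain ⟨N, hN, hNf, hlim⟩ := exists_measurable_weak_limit hs0 hm
    (hF.ae_exists_weak_limit hT hK hκK)
  exact ⟨N, hN, ae_of_all _ hNf, hlim⟩

omit [InnerProductSpace ℝ E] [CompleteSpace E] [SecondCountableTopology E] [BorelSpace E] in
lemma lintegral_limit_univ (hT : 0 < T) (hN : IsChaosLimit P κ om N) :
    ∫⁻ w, N w univ ∂P = 1 := by
  obtain ⟨X, hX, hXe⟩ := hF.exists_limit_chaos hT MeasurableSet.univ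
  rw [measure_univ] at hXe
  rw [← hXe]
  refine lintegral_congr_ae ?_
  filter_upwards [hX, hN.tendsto] with w h1 h2
  have h3 := h2 1
  simp only [BoundedContinuousFunction.coe_one, Pi.one_apply, ENNReal.coe_one,
    lintegral_one] at h3
  exact tendsto_nhds_unique h3 h1

omit [InnerProductSpace ℝ E] [CompleteSpace E] [SecondCountableTopology E] in
-- Continuous functions above the indicator of `K`, decreasing to it, show that the limit of the
-- masses of `K` is at most `N(K)`; that limit has mean `κ(K)` by `L¹` convergence.
lemma le_lintegral_limit_of_isClosed (hT : 0 < T) (hN : IsChaosLimit P κ om N) {K : Set E}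
    (hK : IsClosed K) : κ K ≤ ∫⁻ w, N w K ∂P := by
  obtain ⟨X, hX, hXe⟩ := hF.exists_limit_chaos hT hK.measurableSet
  rw [← hXe]
  refine lintegral_mono_ae ?_
  filter_upwards [hX, hN.tendsto, hN.finite] with w h1 h2 hfin
  have h0 : ∀ n : ℕ, (0 : ℝ) < 1 / (n + 1) := fun n => Nat.one_div_pos_of_nat
  refine ge_of_tendsto' (tendsto_lintegral_thickenedIndicator_of_isClosed (N w) hK h0
    tendsto_one_div_add_atTop_nhds_zero_nat) fun n => ?_
  refine le_of_tendsto_of_tendsto' h1 (h2 (thickenedIndicator (h0 n) K)) fun l => ?_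
  rw [← lintegral_indicator_one hK.measurableSet]
  refine lintegral_mono fun x => ?_
  by_cases hx : x ∈ K
  · rw [indicator_of_mem hx, Pi.one_apply]
    exact ENNReal.one_le_coe_iff.2 (one_le_thickenedIndicator_apply E (h0 n) hx)
  · rw [indicator_of_notMem hx]
    exact zero_le

omit [InnerProductSpace ℝ E] in
theorem lintegral_limit_eq_one (hT : 0 < T) (hN : IsChaosLimit P κ om N) {B : Set E}
    (hB : MeasurableSet B) (hκB : κ B = 1) : ∫⁻ w, N w B ∂P = 1 := by
  refine le_antisymm ?_ ?_
  · rw [← hF.lintegral_limit_univ hT hN]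
    exact lintegral_mono fun w => measure_mono (subset_univ _)
  · rw [← hκB, hB.measure_eq_iSup_isCompact]
    refine iSup_le fun K => iSup_le fun hKB => iSup_le fun hK => ?_
    exact (hF.le_lintegral_limit_of_isClosed hT hN hK.isClosed).trans
      (lintegral_mono fun w => measure_mono hKB)

end IsMartingaleField
end MRM

end

/-! ### The main statement, by specialization to the indicator of `B`. -/

theorem mainTheorem7
    {m : ℕ} [NeZero m] {T R α : ℝ} (hT : 0 < T) (hR : 0 < R) (hα : 0 < α)
    -- the exponents: normalization and moment conditions
    (L : MRM.LevyTriplet) (hψ1 : L.ψ 1 = 0) (hψ2 : L.PsiFinite 2)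
    (hν : ∫⁻ x in Icc (-1) 1, ENNReal.ofReal |x| ∂L.ν < ∞)
    -- the normalized right-invariant Haar measure on the orthogonal group
    (H : Measure (MRM.G m)) [IsProbabilityMeasure H] [H.IsMulRightInvariant]
    -- the random measure and the process `ω_l(x)`
    {Ω : Type*} [MeasurableSpace Ω] (P : Measure Ω) [IsProbabilityMeasure P]
    (μ : Set (MRM.G m × MRM.S) → Ω → ℝ)
    (hμ : MRM.IsIndepScattered P L.φ (H.prod MRM.θ) μ)
    (om : ℝ → EuclideanSpace ℝ (Fin m) → Ω → ℝ) (hom : MRM.IsOmega P T μ om)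
    -- the measure `κ`, supported by the Borel set `B` of the closed ball of radius `R`
    (B : Set (EuclideanSpace ℝ (Fin m))) (hB : MeasurableSet B)
    (hBR : B ⊆ Metric.closedBall 0 R)
    (κ : Measure (EuclideanSpace ℝ (Fin m))) [IsProbabilityMeasure κ] (hκB : κ B = 1)
    (hκ : MRM.ClassRe α B κ) (hψα : L.ψ 2 < α) :
    -- `(N_l(B))_l` is a martingale, as `l` decreases from `T` to `0`
    (∃ ℱ : Filtration (Ioo (0 : ℝ) T)ᵒᵈ ‹MeasurableSpace Ω›,
      Martingale (fun (l : (Ioo (0 : ℝ) T)ᵒᵈ) (w : Ω) =>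
        (MRM.chaos κ om (OrderDual.ofDual l : Ioo (0 : ℝ) T).1 w).real B) ℱ P) ∧
    -- it is uniformly integrable
    UniformIntegrable (fun (l : Ioo (0 : ℝ) T) (w : Ω) => (MRM.chaos κ om l.1 w).real B) 1 P ∧
    -- the limit exists as a random measure
    (∃ N : Ω → Measure (EuclideanSpace ℝ (Fin m)), Measurable N ∧ MRM.IsChaosLimit P κ om N) ∧
    -- it is non-trivial and almost surely supported by `B`
    (∀ N : Ω → Measure (EuclideanSpace ℝ (Fin m)), MRM.IsChaosLimit P κ om N →
      (∫⁻ w, N w B ∂P) = 1 ∧ ¬ (∀ᵐ w ∂P, N w = 0) ∧ ∀ᵐ w ∂P, N w Bᶜ = 0) := by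
  have hκ0 : κ Bᶜ = 0 := (prob_compl_eq_zero_iff hB).2 hκB
  have hκR : κ (Metric.closedBall 0 R)ᶜ = 0 := measure_mono_null (compl_subset_compl.2 hBR) hκ0
  have hF := MRM.isMartingaleField (H := H) hμ hom hψ1 hψ2 hν hα hκ0 hκ hψα
  have hB1 : ∀ x, |B.indicator (1 : EuclideanSpace ℝ (Fin m) → ℝ) x| ≤ 1 := fun x => by
    by_cases hx : x ∈ B <;> simp [hx]
  have hreal : ∀ l ∈ Ioo 0 T, (fun w => (MRM.chaos κ om l w).real B) =
      MRM.chaosInt κ om (B.indicator 1) l := fun l hl => funext fun w => hF.chaos_real_eq hl hB w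
  refine ⟨⟨MRM.scaleFiltration P H μ T, ?_⟩, ?_,
    hF.exists_isChaosLimit hT (isCompact_closedBall 0 R) hκR, fun N hN => ?_⟩
  · have e : (fun (l : (Ioo (0 : ℝ) T)ᵒᵈ) (w : Ω) =>
        (MRM.chaos κ om (OrderDual.ofDual l : Ioo (0 : ℝ) T).1 w).real B) = fun l =>
        MRM.chaosInt κ om (B.indicator 1) (OrderDual.ofDual l).1 :=
      funext fun l => hreal _ (OrderDual.ofDual l).2
    rw [e]
    exact hF.martingale_chaosInt (measurable_one.indicator hB) hB1
  · have e : (fun (l : Ioo (0 : ℝ) T) (w : Ω) => (MRM.chaos κ om l.1 w).real B) =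
        fun l => MRM.chaosInt κ om (B.indicator 1) l.1 := funext fun l => hreal _ l.2
    rw [e]
    exact hF.uniformIntegrable_chaosInt hT (measurable_one.indicator hB) hB1
  · have hNB : ∫⁻ w, N w B ∂P = 1 := hF.lintegral_limit_eq_one hT hN hB hκB
    refine ⟨hNB, fun h0 => ?_, ?_⟩
    · have : ∫⁻ w, N w B ∂P = 0 := by
        have h1 : (fun w => N w B) =ᵐ[P] 0 := by
          filter_upwards [h0] with w hw
          rw [hw]
          rfl
        rw [lintegral_congr_ae h1]
        exact lintegral_zero
      rw [hNB] at this
      exact one_ne_zero this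
    -- The given `N` need not be measurable in `w`. A measurable version, almost surely equal to it,
    -- allows the total mean mass `1` to be split between `B` and its complement.
    · obtain ⟨N', hN'm, hN'⟩ := hF.exists_isChaosLimit hT (isCompact_closedBall 0 R) hκR
      have hB' : ∫⁻ w, N' w B ∂P = 1 := hF.lintegral_limit_eq_one hT hN' hB hκB
      have hm : ∀ {A}, MeasurableSet A → Measurable fun w => N' w A := fun hA =>
        (Measure.measurable_coe hA).comp hN'm
      have hsum : ∫⁻ w, N' w B ∂P + ∫⁻ w, N' w Bᶜ ∂P = 1 := by
        rw [← lintegral_add_left (hm hB),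
          ← hF.lintegral_limit_univ hT hN']
        exact lintegral_congr fun w => measure_add_measure_compl hB
      have hzero : ∫⁻ w, N' w Bᶜ ∂P = 0 := by
        rw [hB'] at hsum
        exact (ENNReal.add_right_inj ENNReal.one_ne_top).1 (hsum.trans (add_zero 1).symm)
      rw [lintegral_eq_zero_iff (hm hB.compl)] at hzero
      filter_upwards [hzero, hN.ae_eq hN'] with w h1 h2
      rw [h2]
      exact h1
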